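/- **Setting.** Cover $\mathbb{CP}^1$ by the standard charts $U_0,U_1\simeq\mathbb C$ with coordinates $x$ and $y=1/x$. For $(k_1,k_2,k_3)\in\mathbb Z^3$ let $(k_1,k_2,k_3)$ also denote the split complex supermanifold of dimension $1|3$ on $\mathbb{CP}^1$ with coordinates $(x,\xi_1,\xi_2,\xi_3)$ over $U_0$, $(y,\eta_1,\eta_2,\eta_3)$ over $U_1$ and transition $y=x^{-1}$, $\eta_i=x^{-k_i}\xi_i$. Let $\mathcal T_2$ be its sheaf of vector fields of degree $2$ (locally spanned over holomorphic functions by $\xi_i\xi_j\frac{\partial}{\partial x}$ and $\xi_1\xi_2\xi_3\frac{\partial}{\partial\xi_l}$). A section $v$ of $\mathcal T_2$ over $U_0\cap U_1$ is a Čech $1$-cocycle with class $[v]\in H^1(\mathbb{CP}^1,\mathcal T_2)$, and it defines a supermanifold with retract (associated graded supermanifold) $(k_1,k_2,k_3)$ by the transition $y=(\mathrm{id}+v)(x^{-1})$, $\eta_i=(\mathrm{id}+v)(x^{-k_i}\xi_i)$; we say that any supermanifold whose structure sheaf is isomorphic to that of this one (over the identity of $\mathbb{CP}^1$) corresponds to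 $v$. A supermanifold is split if its structure sheaf is isomorphic to $\bigwedge\mathcal E$ for a holomorphic vector bundle $\mathcal E$ on $\mathbb{CP}^1$. If $k_1=k_2$, let $\mathfrak s'=\langle \mathbf e',\mathbf f',[\mathbf e',\mathbf f']\rangle$ with $\mathbf e'=\frac{\partial}{\partial x}+\xi_2\frac{\partial}{\partial\xi_1}$ and $\mathbf f'=\frac{\partial}{\partial y}+\eta_1\frac{\partial}{\partial\eta_2}$. A supermanifold with retract $(k_1,k_2,k_3)$ is called $\mathfrak s'$-even-homogeneous if it corresponds to a cocycle $v$ with $[u,v]=0$ in $H^1(\mathbb{CP}^1,\mathcal T_2)$ for all $u\in\mathfrak s'$. **Theorem** (Classification of $\mathfrak s'$-even-homogeneous supermanifolds). 1. There exist exactly two, up to isomorphism, $\mathfrak s'$-even-homogeneous non-split supermanifolds with retract a) $(2,2,1)$; they correspond to the cocycles $$\tfrac1x\xi_1\xi_2\tfrac{\partial}{\partial x}+\tfrac{1}{2x^2}\xi_1\xi_2\xi_3\tfrac{\partial}{\partial\xi_3},\qquad \tfrac1{x^2}\xi_1\xi_2\xi_3\tfrac{\partial}{\partial\xi_2}-\tfrac1x\xi_1\xi_2\xi_3\tfrac{\partial}{\partial\xi_1};$$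 b) $(2,2,3)$; they correspond to the cocycles $$\tfrac1x\xi_1\xi_2\tfrac{\partial}{\partial x}+\tfrac{3}{2x^2}\xi_1\xi_2\xi_3\tfrac{\partial}{\partial\xi_3},\qquad \tfrac1x\xi_2\xi_3\tfrac{\partial}{\partial x}+\tfrac1{x^2}\xi_1\xi_3\tfrac{\partial}{\partial x}+\tfrac{2}{3x^2}\xi_1\xi_2\xi_3\tfrac{\partial}{\partial\xi_1}-\tfrac{4}{3x^3}\xi_1\xi_2\xi_3\tfrac{\partial}{\partial\xi_2}.$$ 2. There exists a unique, up to isomorphism, $\mathfrak s'$-even-homogeneous non-split supermanifold with retract (here $k\in\mathbb Z$) a) $(2,2,k)$, $k\neq1,3$; it corresponds to the cocycle $\frac1x\xi_1\xi_2\frac{\partial}{\partial x}+\frac{k}{2x^2}\xi_1\xi_2\xi_3\frac{\partial}{\partial\xi_3}$; b) $(k,k,3-k)$, $k\neq2$; it corresponds to the cocycle $\frac1{x^2}\xi_1\xi_2\xi_3\frac{\partial}{\partial\xi_2}-\frac1x\xi_1\xi_2\xi_3\frac{\partial}{\partial\xi_1}$; c) $(k,k,5-k)$, $k\neq2$; it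 corresponds to the cocycle $\frac1x\xi_2\xi_3\frac{\partial}{\partial x}+\frac1{x^2}\xi_1\xi_3\frac{\partial}{\partial x}+\frac{k}{3x^2}\xi_1\xi_2\xi_3\frac{\partial}{\partial\xi_1}-\frac{2k}{3x^3}\xi_1\xi_2\xi_3\frac{\partial}{\partial\xi_2}$; d) $(1,1,0)$; it corresponds to the cocycle $\frac1x\xi_1\xi_2\xi_3\frac{\partial}{\partial\xi_3}$. Here the listed supermanifolds are pairwise non-isomorphic even with respect to isomorphisms that induce an arbitrary self-map of $\mathbb{CP}^1$, and every non-split $\mathfrak s'$-even-homogeneous supermanifold with the given retract is isomorphic to a listed one by an isomorphism inducing the identity of $\mathbb{CP}^1$. -/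

import Mathlib

open scoped OnePoint
open TopologicalSpace

noncomputable section

namespace SuperCP1

/-! ### Superfunctions in the odd variables `ξ₁, ξ₂, ξ₃`

The indices `0, 1, 2 : Fin 3` stand for `1, 2, 3`. -/

/-- The Grassmann algebra in three odd generators over `ℂ`. -/
abbrev Grassmann : Type := ExteriorAlgebra ℂ (Fin 3 → ℂ)

/-- The odd generators. -/
def ξ (i : Fin 3) : Grassmann := ExteriorAlgebra.ι ℂ (Pi.single i 1)

/-- The standard monomial basis of the Grassmann algebra. -/
def monomialBasis : Module.Basis (Finset (Fin 3)) ℂ Grassmann :=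
  (Pi.basisFun ℂ (Fin 3)).ExteriorAlgebra

/-- The even (`p = 0`) and the odd (`p = 1`) part of the Grassmann algebra. -/
def parityPart (p : ZMod 2) : Submodule ℂ Grassmann :=
  CliffordAlgebra.evenOdd (0 : QuadraticForm ℂ (Fin 3 → ℂ)) p

/-- A superfunction `F = ∑ F_S(x) ξ_S` has coefficients that are complex differentiable at `z`. -/
def DiffAt (F : ℂ → Grassmann) (z : ℂ) : Prop :=
  ∀ S, DifferentiableAt ℂ (fun t => monomialBasis.repr (F t) S) z

/-- `∂F/∂x` at `z`. -/
def dX (F : ℂ → Grassmann) (z : ℂ) : Grassmann :=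
  ∑ S, deriv (fun t => monomialBasis.repr (F t) S) z • monomialBasis S

/-- The (left) odd derivative `∂/∂ξ_i` on the Grassmann algebra: contraction with the `i`-th
coordinate form. -/
def dXi (i : Fin 3) : Grassmann →ₗ[ℂ] Grassmann :=
  CliffordAlgebra.contractLeft (Q := (0 : QuadraticForm ℂ (Fin 3 → ℂ)))
    (LinearMap.proj i : (Fin 3 → ℂ) →ₗ[ℂ] ℂ)

/-! ### Even vector fields -/

/-- The coefficients of an even vector field
`X = X none ∂/∂x + ∑ i, X (some i) ∂/∂ξ_i`
in one chart; only the values on the domain of the field are meaningful. -/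
abbrev EvenVF : Type := Option (Fin 3) → ℂ → Grassmann

/-- The vector field `a ∂/∂x + ∑ i, b i ∂/∂ξ_i`. -/
def vf (a : ℂ → Grassmann) (b : Fin 3 → ℂ → Grassmann) : EvenVF := fun o => o.elim a b

/-- The value at `z` of the derivative of `F` along `X`. -/
def app (X : EvenVF) (F : ℂ → Grassmann) (z : ℂ) : Grassmann :=
  X none z * dX F z + ∑ i, X (some i) z * dXi i (F z)

/-- The Lie bracket `[X, Y] = XY - YX` of two even vector fields: the coefficient of
`∂/∂c` is `X(Y(c)) - Y(X(c))` for each coordinate `c`. -/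
def bracket (X Y : EvenVF) : EvenVF := fun o z => app X (Y o) z - app Y (X o) z

/-- `X` is a holomorphic section over `W` of the sheaf `𝒯₂` of (even) vector fields of degree 2:
it raises the degree in the odd variables by two. -/
structure IsT2 (X : EvenVF) (W : Set ℂ) : Prop where
  diff : ∀ o, ∀ z ∈ W, DiffAt (X o) z
  deg_x : ∀ z ∈ W, X none z ∈ ⋀[ℂ]^2 (Fin 3 → ℂ)
  deg_ξ : ∀ i, ∀ z ∈ W, X (some i) z ∈ ⋀[ℂ]^3 (Fin 3 → ℂ)

theorem isT2_zero (W : Set ℂ) : IsT2 0 W where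
  diff _ _ _ S := by
    simp only [Pi.zero_apply, map_zero, Finsupp.coe_zero]
    exact differentiableAt_const _
  deg_x _ _ := Submodule.zero_mem _
  deg_ξ _ _ _ := Submodule.zero_mem _

/-! ### The underlying space and superfunctions on its open subsets -/

/-- The two standard charts of `ℂP¹ = ℂ ∪ {∞}`: the coordinate `x` on `U₀ = ℂ` (for `j = 0`) and the
coordinate `y = 1/x` on `U₁`, the complement of `0` (for `j = 1`), as maps from `ℂ`. -/
def chart (j : Fin 2) (z : ℂ) : OnePoint ℂ :=
  if j = 0 then (z : OnePoint ℂ) else if z = 0 then ∞ else ((z⁻¹ : ℂ) : OnePoint ℂ)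

/-- Pairs of Grassmann algebra valued functions on `U ∩ U₀` and on `U ∩ U₁`, written in the
coordinates of the two charts. -/
abbrev LocalPair (U : Opens (OnePoint ℂ)) : Type :=
  ∀ j : Fin 2, {z : ℂ // chart j z ∈ U} → Grassmann

open Classical in
/-- The member with index `j` of a pair, extended by zero. -/
def LocalPair.ext {U : Opens (OnePoint ℂ)} (f : LocalPair U) (j : Fin 2) (z : ℂ) : Grassmann :=
  if h : chart j z ∈ U then f j ⟨z, h⟩ else 0

/-! ### Supermanifolds -/

/-- The transition data of a complex supermanifold of dimension `1|3` with underlying manifold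
`ℂP¹`, which has coordinates `(x, ξ₁, ξ₂, ξ₃)` over `U₀` and `(y, η₁, η₂, η₃)` over `U₁`. On
`U₀ ∩ U₁` they are related by
`y = (id + v)(x⁻¹)`, `η_j = (id + v)(∑ i, g i j (x) ξ_i)`,
where `g` is an invertible holomorphic matrix and `v` is a vector field of degree 2. This is the
general form of an invertible parity preserving holomorphic transition over `y = x⁻¹`. -/
structure Supermanifold where
  g : ℂ → Matrix (Fin 3) (Fin 3) ℂ
  v : EvenVF
  g_diff : ∀ i j, ∀ x ∈ ({0}ᶜ : Set ℂ), DifferentiableAt ℂ (fun t => g t i j) x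
  g_unit : ∀ x ∈ ({0}ᶜ : Set ℂ), IsUnit (g x).det
  v_mem : IsT2 v {0}ᶜ

/-- The substitution `F(y, η) ↦ F(x⁻¹, g(x) ξ)`, i.e. `y = x⁻¹`, `η_j = ∑ i, g i j (x) ξ_i`. -/
def subst (g : ℂ → Matrix (Fin 3) (Fin 3) ℂ) (F : ℂ → Grassmann) (x : ℂ) : Grassmann :=
  ExteriorAlgebra.map (Matrix.toLin' (g x)) (F x⁻¹)

/-- A superfunction `F(y, η)` rewritten in the coordinates `(x, ξ)`. -/
def Supermanifold.trans (M : Supermanifold) (F : ℂ → Grassmann) (x : ℂ) : Grassmann :=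
  subst M.g F x + app M.v (subst M.g F) x

/-! #### Auxiliary facts on derivatives -/

/-- Derivative of a Grassmann algebra valued function, tested on linear forms. -/
def HasD (F : ℂ → Grassmann) (A : Grassmann) (z : ℂ) : Prop :=
  ∀ l : Grassmann →ₗ[ℂ] ℂ, HasDerivAt (fun t => l (F t)) (l A) z

theorem apply_eq_sum (l : Grassmann →ₗ[ℂ] ℂ) (a : Grassmann) :
    l a = ∑ S, monomialBasis.repr a S * l (monomialBasis S) := by
  conv_lhs => rw [← monomialBasis.sum_repr a]
  simp only [map_sum, map_smul, smul_eq_mul]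

theorem DiffAt.hasD {F : ℂ → Grassmann} {z : ℂ} (h : DiffAt F z) : HasD F (dX F z) z := by
  intro l
  have e : (fun t => l (F t)) =
      fun t => ∑ S, monomialBasis.repr (F t) S * l (monomialBasis S) :=
    funext fun t => apply_eq_sum l (F t)
  rw [e, dX, map_sum]
  simp only [map_smul, smul_eq_mul]
  exact HasDerivAt.fun_sum fun S _ => (h S).hasDerivAt.mul_const _

theorem HasD.coord {F : ℂ → Grassmann} {A : Grassmann} {z : ℂ} (h : HasD F A z)
    (S : Finset (Fin 3)) :
    HasDerivAt (fun t => monomialBasis.repr (F t) S) (monomialBasis.repr A S) z :=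
  h (monomialBasis.coord S)

theorem HasD.diffAt {F : ℂ → Grassmann} {A : Grassmann} {z : ℂ} (h : HasD F A z) :
    DiffAt F z := fun S => (h.coord S).differentiableAt

theorem HasD.dX_eq {F : ℂ → Grassmann} {A : Grassmann} {z : ℂ} (h : HasD F A z) :
    dX F z = A := by
  rw [dX]
  conv_rhs => rw [← monomialBasis.sum_repr A]
  exact Finset.sum_congr rfl fun S _ => by rw [(h.coord S).deriv]

theorem HasD.add {F G : ℂ → Grassmann} {A B : Grassmann} {z : ℂ} (hF : HasD F A z)
    (hG : HasD G B z) : HasD (F + G) (A + B) z := by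
  intro l
  have e : (fun t => l ((F + G) t)) = (fun t => l (F t)) + fun t => l (G t) :=
    funext fun t => l.map_add _ _
  rw [e, map_add]
  exact (hF l).add (hG l)

theorem hasD_const (a : Grassmann) (z : ℂ) : HasD (fun _ => a) 0 z := by
  intro l
  rw [map_zero]
  exact hasDerivAt_const z (l a)

theorem HasD.mul {F G : ℂ → Grassmann} {A B : Grassmann} {z : ℂ} (hF : HasD F A z)
    (hG : HasD G B z) : HasD (F * G) (A * G z + F z * B) z := by
  intro l
  have e : ∀ a b : Grassmann, l (a * b) =
      ∑ S, monomialBasis.repr a S * l (monomialBasis S * b) := fun a b => by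
    have := apply_eq_sum (l ∘ₗ LinearMap.mulRight ℂ b) a
    simpa using this
  have h : HasDerivAt
      (fun t => ∑ S, monomialBasis.repr (F t) S * l (monomialBasis S * G t))
      (∑ S, (monomialBasis.repr A S * l (monomialBasis S * G z) +
        monomialBasis.repr (F z) S * l (monomialBasis S * B))) z :=
    HasDerivAt.fun_sum fun S _ =>
      (hF.coord S).mul (hG (l ∘ₗ LinearMap.mulLeft ℂ (monomialBasis S)))
  rw [map_add, e, e, ← Finset.sum_add_distrib]
  have e' : (fun t => l ((F * G) t)) =
      fun t => ∑ S, monomialBasis.repr (F t) S * l (monomialBasis S * G t) :=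
    funext fun t => e (F t) (G t)
  rw [e']
  exact h

theorem HasD.smul {f : ℂ → ℂ} {f' : ℂ} {G : ℂ → Grassmann} {B : Grassmann} {z : ℂ}
    (hf : HasDerivAt f f' z) (hG : HasD G B z) :
    HasD (fun t => f t • G t) (f' • G z + f z • B) z := by
  intro l
  have e : (fun t => l (f t • G t)) = f * fun t => l (G t) := funext fun t => l.map_smul _ _
  rw [e, map_add, map_smul, map_smul, smul_eq_mul, smul_eq_mul]
  exact hf.mul (hG l)

theorem DiffAt.add {F G : ℂ → Grassmann} {z : ℂ} (hF : DiffAt F z) (hG : DiffAt G z) :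
    DiffAt (F + G) z := (hF.hasD.add hG.hasD).diffAt

theorem DiffAt.mul {F G : ℂ → Grassmann} {z : ℂ} (hF : DiffAt F z) (hG : DiffAt G z) :
    DiffAt (F * G) z := (hF.hasD.mul hG.hasD).diffAt

theorem DiffAt.congr {F G : ℂ → Grassmann} {z : ℂ} (hF : DiffAt F z) (h : G =ᶠ[nhds z] F) :
    DiffAt G z := fun S =>
  (hF S).congr_of_eventuallyEq (h.mono fun t ht => by simp only [ht])

theorem dX_congr {F G : ℂ → Grassmann} {z : ℂ} (h : G =ᶠ[nhds z] F) : dX G z = dX F z := by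
  simp only [dX]
  refine Finset.sum_congr rfl fun S _ => ?_
  congr 1
  exact Filter.EventuallyEq.deriv_eq (h.mono fun t ht => by simp only [ht])

theorem app_congr (X : EvenVF) {F G : ℂ → Grassmann} {z : ℂ} (h : G =ᶠ[nhds z] F) :
    app X G z = app X F z := by
  simp only [app, dX_congr h, h.eq_of_nhds]

theorem diffAt_sum {ι : Type} (s : Finset ι) {F : ι → ℂ → Grassmann} {z : ℂ}
    (h : ∀ i ∈ s, DiffAt (F i) z) : DiffAt (fun t => ∑ i ∈ s, F i t) z := by
  intro S
  simp only [map_sum, Finsupp.coe_finsetSum, Finset.sum_apply]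
  exact DifferentiableAt.fun_sum fun i hi => h i hi S

/-! #### Auxiliary facts on the substitution and on the transition -/

theorem Supermanifold.diffAt_map (M : Supermanifold) {x : ℂ} (hx : x ≠ 0) (a : Grassmann) :
    DiffAt (fun t => ExteriorAlgebra.map (Matrix.toLin' (M.g t)) a) x := by
  induction a using ExteriorAlgebra.induction with
  | algebraMap r =>
    simp only [AlgHom.commutes]
    exact (hasD_const _ x).diffAt
  | ι m =>
    have e : (fun t => ExteriorAlgebra.map (Matrix.toLin' (M.g t)) (ExteriorAlgebra.ι ℂ m)) =
        fun t => ∑ i, (∑ j, M.g t i j * m j) • ξ i := by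
      funext t
      rw [ExteriorAlgebra.map_apply_ι, Matrix.toLin'_apply]
      conv_lhs => rw [← Finset.univ_sum_single (Matrix.mulVec (M.g t) m)]
      rw [map_sum]
      refine Finset.sum_congr rfl fun i _ => ?_
      rw [ξ, ← map_smul]
      congr 1
      rw [← Pi.single_smul]
      simp [Matrix.mulVec, dotProduct]
    rw [e]
    refine diffAt_sum _ fun i _ => ?_
    have hd : DifferentiableAt ℂ (fun t => ∑ j, M.g t i j * m j) x :=
      DifferentiableAt.fun_sum fun j _ => (M.g_diff i j x hx).mul_const _
    exact (HasD.smul hd.hasDerivAt (hasD_const (ξ i) x)).diffAt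
  | mul a b ha hb =>
    simp only [map_mul]
    exact ha.mul hb
  | add a b ha hb =>
    simp only [map_add]
    exact ha.add hb

theorem Supermanifold.diffAt_subst (M : Supermanifold) {F : ℂ → Grassmann} {x : ℂ} (hx : x ≠ 0)
    (hF : DiffAt F x⁻¹) : DiffAt (subst M.g F) x := by
  have e : subst M.g F = fun t => ∑ S, monomialBasis.repr (F t⁻¹) S •
      ExteriorAlgebra.map (Matrix.toLin' (M.g t)) (monomialBasis S) := by
    funext t
    rw [subst]
    conv_lhs => rw [← monomialBasis.sum_repr (F t⁻¹)]
    simp only [map_sum, map_smul]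
  rw [e]
  refine diffAt_sum _ fun S _ => ?_
  have hd : DifferentiableAt ℂ (fun t => monomialBasis.repr (F t⁻¹) S) x :=
    DifferentiableAt.comp x (hF S) (differentiableAt_inv hx)
  exact (HasD.smul hd.hasDerivAt (M.diffAt_map hx _).hasD).diffAt

theorem subst_congr (g : ℂ → Matrix (Fin 3) (Fin 3) ℂ) {F G : ℂ → Grassmann} {x : ℂ} (hx : x ≠ 0)
    (h : G =ᶠ[nhds x⁻¹] F) : subst g G =ᶠ[nhds x] subst g F := by
  have := (continuousAt_inv₀ hx).tendsto.eventually h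
  exact this.mono fun t ht => by simp only [subst, ht]

theorem Supermanifold.trans_congr (M : Supermanifold) {F G : ℂ → Grassmann} {x : ℂ} (hx : x ≠ 0)
    (h : G =ᶠ[nhds x⁻¹] F) : M.trans G x = M.trans F x := by
  rw [trans, trans, app_congr _ (subst_congr _ hx h), (subst_congr M.g hx h).eq_of_nhds]

/-- Elements of degree two are central. -/
theorem comm_of_deg2 {c : Grassmann} (hc : c ∈ ⋀[ℂ]^2 (Fin 3 → ℂ)) (a : Grassmann) :
    c * a = a * c := by
  rw [ExteriorAlgebra.exteriorPower, pow_two] at hc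
  induction a using ExteriorAlgebra.induction with
  | algebraMap r => exact (Algebra.commutes r c).symm
  | mul a b ha hb => rw [← mul_assoc, ha, mul_assoc, hb, mul_assoc]
  | add a b ha hb => rw [mul_add, add_mul, ha, hb]
  | ι m =>
    induction hc using Submodule.mul_induction_on' with
    | add p _ q _ hp hq => rw [add_mul, mul_add, hp, hq]
    | mem_mul_mem p hp q hq =>
      obtain ⟨p, rfl⟩ := hp
      obtain ⟨q, rfl⟩ := hq
      have h1 := eq_neg_of_add_eq_zero_left (ExteriorAlgebra.ι_add_mul_swap (R := ℂ) q m)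
      have h2 := eq_neg_of_add_eq_zero_left (ExteriorAlgebra.ι_add_mul_swap (R := ℂ) p m)
      rw [mul_assoc, h1, mul_neg, ← mul_assoc, h2, neg_mul, neg_neg, mul_assoc]

/-- Elements of degree three anticommute with the odd generators. -/
theorem anticomm_of_deg3 {w : Grassmann} (hw : w ∈ ⋀[ℂ]^3 (Fin 3 → ℂ)) (m : Fin 3 → ℂ) :
    w * ExteriorAlgebra.ι ℂ m = -(ExteriorAlgebra.ι ℂ m * w) := by
  rw [ExteriorAlgebra.exteriorPower, pow_succ] at hw
  induction hw using Submodule.mul_induction_on' with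
  | add p _ q _ hp hq => rw [add_mul, mul_add, hp, hq, neg_add]
  | mem_mul_mem p hp q hq =>
    obtain ⟨q, rfl⟩ := hq
    have h1 := eq_neg_of_add_eq_zero_left (ExteriorAlgebra.ι_add_mul_swap (R := ℂ) q m)
    rw [mul_assoc, h1, mul_neg, ← mul_assoc, comm_of_deg2 hp, mul_assoc]

theorem eq_zero_of_deg {n : ℕ} (hn : 3 < n) {a : Grassmann} (ha : a ∈ ⋀[ℂ]^n (Fin 3 → ℂ)) :
    a = 0 := by
  rw [← ExteriorAlgebra.ιMulti_span_fixedDegree] at ha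
  induction ha using Submodule.span_induction with
  | mem x hx =>
    obtain ⟨v, rfl⟩ := hx
    refine AlternatingMap.map_linearDependent _ _ fun hv => ?_
    have := hv.fintype_card_le_finrank
    simp at this
    omega
  | zero => rfl
  | add x y _ _ hx hy => rw [hx, hy, add_zero]
  | smul c x _ hx => rw [hx, smul_zero]

theorem mul_eq_zero_of_deg {p q : ℕ} (h : 3 < p + q) {a b : Grassmann}
    (ha : a ∈ ⋀[ℂ]^p (Fin 3 → ℂ)) (hb : b ∈ ⋀[ℂ]^q (Fin 3 → ℂ)) : a * b = 0 := by
  refine eq_zero_of_deg h ?_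
  rw [ExteriorAlgebra.exteriorPower, pow_add]
  exact Submodule.mul_mem_mul ha hb

theorem swap_of_deg3 {w : Grassmann} (hw : w ∈ ⋀[ℂ]^3 (Fin 3 → ℂ)) (a : Grassmann) :
    ∃ a', w * a = a' * w := by
  induction a using ExteriorAlgebra.induction with
  | algebraMap r => exact ⟨_, (Algebra.commutes r w).symm⟩
  | mul a b ha hb =>
    obtain ⟨a', ha⟩ := ha
    obtain ⟨b', hb⟩ := hb
    exact ⟨a' * b', by rw [← mul_assoc, ha, mul_assoc, hb, mul_assoc]⟩
  | add a b ha hb =>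
    obtain ⟨a', ha⟩ := ha
    obtain ⟨b', hb⟩ := hb
    exact ⟨a' + b', by rw [mul_add, add_mul, ha, hb]⟩
  | ι m => exact ⟨-ExteriorAlgebra.ι ℂ m, by rw [anticomm_of_deg3 hw, neg_mul]⟩

theorem dXi_ι_mul (i : Fin 3) (m : Fin 3 → ℂ) (b : Grassmann) :
    dXi i (ExteriorAlgebra.ι ℂ m * b) = m i • b - ExteriorAlgebra.ι ℂ m * dXi i b := by
  have := CliffordAlgebra.contractLeft_ι_mul (Q := (0 : QuadraticForm ℂ (Fin 3 → ℂ)))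
    (d := (LinearMap.proj i : (Fin 3 → ℂ) →ₗ[ℂ] ℂ)) m b
  exact this

theorem dXi_algebraMap (i : Fin 3) (r : ℂ) : dXi i (algebraMap ℂ Grassmann r) = 0 :=
  CliffordAlgebra.contractLeft_algebraMap (Q := (0 : QuadraticForm ℂ (Fin 3 → ℂ)))
    (d := (LinearMap.proj i : (Fin 3 → ℂ) →ₗ[ℂ] ℂ)) r

theorem dXi_algebraMap_mul (i : Fin 3) (r : ℂ) (b : Grassmann) :
    dXi i (algebraMap ℂ Grassmann r * b) = algebraMap ℂ Grassmann r * dXi i b :=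
  CliffordAlgebra.contractLeft_algebraMap_mul (Q := (0 : QuadraticForm ℂ (Fin 3 → ℂ)))
    (d := (LinearMap.proj i : (Fin 3 → ℂ) →ₗ[ℂ] ℂ)) r b

/-- The derivation property of `w ∂/∂ξ_i` for `w` of degree three. -/
theorem leibniz_of_deg3 {w : Grassmann} (hw : w ∈ ⋀[ℂ]^3 (Fin 3 → ℂ)) (i : Fin 3)
    (a : Grassmann) : ∀ b, w * dXi i (a * b) = w * dXi i a * b + a * (w * dXi i b) := by
  induction a using ExteriorAlgebra.induction with
  | algebraMap r =>
    intro b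
    rw [dXi_algebraMap_mul, dXi_algebraMap, mul_zero, zero_mul, zero_add, ← mul_assoc,
      ← Algebra.commutes r w, mul_assoc]
  | ι m =>
    intro b
    have h := dXi_ι_mul i m 1
    rw [mul_one, ← map_one (algebraMap ℂ Grassmann), dXi_algebraMap, mul_zero, sub_zero,
      map_one] at h
    rw [h, dXi_ι_mul, mul_sub, mul_smul_comm, mul_smul_comm, mul_one, smul_mul_assoc,
      ← mul_assoc w, anticomm_of_deg3 hw, neg_mul, sub_neg_eq_add, mul_assoc]
  | mul a a' ha ha' =>
    intro b
    rw [mul_assoc a a' b, ha, ha', ha a', mul_add, add_mul]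
    simp only [mul_assoc, add_assoc]
  | add a a' ha ha' =>
    intro b
    simp only [add_mul, map_add, mul_add, ha, ha']
    abel

/-- The derivation property of vector fields of degree two. -/
theorem app_mul {X : EvenVF} {W : Set ℂ} (hX : IsT2 X W) {z : ℂ} (hz : z ∈ W)
    {F G : ℂ → Grassmann} (hF : DiffAt F z) (hG : DiffAt G z) :
    app X (F * G) z = app X F z * G z + F z * app X G z := by
  simp only [app, (hF.hasD.mul hG.hasD).dX_eq, Pi.mul_apply, leibniz_of_deg3 (hX.deg_ξ _ z hz)]
  rw [mul_add, ← mul_assoc, ← mul_assoc, comm_of_deg2 (hX.deg_x z hz) (F z), add_mul, mul_add,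
    Finset.sum_add_distrib, Finset.sum_mul, Finset.mul_sum, mul_assoc (F z)]
  abel

theorem app_mul_app {X : EvenVF} {W : Set ℂ} (hX : IsT2 X W) {z : ℂ} (hz : z ∈ W)
    (F G : ℂ → Grassmann) : app X F z * app X G z = 0 := by
  have key : ∀ o o' (a b : Grassmann), X o z * a * (X o' z * b) = 0 := by
    intro o o' a b
    have h0 : X o z * X o' z = 0 := by
      rcases o with _ | i <;> rcases o' with _ | j
      · exact mul_eq_zero_of_deg (by norm_num) (hX.deg_x z hz) (hX.deg_x z hz)
      · exact mul_eq_zero_of_deg (by norm_num) (hX.deg_x z hz) (hX.deg_ξ j z hz)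
      · exact mul_eq_zero_of_deg (by norm_num) (hX.deg_ξ i z hz) (hX.deg_x z hz)
      · exact mul_eq_zero_of_deg (by norm_num) (hX.deg_ξ i z hz) (hX.deg_ξ j z hz)
    have h1 : ∃ a', X o z * a = a' * X o z := by
      rcases o with _ | i
      · exact ⟨a, comm_of_deg2 (hX.deg_x z hz) a⟩
      · exact swap_of_deg3 (hX.deg_ξ i z hz) a
    obtain ⟨a', h1⟩ := h1
    rw [h1, mul_assoc, ← mul_assoc (X o z), h0, zero_mul, mul_zero]
  simp only [app, add_mul, mul_add, Finset.sum_mul, Finset.mul_sum, key, Finset.sum_const_zero,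
    add_zero]

theorem subst_mul (g : ℂ → Matrix (Fin 3) (Fin 3) ℂ) (F G : ℂ → Grassmann) :
    subst g (F * G) = subst g F * subst g G := by
  funext x
  simp only [subst, Pi.mul_apply, map_mul]

theorem subst_add (g : ℂ → Matrix (Fin 3) (Fin 3) ℂ) (F G : ℂ → Grassmann) :
    subst g (F + G) = subst g F + subst g G := by
  funext x
  simp only [subst, Pi.add_apply, map_add]

theorem Supermanifold.trans_mul (M : Supermanifold) {F G : ℂ → Grassmann} {x : ℂ} (hx : x ≠ 0)
    (hF : DiffAt F x⁻¹) (hG : DiffAt G x⁻¹) :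
    M.trans (F * G) x = M.trans F x * M.trans G x := by
  have hx' : x ∈ ({0}ᶜ : Set ℂ) := hx
  rw [trans, trans, trans, subst_mul,
    app_mul M.v_mem hx' (M.diffAt_subst hx hF) (M.diffAt_subst hx hG), Pi.mul_apply, add_mul,
    mul_add, mul_add, app_mul_app M.v_mem hx', add_zero]
  abel

theorem Supermanifold.trans_add (M : Supermanifold) {F G : ℂ → Grassmann} {x : ℂ} (hx : x ≠ 0)
    (hF : DiffAt F x⁻¹) (hG : DiffAt G x⁻¹) :
    M.trans (F + G) x = M.trans F x + M.trans G x := by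
  have h := ((M.diffAt_subst hx hF).hasD.add (M.diffAt_subst hx hG).hasD).dX_eq
  simp only [trans, subst_add, app, h, Pi.add_apply, map_add, mul_add, Finset.sum_add_distrib]
  abel

theorem Supermanifold.trans_const (M : Supermanifold) (r : ℂ) (x : ℂ) :
    M.trans (fun _ => algebraMap ℂ Grassmann r) x = algebraMap ℂ Grassmann r := by
  have e : subst M.g (fun _ => algebraMap ℂ Grassmann r) = fun _ => algebraMap ℂ Grassmann r := by
    funext t
    simp only [subst, AlgHom.commutes]
  rw [trans, e, app, (hasD_const _ x).dX_eq]
  simp only [dXi_algebraMap, mul_zero, Finset.sum_const_zero, add_zero]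

theorem continuous_chart (j : Fin 2) : Continuous (chart j) := by
  fin_cases j
  · exact OnePoint.continuous_coe
  · refine continuous_iff_continuousAt.2 fun y => ?_
    have h1 : ∀ t : ℂ, t ≠ 0 → chart 1 t = ((t⁻¹ : ℂ) : OnePoint ℂ) := fun t ht => by
      simp [chart, ht]
    have h0 : chart 1 0 = ∞ := by simp [chart]
    change ContinuousAt (chart 1) y
    by_cases hy : y = 0
    · subst hy
      rw [continuousAt_iff_punctured_nhds, h0]
      have h2 : Filter.Tendsto (fun t : ℂ => ((t⁻¹ : ℂ) : OnePoint ℂ)) (nhdsWithin 0 {0}ᶜ)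
          (nhds ∞) := by
        refine OnePoint.tendsto_coe_infty.comp ?_
        rw [Filter.coclosedCompact_eq_cocompact, ← Metric.cobounded_eq_cocompact]
        exact Filter.tendsto_inv₀_nhdsNE_zero
      refine h2.congr' ?_
      filter_upwards [self_mem_nhdsWithin] with t ht
      exact (h1 t ht).symm
    · have h2 : ContinuousAt (fun t : ℂ => ((t⁻¹ : ℂ) : OnePoint ℂ)) y :=
        OnePoint.continuous_coe.continuousAt.comp (continuousAt_inv₀ hy)
      refine h2.congr ?_
      filter_upwards [isOpen_ne.mem_nhds hy] with t ht
      exact (h1 t ht).symm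

theorem chart_one_inv {x : ℂ} (hx : x ≠ 0) : chart 1 x⁻¹ = chart 0 x := by
  simp [chart, hx]

theorem eventually_mem {U : Opens (OnePoint ℂ)} {j : Fin 2} {z : ℂ} (hz : chart j z ∈ U) :
    ∀ᶠ t in nhds z, chart j t ∈ U :=
  (continuous_chart j).continuousAt.eventually (U.isOpen.mem_nhds hz)

theorem LocalPair.ext_algebraMap {U : Opens (OnePoint ℂ)} {j : Fin 2} {z : ℂ}
    (hz : chart j z ∈ U) (r : ℂ) :
    LocalPair.ext (algebraMap ℂ (LocalPair U) r) j =ᶠ[nhds z]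
      fun _ => algebraMap ℂ Grassmann r := by
  filter_upwards [eventually_mem hz] with t ht
  simp only [LocalPair.ext, dif_pos ht]
  rfl

theorem LocalPair.ext_mul {U : Opens (OnePoint ℂ)} (f g : LocalPair U) (j : Fin 2) :
    LocalPair.ext (f * g) j = f.ext j * g.ext j := by
  funext z
  simp only [LocalPair.ext, Pi.mul_apply]
  split_ifs <;> simp

theorem LocalPair.ext_add {U : Opens (OnePoint ℂ)} (f g : LocalPair U) (j : Fin 2) :
    LocalPair.ext (f + g) j = f.ext j + g.ext j := by
  funext z
  simp only [LocalPair.ext, Pi.add_apply]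
  split_ifs <;> simp

/-! #### The structure sheaf -/

/-- The algebra of sections over `U` of the structure sheaf of `M`: pairs of holomorphic
superfunctions on `U ∩ U₀` and `U ∩ U₁` which match under the transition of `M`. -/
def Supermanifold.sections (M : Supermanifold) (U : Opens (OnePoint ℂ)) :
    Subalgebra ℂ (LocalPair U) where
  carrier := {f | (∀ j z, chart j z ∈ U → DiffAt (f.ext j) z) ∧
    ∀ x : ℂ, x ≠ 0 → chart 0 x ∈ U → f.ext 0 x = M.trans (f.ext 1) x}
  mul_mem' := by
    rintro f g ⟨hf, hf'⟩ ⟨hg, hg'⟩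
    refine ⟨fun j z hz => ?_, fun x hx hU => ?_⟩
    · rw [LocalPair.ext_mul]
      exact (hf j z hz).mul (hg j z hz)
    · have hU' : chart 1 x⁻¹ ∈ U := by rwa [chart_one_inv hx]
      rw [LocalPair.ext_mul, LocalPair.ext_mul, M.trans_mul hx (hf 1 _ hU') (hg 1 _ hU'),
        ← hf' x hx hU, ← hg' x hx hU, Pi.mul_apply]
  add_mem' := by
    rintro f g ⟨hf, hf'⟩ ⟨hg, hg'⟩
    refine ⟨fun j z hz => ?_, fun x hx hU => ?_⟩
    · rw [LocalPair.ext_add]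
      exact (hf j z hz).add (hg j z hz)
    · have hU' : chart 1 x⁻¹ ∈ U := by rwa [chart_one_inv hx]
      rw [LocalPair.ext_add, LocalPair.ext_add, M.trans_add hx (hf 1 _ hU') (hg 1 _ hU'),
        ← hf' x hx hU, ← hg' x hx hU, Pi.add_apply]
  algebraMap_mem' := by
    intro r
    refine ⟨fun j z hz => ?_, fun x hx hU => ?_⟩
    · exact (hasD_const _ z).diffAt.congr (LocalPair.ext_algebraMap hz r)
    · have hU' : chart 1 x⁻¹ ∈ U := by rwa [chart_one_inv hx]
      rw [(LocalPair.ext_algebraMap hU r).eq_of_nhds,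
        M.trans_congr hx (LocalPair.ext_algebraMap hU' r), M.trans_const]

/-- Restriction of pairs of functions. -/
def LocalPair.restrict {U V : Opens (OnePoint ℂ)} (h : V ≤ U) : LocalPair U →ₐ[ℂ] LocalPair V where
  toFun f := fun j z => f j ⟨z.1, h z.2⟩
  map_one' := rfl
  map_mul' _ _ := rfl
  map_zero' := rfl
  map_add' _ _ := rfl
  commutes' _ := rfl

theorem LocalPair.ext_restrict {U V : Opens (OnePoint ℂ)} (h : V ≤ U) (f : LocalPair U)
    {j : Fin 2} {z : ℂ} (hz : chart j z ∈ V) :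
    (LocalPair.restrict h f).ext j =ᶠ[nhds z] f.ext j := by
  filter_upwards [eventually_mem hz] with t ht
  simp only [LocalPair.ext, dif_pos ht, dif_pos (h ht)]
  rfl

/-- The restriction maps of the structure sheaf. -/
def Supermanifold.res (M : Supermanifold) {U V : Opens (OnePoint ℂ)} (h : V ≤ U) :
    M.sections U →ₐ[ℂ] M.sections V :=
  ((LocalPair.restrict h).comp (M.sections U).val).codRestrict (M.sections V) (by
    rintro ⟨f, hf, hf'⟩
    refine ⟨fun j z hz => ?_, fun x hx hV => ?_⟩
    · exact (hf j z (h hz)).congr (LocalPair.ext_restrict h f hz)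
    · have hV' : chart 1 x⁻¹ ∈ V := by rwa [chart_one_inv hx]
      change (LocalPair.restrict h f).ext 0 x = M.trans ((LocalPair.restrict h f).ext 1) x
      rw [(LocalPair.ext_restrict h f hV).eq_of_nhds,
        M.trans_congr hx (LocalPair.ext_restrict h f hV'), hf' x hx (h hV)])

/-- A section is homogeneous of parity `p`. -/
def Supermanifold.HasParity (M : Supermanifold) {U : Opens (OnePoint ℂ)} (p : ZMod 2)
    (s : M.sections U) : Prop := ∀ j z, s.1 j z ∈ parityPart p

/-! ### Isomorphisms -/

/-- An isomorphism of supermanifolds: a homeomorphism of the underlying spaces together with an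
isomorphism of the sheaves of superalgebras. -/
structure Supermanifold.Iso (M N : Supermanifold) where
  base : OnePoint ℂ ≃ₜ OnePoint ℂ
  pull : ∀ U : Opens (OnePoint ℂ),
    N.sections U ≃ₐ[ℂ] M.sections (Opens.comap (base : C(OnePoint ℂ, OnePoint ℂ)) U)
  pull_res : ∀ (U V : Opens (OnePoint ℂ)) (h : V ≤ U) (s : N.sections U),
    M.res (Opens.comap_mono _ h) (pull U s) = pull V (N.res h s)
  pull_parity : ∀ (U : Opens (OnePoint ℂ)) (p : ZMod 2) (s : N.sections U),
    N.HasParity p s → M.HasParity p (pull U s)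

/-- `M` and `N` are isomorphic as supermanifolds. -/
def Supermanifold.Isomorphic (M N : Supermanifold) : Prop := Nonempty (Supermanifold.Iso M N)

/-- `M` and `N` are isomorphic by an isomorphism which induces the identity on `ℂP¹`, that is, the
structure sheaves are isomorphic as sheaves of superalgebras on `ℂP¹`. -/
def Supermanifold.IsomorphicOverId (M N : Supermanifold) : Prop :=
  ∃ φ : Supermanifold.Iso M N, φ.base = Homeomorph.refl _

/-- `M` is split: its structure sheaf is isomorphic to the sheaf of exterior algebras `⋀ℰ` of a
holomorphic vector bundle on `ℂP¹`, which is given by its transition matrix between `U₀` and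
`U₁`. -/
def Supermanifold.IsSplit (M : Supermanifold) : Prop :=
  ∃ N : Supermanifold, N.v = 0 ∧ M.IsomorphicOverId N

/-- The retract `gr M`: the structure sheaf of `M` is filtered by the powers of the ideal generated
by the odd elements, and the associated graded sheaf `⋀ℰ` is glued by `y = x⁻¹`,
`η_j = ∑ i, g i j (x) ξ_i`. -/
def Supermanifold.retract (M : Supermanifold) : Supermanifold where
  g := M.g
  v := 0
  g_diff := M.g_diff
  g_unit := M.g_unit
  v_mem := isT2_zero _

/-! ### The split supermanifold `(k₁, k₂, k₃)` and the supermanifolds with this retract -/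

/-- The transition matrix of `η_i = x^{-k_i} ξ_i`. -/
def diagMatrix (k : Fin 3 → ℤ) (x : ℂ) : Matrix (Fin 3) (Fin 3) ℂ :=
  Matrix.diagonal fun i => x ^ (-k i)

/-- The supermanifold with retract `(k₁, k₂, k₃)` which is glued by the cocycle `v`:
`y = (id + v)(x⁻¹)`, `η_i = (id + v)(x^{-k_i} ξ_i)`. -/
def glue (k : Fin 3 → ℤ) (v : EvenVF) (hv : IsT2 v {0}ᶜ) : Supermanifold where
  g := diagMatrix k
  v := v
  g_diff := by
    intro i j x hx
    by_cases h : i = j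
    · subst h
      simp only [diagMatrix, Matrix.diagonal_apply_eq]
      exact differentiableAt_zpow.2 (Or.inl hx)
    · simp only [diagMatrix, Matrix.diagonal_apply_ne _ h]
      exact differentiableAt_const _
  g_unit := by
    intro x hx
    rw [diagMatrix, Matrix.det_diagonal, isUnit_iff_ne_zero]
    exact Finset.prod_ne_zero_iff.2 fun i _ => zpow_ne_zero _ hx
  v_mem := hv

/-- The retract of `M` is the split supermanifold `(k₁, k₂, k₃)`. -/
def HasRetract (k : Fin 3 → ℤ) (M : Supermanifold) : Prop :=
  M.retract.IsomorphicOverId (glue k 0 (isT2_zero _))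

/-- A vector field on the split supermanifold `(k₁, k₂, k₃)`, given in the chart `(y, η)`,
rewritten in the chart `(x, ξ)`: its coefficients are its values on the coordinates `x = y⁻¹` and
`ξ_i = y^{-k_i} η_i`. -/
def toChart0 (k : Fin 3 → ℤ) (Y : EvenVF) : EvenVF :=
  vf (subst (diagMatrix k) (app Y fun y => algebraMap ℂ Grassmann y⁻¹))
    fun i => subst (diagMatrix k) (app Y fun y => y ^ (-k i) • ξ i)

/-! ### Čech cohomology of `𝒯₂` for the cover `{U₀, U₁}`

A 1-cocycle is a section of `𝒯₂` over `U₀ ∩ U₁ = ℂ \ {0}`, that is, some `v` with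
`IsT2 v {0}ᶜ`, written in the chart `(x, ξ)`. -/

/-- `v` is the difference of a section of `𝒯₂` over `U₀` and a section of `𝒯₂` over `U₁`. -/
def IsCoboundary (k : Fin 3 → ℤ) (v : EvenVF) : Prop :=
  ∃ w₀ w₁ : EvenVF, IsT2 w₀ Set.univ ∧ IsT2 w₁ Set.univ ∧
    ∀ o, ∀ x : ℂ, x ≠ 0 → v o x = w₀ o x - toChart0 k w₁ o x

/-! ### The subalgebra `𝔰'` (for `k₁ = k₂`) -/

/-- `e' = ∂/∂x + ξ₂ ∂/∂ξ₁`. -/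
def ePrime : EvenVF := vf 1 ![fun _ => ξ 1, 0, 0]

/-- `f' = ∂/∂y + η₁ ∂/∂η₂`, rewritten in the chart `(x, ξ)`. -/
def fPrime (k : Fin 3 → ℤ) : EvenVF := toChart0 k (vf 1 ![0, fun _ => ξ 0, 0])

/-- `𝔰'` is spanned by `e'`, `f'` and `h' = [e', f']`. -/
def sPrime (k : Fin 3 → ℤ) : Submodule ℂ EvenVF :=
  Submodule.span ℂ {ePrime, fPrime k, bracket ePrime (fPrime k)}

/-- The cohomology class of the cocycle `v` is `𝔰'`-invariant: `[u, v] = 0` in `H¹(ℂP¹, 𝒯₂)` for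
all `u ∈ 𝔰'`. -/
def IsSPrimeInvariant (k : Fin 3 → ℤ) (v : EvenVF) : Prop :=
  ∀ u ∈ sPrime k, IsCoboundary k (bracket u v)

/-- `M` is an `𝔰'`-even-homogeneous supermanifold with retract `(k₁, k₂, k₃)`: it corresponds to an
`𝔰'`-invariant class in `H¹(ℂP¹, 𝒯₂)`, i.e. it is isomorphic to the supermanifold glued by a cocycle
in such a class. -/
def IsSPrimeEvenHomogeneous (k : Fin 3 → ℤ) (M : Supermanifold) : Prop :=
  HasRetract k M ∧
    ∃ (v : EvenVF) (hv : IsT2 v {0}ᶜ), IsSPrimeInvariant k v ∧ M.IsomorphicOverId (glue k v hv)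

/-- The non-split `𝔰'`-even-homogeneous supermanifolds with retract `(k₁, k₂, k₃)` are, up to
isomorphism, exactly `n`, and they correspond to the cocycles `c 0, …, c (n - 1)`: these are
cocycles with `𝔰'`-invariant classes, they give non-split, pairwise non-isomorphic
`𝔰'`-even-homogeneous supermanifolds with this retract, and every non-split `𝔰'`-even-homogeneous supermanifold with this retract is
isomorphic to one of these, even by an isomorphism over the identity of `ℂP¹`. -/
def ClassifiedBy (k : Fin 3 → ℤ) {n : ℕ} (c : Fin n → EvenVF) : Prop :=
  ∃ hc : ∀ i, IsT2 (c i) {0}ᶜ,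
    (∀ i, IsSPrimeInvariant k (c i)) ∧
    (∀ i, IsSPrimeEvenHomogeneous k (glue k (c i) (hc i))) ∧
    (∀ i, ¬ (glue k (c i) (hc i)).IsSplit) ∧
    (∀ i j, i ≠ j → ¬ (glue k (c i) (hc i)).Isomorphic (glue k (c j) (hc j))) ∧
    ∀ M : Supermanifold, IsSPrimeEvenHomogeneous k M → ¬ M.IsSplit →
      ∃ i, M.IsomorphicOverId (glue k (c i) (hc i))

/-! ### The explicit cocycles -/

/-- `x⁻¹ ξ₁ξ₂ ∂/∂x + (k / 2x²) ξ₁ξ₂ξ₃ ∂/∂ξ₃`. -/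
def cocycleA (k : ℤ) : EvenVF :=
  vf (fun x => x⁻¹ • (ξ 0 * ξ 1)) ![0, 0, fun x => ((k : ℂ) / (2 * x ^ 2)) • (ξ 0 * ξ 1 * ξ 2)]

/-- `x⁻² ξ₁ξ₂ξ₃ ∂/∂ξ₂ - x⁻¹ ξ₁ξ₂ξ₃ ∂/∂ξ₁`. -/
def cocycleB : EvenVF :=
  vf 0 ![fun x => -(x⁻¹ • (ξ 0 * ξ 1 * ξ 2)), fun x => (x ^ 2)⁻¹ • (ξ 0 * ξ 1 * ξ 2), 0]

/-- `x⁻¹ ξ₂ξ₃ ∂/∂x + x⁻² ξ₁ξ₃ ∂/∂x + (k / 3x²) ξ₁ξ₂ξ₃ ∂/∂ξ₁ - (2k / 3x³) ξ₁ξ₂ξ₃ ∂/∂ξ₂`. -/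
def cocycleC (k : ℤ) : EvenVF :=
  vf (fun x => x⁻¹ • (ξ 1 * ξ 2) + (x ^ 2)⁻¹ • (ξ 0 * ξ 2))
    ![fun x => ((k : ℂ) / (3 * x ^ 2)) • (ξ 0 * ξ 1 * ξ 2),
      fun x => -((2 * (k : ℂ) / (3 * x ^ 3)) • (ξ 0 * ξ 1 * ξ 2)), 0]

/-- `x⁻¹ ξ₁ξ₂ξ₃ ∂/∂ξ₃`. -/
def cocycleD : EvenVF := vf 0 ![0, 0, fun x => x⁻¹ • (ξ 0 * ξ 1 * ξ 2)]

end SuperCP1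

end

/-! A field of degree two is `∑ p l ω_l ∂/∂x + ∑ q l Ω ∂/∂ξ_l`, and the change of charts does not
mix the three slots `l` (`toChart0_eq`). Slot `l` is an extension of `O(2 - m)` (the `p` part) by
`O(-m)` (the `q` part), with `m = wt k l` and an off-diagonal term proportional to `k l`. Hence a
class in `H¹` is decided, slot by slot, by finitely many Laurent coefficients on the punctured
plane: `isCoboundary_iff`, and `pairCob_of_lc` with its converses `PairCob.lc_p`, `PairCob.lc_q`,
`PairCob.lc_pq`, `PairCob.lc_q_two`.

The algebra `𝔰'` is a copy of `sl₂`. On slot 2 its nilpotent matrix parts do nothing, so the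
cohomology is made of the irreducible modules of dimensions `m - 3` and `m - 1`; for `m = 2` the
second one is killed by the connecting map unless `k 2 = 0`. Slots 0 and 1 together are the same
modules tensored with the two-dimensional one, because `ξ₂ ∂/∂ξ₁` and `η₁ ∂/∂η₂` mix them. An
invariant line therefore appears only for `m = 4` (cocycle `A`) or `m = 2`, `k 2 = 0` (cocycle `D`)
in slot 2, and for `m = 3` (cocycle `B`) or `m = 5` (cocycle `C`) in slots 0 and 1. In the proof
this is a recursion on Laurent coefficients, in `pairCob_of_invariant` and
`pairCob_of_invariant_pair`; `isSPrimeInvariant_invariantVF` is the converse.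

From classes to supermanifolds: composites of degree-two fields vanish, so `id + w` is an
automorphism with inverse `id - w`, and cohomologous cocycles glue isomorphic supermanifolds
(`glue_isomorphicOverId_of_isCoboundary`). Automorphisms of the underlying bundle give further
isomorphisms (`glue_isomorphicOverId_of_linear`). Diagonal ones normalise nonzero coefficients to
one. For `(2,2,1)` a shear absorbs the `B` part of a class with nonzero `A` part; for `(2,2,3)` a
shear absorbs the `A` part of a class with nonzero `C` part. So at most two isomorphism classes
remain in these two cases, and one in the others.

Non-splitness (`isCoboundary_of_isSplit`): on a split supermanifold the odd coordinates can be
multiplied by 2. Conjugating this dilation to the glued supermanifold gives an endomorphism that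
multiplies `ω` by 4 and `Ω` by 8; comparing it with the transition writes a nonzero multiple of the
cocycle as a coboundary.

Non-isomorphism, for an arbitrary homeomorphism of the base (`PreIso.exists_splitting`): if the
target has a subalgebra of functions projecting onto the body and compatible with its transition,
then pulling back lifts of the coordinates trivialises part of the cocycle of the source. For
`(2,2,1)` the supermanifold of `B` has such a subalgebra of bodies, while the class of `A` is an
obstruction to one. For `(2,2,3)` the supermanifold of `A` has one made of bodies and multiples of
`ω 2`; an isomorphism respects the multiples of `ω 2`, because the relevant entries of its linear
part form a section of `O(-1)` and so vanish, and the class of `C` is the obstruction. -/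

noncomputable section

namespace SuperCP1

/-! ### Coordinates on the Grassmann algebra -/

/-- The product of the two odd generators which follow `ξ l` cyclically. -/
def ω (l : Fin 3) : Grassmann := ξ (l + 1) * ξ (l + 2)

/-- The product of all odd generators. -/
def Ω : Grassmann := ξ 0 * ξ 1 * ξ 2

/-- The body of an element of the Grassmann algebra. -/
def body : Grassmann →ₐ[ℂ] ℂ := ExteriorAlgebra.algebraMapInv

/-- The coefficient of `ξ i`. -/
def cL (i : Fin 3) : Grassmann →ₗ[ℂ] ℂ := body.toLinearMap ∘ₗ dXi i

/-- The coefficient of `ω l`. -/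
def cP (l : Fin 3) : Grassmann →ₗ[ℂ] ℂ := body.toLinearMap ∘ₗ dXi (l + 2) ∘ₗ dXi (l + 1)

/-- The coefficient of `Ω`. -/
def cT : Grassmann →ₗ[ℂ] ℂ := body.toLinearMap ∘ₗ dXi 2 ∘ₗ dXi 1 ∘ₗ dXi 0

theorem dXi_ξ_mul (i j : Fin 3) (b : Grassmann) :
    dXi i (ξ j * b) = (if i = j then (1 : ℂ) else 0) • b - ξ j * dXi i b := by
  rw [ξ, dXi_ι_mul, Pi.single_apply]

theorem dXi_one (i : Fin 3) : dXi i 1 = 0 := by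
  simpa using dXi_algebraMap i 1

theorem dXi_ξ (i j : Fin 3) : dXi i (ξ j) = (if i = j then (1 : ℂ) else 0) • 1 := by
  have := dXi_ξ_mul i j 1
  rwa [mul_one, dXi_one, mul_zero, sub_zero] at this

@[simp] theorem body_ξ (i : Fin 3) : body (ξ i) = 0 := by
  rw [body, ξ]
  exact ExteriorAlgebra.lift_ι_apply _ _ _ _

theorem ξ_mul_self (i : Fin 3) : ξ i * ξ i = 0 := ExteriorAlgebra.ι_sq_zero _

theorem ξ_mul_swap (i j : Fin 3) : ξ i * ξ j = -(ξ j * ξ i) :=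
  eq_neg_of_add_eq_zero_left (ExteriorAlgebra.ι_add_mul_swap _ _)

theorem ξ_mul_self_assoc (i : Fin 3) (b : Grassmann) : ξ i * (ξ i * b) = 0 := by
  rw [← mul_assoc, ξ_mul_self, zero_mul]

theorem ξ_mul_swap_assoc (i j : Fin 3) (b : Grassmann) : ξ i * (ξ j * b) = -(ξ j * (ξ i * b)) := by
  rw [← mul_assoc, ξ_mul_swap, neg_mul, mul_assoc]

theorem ξ_mul_ω (i l : Fin 3) : ξ i * ω l = if i = l then Ω else 0 := by
  fin_cases i <;> fin_cases l <;>
    simp [ω, Ω, ξ_mul_self, ξ_mul_self_assoc, ξ_mul_swap 1 0, ξ_mul_swap 2 0, ξ_mul_swap 2 1,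
      ξ_mul_swap_assoc 1 0, ξ_mul_swap_assoc 2 0, ξ_mul_swap_assoc 2 1, mul_assoc]

theorem ξ_mul_Ω (i : Fin 3) : ξ i * Ω = 0 := by
  fin_cases i <;>
    simp [Ω, ξ_mul_self, ξ_mul_self_assoc,
      ξ_mul_swap_assoc 1 0, ξ_mul_swap_assoc 2 0, ξ_mul_swap_assoc 2 1, mul_assoc]

/-- Left multiplication by a vector preserves this shape, so it propagates by induction from the
scalars. Only spanning is needed here: the functionals `body`, `cL`, `cP`, `cT` read off the
coefficients and give uniqueness. -/
theorem exists_coords (a : Grassmann) : ∃ (e t : ℂ) (l p : Fin 3 → ℂ),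
    a = e • 1 + ∑ i, l i • ξ i + ∑ i, p i • ω i + t • Ω := by
  induction a using CliffordAlgebra.left_induction with
  | algebraMap r => exact ⟨r, 0, 0, 0, by simp [Algebra.algebraMap_eq_smul_one]⟩
  | add x y hx hy =>
    obtain ⟨e, t, l, p, rfl⟩ := hx
    obtain ⟨e', t', l', p', rfl⟩ := hy
    refine ⟨e + e', t + t', l + l', p + p', ?_⟩
    simp only [add_smul, Pi.add_apply, Finset.sum_add_distrib]
    abel
  | ι_mul x m hx =>
    obtain ⟨e, t, l, p, rfl⟩ := hx
    have hm : CliffordAlgebra.ι (0 : QuadraticForm ℂ (Fin 3 → ℂ)) m = ∑ i, m i • ξ i := by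
      change ExteriorAlgebra.ι ℂ m = _
      conv_lhs => rw [← Finset.univ_sum_single m]
      rw [map_sum]
      refine Finset.sum_congr rfl fun i _ => ?_
      rw [ξ, ← map_smul, ← Pi.single_smul, smul_eq_mul, mul_one]
    refine ⟨0, ∑ i, m i * p i, fun i => e * m i,
      fun i => m (i + 1) * l (i + 2) - m (i + 2) * l (i + 1), ?_⟩
    rw [hm]
    have h10 := ξ_mul_swap 1 0
    have h20 := ξ_mul_swap 2 0
    have h21 := ξ_mul_swap 2 1
    have e0 : ξ 0 * ξ 2 = - ω 1 := by simp [ω, h20]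
    have e1 : ξ 1 * ξ 0 = - ω 2 := by simp [ω, h10]
    have e2 : ξ 2 * ξ 1 = - ω 0 := by simp [ω, h21]
    have e3 : ξ 0 * ξ 1 = ω 2 := by simp [ω]
    have e4 : ξ 1 * ξ 2 = ω 0 := by simp [ω]
    have e5 : ξ 2 * ξ 0 = ω 1 := by simp [ω]
    simp only [Fin.sum_univ_three, mul_add, add_mul, smul_mul_smul_comm, ξ_mul_ω, ξ_mul_Ω,
      ξ_mul_self, mul_one, e0, e1, e2, e3, e4, e5, smul_zero, zero_smul]
    simp
    module

section
variable (i j l : Fin 3)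

@[simp] theorem cL_one : cL i 1 = 0 := by simp [cL, dXi_one]
@[simp] theorem cP_one : cP l 1 = 0 := by simp [cP, dXi_one]
@[simp] theorem cT_one : cT 1 = 0 := by simp [cT, dXi_one]
@[simp] theorem cL_ξ : cL i (ξ j) = if i = j then 1 else 0 := by simp [cL, dXi_ξ]
@[simp] theorem cP_ξ : cP l (ξ j) = 0 := by
  simp only [cP, dXi_ξ, LinearMap.comp_apply, map_smul, dXi_one, smul_zero, map_zero]
@[simp] theorem cT_ξ : cT (ξ j) = 0 := by
  simp only [cT, dXi_ξ, LinearMap.comp_apply, map_smul, dXi_one, smul_zero, map_zero]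
@[simp] theorem body_ω : body (ω l) = 0 := by simp [ω]
@[simp] theorem cL_ω : cL i (ω l) = 0 := by
  fin_cases i <;> fin_cases l <;> simp [cL, ω, dXi_ξ_mul, dXi_ξ]
@[simp] theorem cP_ω : cP l (ω j) = if l = j then 1 else 0 := by
  fin_cases l <;> fin_cases j <;> simp [cP, ω, dXi_ξ_mul, dXi_ξ, dXi_one]
@[simp] theorem cT_ω : cT (ω l) = 0 := by
  fin_cases l <;> simp [cT, ω, dXi_ξ_mul, dXi_ξ, dXi_one]
@[simp] theorem body_Ω : body Ω = 0 := by simp [Ω]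
@[simp] theorem cL_Ω : cL i Ω = 0 := by
  fin_cases i <;> simp [cL, Ω, mul_assoc, dXi_ξ_mul, dXi_ξ]
@[simp] theorem cP_Ω : cP l Ω = 0 := by
  fin_cases l <;> simp [cP, Ω, mul_assoc, dXi_ξ_mul, dXi_ξ, dXi_one]
@[simp] theorem cT_Ω : cT Ω = 1 := by
  simp [cT, Ω, mul_assoc, dXi_ξ_mul, dXi_ξ, dXi_one]
end

/-- The element with given coordinates. -/
def elt (e : ℂ) (l p : Fin 3 → ℂ) (t : ℂ) : Grassmann :=
  e • 1 + ∑ i, l i • ξ i + ∑ i, p i • ω i + t • Ω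

section
variable (e : ℂ) (l p : Fin 3 → ℂ) (t : ℂ) (i : Fin 3)
@[simp] theorem body_elt : body (elt e l p t) = e := by simp [elt]
@[simp] theorem cL_elt : cL i (elt e l p t) = l i := by simp [elt]
@[simp] theorem cP_elt : cP i (elt e l p t) = p i := by simp [elt]
@[simp] theorem cT_elt : cT (elt e l p t) = t := by simp [elt]
end

theorem elt_coords (a : Grassmann) :
    elt (body a) (fun i => cL i a) (fun i => cP i a) (cT a) = a := by
  obtain ⟨e, t, l, p, h⟩ := exists_coords a
  change a = elt e l p t at h
  rw [h]
  simp

theorem gext {a b : Grassmann} (h0 : body a = body b) (h1 : ∀ i, cL i a = cL i b)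
    (h2 : ∀ i, cP i a = cP i b) (h3 : cT a = cT b) : a = b := by
  rw [← elt_coords a, ← elt_coords b, h0, h3, funext h1, funext h2]

/-- The cyclic labelling of `ω` removes all signs: two linear parts multiply by the cross product,
and linear and quadratic parts pair by the scalar product. -/
theorem elt_mul (e : ℂ) (l p : Fin 3 → ℂ) (t : ℂ) (e' : ℂ) (l' p' : Fin 3 → ℂ) (t' : ℂ) :
    elt e l p t * elt e' l' p' t' = elt (e * e') (fun i => e * l' i + l i * e')
      (fun i => e * p' i + p i * e' + (l (i + 1) * l' (i + 2) - l (i + 2) * l' (i + 1)))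
      (e * t' + t * e' + ∑ i, (p i * l' i + l i * p' i)) := by
  have h10 := ξ_mul_swap 1 0
  have h20 := ξ_mul_swap 2 0
  have h21 := ξ_mul_swap 2 1
  have e0 : ξ 0 * ξ 2 = - ω 1 := by simp [ω, h20]
  have e1 : ξ 1 * ξ 0 = - ω 2 := by simp [ω, h10]
  have e2 : ξ 2 * ξ 1 = - ω 0 := by simp [ω, h21]
  have e3 : ξ 0 * ξ 1 = ω 2 := by simp [ω]
  have e4 : ξ 1 * ξ 2 = ω 0 := by simp [ω]
  have e5 : ξ 2 * ξ 0 = ω 1 := by simp [ω]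
  have hω : ∀ i j, ω i * ξ j = ξ j * ω i := fun i j =>
    comm_of_deg2 (by
      rw [ω, ExteriorAlgebra.exteriorPower, pow_two]
      exact Submodule.mul_mem_mul ⟨_, rfl⟩ ⟨_, rfl⟩) _
  have hωω : ∀ i j, ω i * ω j = 0 := fun i j => by
    nth_rw 2 [ω]
    rw [← mul_assoc, hω, mul_assoc, hω, ← mul_assoc, ω, ← mul_assoc]
    fin_cases i <;> fin_cases j <;>
      simp [mul_assoc, ξ_mul_self, ξ_mul_self_assoc, ξ_mul_swap 1 0, ξ_mul_swap 2 0,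
        ξ_mul_swap 2 1, ξ_mul_swap_assoc 1 0, ξ_mul_swap_assoc 2 0, ξ_mul_swap_assoc 2 1]
  have hΩ : ∀ j, Ω * ξ j = 0 := fun j => by
    have : Ω = ξ 0 * ω 0 := by simp [ξ_mul_ω]
    rw [this, mul_assoc, hω, ← mul_assoc]
    rw [ξ_mul_swap, neg_mul, mul_assoc, ξ_mul_ω]
    split_ifs <;> simp [ξ_mul_Ω]
  have hΩω : ∀ j, Ω * ω j = 0 := fun j => by
    rw [ω, ← mul_assoc, hΩ, zero_mul]
  have hωΩ : ∀ j, ω j * Ω = 0 := fun j => by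
    rw [ω, mul_assoc, ξ_mul_Ω, mul_zero]
  have hΩΩ : Ω * Ω = 0 := by
    nth_rw 1 [Ω]
    rw [mul_assoc, ξ_mul_Ω, mul_zero]
  simp only [elt, Fin.sum_univ_three, mul_add, add_mul, smul_mul_smul_comm, hω, ξ_mul_ω, ξ_mul_Ω,
      ξ_mul_self, mul_one, one_mul, e0, e1, e2, e3, e4, e5, smul_zero, zero_smul, hωω, hΩ, hΩω,
      hωΩ, hΩΩ]
  simp
  module

section
variable (a b : Grassmann) (i : Fin 3)
theorem cL_mul : cL i (a * b) = body a * cL i b + cL i a * body b := by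
  conv_lhs => rw [← elt_coords a, ← elt_coords b, elt_mul, cL_elt]
theorem cP_mul : cP i (a * b) = body a * cP i b + cP i a * body b +
    (cL (i + 1) a * cL (i + 2) b - cL (i + 2) a * cL (i + 1) b) := by
  conv_lhs => rw [← elt_coords a, ← elt_coords b, elt_mul, cP_elt]
theorem cT_mul : cT (a * b) = body a * cT b + cT a * body b +
    ∑ i, (cP i a * cL i b + cL i a * cP i b) := by
  conv_lhs => rw [← elt_coords a, ← elt_coords b, elt_mul, cT_elt]
end

theorem dXi_elt (i : Fin 3) (e : ℂ) (l p : Fin 3 → ℂ) (t : ℂ) :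
    dXi i (elt e l p t) = elt (l i)
      (fun j => if j = i + 1 then p (i + 2) else if j = i + 2 then -p (i + 1) else 0)
      (fun j => if j = i then t else 0) 0 := by
  have h10 := ξ_mul_swap 1 0
  have h20 := ξ_mul_swap 2 0
  have h21 := ξ_mul_swap 2 1
  fin_cases i <;>
    simp [elt, dXi_one, dXi_ξ, Fin.sum_univ_three, ω, Ω, dXi_ξ_mul, mul_assoc, h10, h20, h21] <;>
    module

theorem body_dXi (i : Fin 3) (a : Grassmann) : body (dXi i a) = cL i a := rfl

/-- The eight coordinate functionals span the dual space, so they suffice for the test in `HasD`;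
the basis `monomialBasis` used in `DiffAt` never has to be evaluated. -/
theorem hasD_of_coords {F : ℂ → Grassmann} {z : ℂ} {A : Grassmann}
    (h0 : HasDerivAt (fun t => body (F t)) (body A) z)
    (h1 : ∀ i, HasDerivAt (fun t => cL i (F t)) (cL i A) z)
    (h2 : ∀ i, HasDerivAt (fun t => cP i (F t)) (cP i A) z)
    (h3 : HasDerivAt (fun t => cT (F t)) (cT A) z) : HasD F A z := by
  intro φ
  have key : ∀ a, φ a = body a * φ 1 + ∑ i, cL i a * φ (ξ i) + ∑ i, cP i a * φ (ω i) +
      cT a * φ Ω := by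
    intro a
    conv_lhs => rw [← elt_coords a, elt]
    simp only [map_add, map_sum, map_smul, smul_eq_mul]
  rw [key A, show (fun t => φ (F t)) = fun t => body (F t) * φ 1 + ∑ i, cL i (F t) * φ (ξ i) +
    ∑ i, cP i (F t) * φ (ω i) + cT (F t) * φ Ω from funext fun t => key _]
  exact (((h0.mul_const _).add (HasDerivAt.fun_sum fun i _ => (h1 i).mul_const _)).add
    (HasDerivAt.fun_sum fun i _ => (h2 i).mul_const _)).add (h3.mul_const _)

theorem diffAt_iff {F : ℂ → Grassmann} {z : ℂ} : DiffAt F z ↔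
    DifferentiableAt ℂ (fun t => body (F t)) z ∧ (∀ i, DifferentiableAt ℂ (fun t => cL i (F t)) z) ∧
    (∀ i, DifferentiableAt ℂ (fun t => cP i (F t)) z) ∧
    DifferentiableAt ℂ (fun t => cT (F t)) z := by
  constructor
  · intro h
    exact ⟨(h.hasD body.toLinearMap).differentiableAt, fun i => (h.hasD (cL i)).differentiableAt,
      fun i => (h.hasD (cP i)).differentiableAt, (h.hasD cT).differentiableAt⟩
  · rintro ⟨h0, h1, h2, h3⟩
    refine (hasD_of_coords (A := elt (deriv (fun t => body (F t)) z)
      (fun i => deriv (fun t => cL i (F t)) z) (fun i => deriv (fun t => cP i (F t)) z)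
      (deriv (fun t => cT (F t)) z)) ?_ (fun i => ?_) (fun i => ?_) ?_).diffAt
    · rw [body_elt]; exact h0.hasDerivAt
    · rw [cL_elt]; exact (h1 i).hasDerivAt
    · rw [cP_elt]; exact (h2 i).hasDerivAt
    · rw [cT_elt]; exact h3.hasDerivAt

section
variable {F : ℂ → Grassmann} {z : ℂ}
theorem DiffAt.body_dX (h : DiffAt F z) : body (dX F z) = deriv (fun t => body (F t)) z :=
  ((h.hasD body.toLinearMap).deriv).symm
theorem DiffAt.cL_dX (h : DiffAt F z) (i : Fin 3) : cL i (dX F z) = deriv (fun t => cL i (F t)) z :=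
  ((h.hasD (cL i)).deriv).symm
theorem DiffAt.cP_dX (h : DiffAt F z) (i : Fin 3) : cP i (dX F z) = deriv (fun t => cP i (F t)) z :=
  ((h.hasD (cP i)).deriv).symm
theorem DiffAt.cT_dX (h : DiffAt F z) : cT (dX F z) = deriv (fun t => cT (F t)) z :=
  ((h.hasD cT).deriv).symm
end

end SuperCP1
end

/-! ### Degree and parity in coordinates. -/

noncomputable section

namespace SuperCP1

theorem ι_eq_sum (m : Fin 3 → ℂ) : ExteriorAlgebra.ι ℂ m = ∑ i, m i • ξ i := by
  conv_lhs => rw [← Finset.univ_sum_single m]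
  rw [map_sum]
  refine Finset.sum_congr rfl fun i _ => ?_
  rw [ξ, ← map_smul, ← Pi.single_smul, smul_eq_mul, mul_one]

@[simp] theorem body_ι (m : Fin 3 → ℂ) : body (ExteriorAlgebra.ι ℂ m) = 0 := by
  simp [ι_eq_sum]
@[simp] theorem cL_ι (i : Fin 3) (m : Fin 3 → ℂ) : cL i (ExteriorAlgebra.ι ℂ m) = m i := by
  simp [ι_eq_sum]
@[simp] theorem cP_ι (i : Fin 3) (m : Fin 3 → ℂ) : cP i (ExteriorAlgebra.ι ℂ m) = 0 := by
  simp [ι_eq_sum]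
@[simp] theorem cT_ι (m : Fin 3 → ℂ) : cT (ExteriorAlgebra.ι ℂ m) = 0 := by
  simp [ι_eq_sum]

theorem ω_mem (l : Fin 3) : ω l ∈ ⋀[ℂ]^2 (Fin 3 → ℂ) := by
  rw [ω, ExteriorAlgebra.exteriorPower, pow_two]
  exact Submodule.mul_mem_mul ⟨_, rfl⟩ ⟨_, rfl⟩

theorem Ω_mem : Ω ∈ ⋀[ℂ]^3 (Fin 3 → ℂ) := by
  rw [Ω, ExteriorAlgebra.exteriorPower, pow_succ, pow_two]
  exact Submodule.mul_mem_mul (Submodule.mul_mem_mul ⟨_, rfl⟩ ⟨_, rfl⟩) ⟨_, rfl⟩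

theorem mem_deg2 {a : Grassmann} :
    a ∈ ⋀[ℂ]^2 (Fin 3 → ℂ) ↔ a = elt 0 0 (fun l => cP l a) 0 := by
  constructor
  · intro h
    have : body a = 0 ∧ (∀ i, cL i a = 0) ∧ cT a = 0 := by
      rw [ExteriorAlgebra.exteriorPower, pow_two] at h
      induction h using Submodule.mul_induction_on' with
      | add p _ q _ hp hq => simp [hp.1, hp.2.1, hp.2.2, hq.1, hq.2.1, hq.2.2]
      | mem_mul_mem p hp q hq =>
        obtain ⟨p, rfl⟩ := hp
        obtain ⟨q, rfl⟩ := hq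
        simp [cL_mul, cT_mul]
    exact gext (by simp [this.1]) (by simp [this.2.1]) (by simp) (by simp [this.2.2])
  · intro h
    rw [h, elt]
    simp only [zero_smul, Pi.zero_apply, Finset.sum_const_zero, zero_add, add_zero]
    exact Submodule.sum_mem _ fun i _ => Submodule.smul_mem _ _ (ω_mem i)

theorem mem_deg3 {a : Grassmann} :
    a ∈ ⋀[ℂ]^3 (Fin 3 → ℂ) ↔ a = elt 0 0 0 (cT a) := by
  constructor
  · intro h
    have : body a = 0 ∧ (∀ i, cL i a = 0) ∧ (∀ i, cP i a = 0) := by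
      rw [ExteriorAlgebra.exteriorPower, pow_succ, ← ExteriorAlgebra.exteriorPower] at h
      induction h using Submodule.mul_induction_on' with
      | add p _ q _ hp hq => simp [hp.1, hp.2.1, hp.2.2, hq.1, hq.2.1, hq.2.2]
      | mem_mul_mem p hp q hq =>
        rw [mem_deg2] at hp
        obtain ⟨q, rfl⟩ := hq
        rw [hp]
        simp [cL_mul, cP_mul]
    exact gext (by simp [this.1]) (by simp [this.2.1]) (by simp [this.2.2]) (by simp)
  · intro h
    rw [h, elt]
    simp only [zero_smul, Pi.zero_apply, Finset.sum_const_zero, zero_add]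
    exact Submodule.smul_mem _ _ Ω_mem

theorem involute_elt (e : ℂ) (l p : Fin 3 → ℂ) (t : ℂ) :
    CliffordAlgebra.involute (elt e l p t) = elt e (-l) p (-t) := by
  have h (i : Fin 3) : CliffordAlgebra.involute (ξ i) = -ξ i :=
    CliffordAlgebra.involute_ι _
  simp only [elt, map_add, map_smul, map_one, map_sum, h, ω, Ω, map_mul, neg_mul, neg_neg,
    Pi.neg_apply, smul_neg, neg_smul, mul_neg]

/-- The grade involution fixes even elements and changes the sign of the coordinates `cL` and `cT`,
which therefore equal their own negatives. -/
theorem mem_parityPart_zero {a : Grassmann} :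
    a ∈ parityPart 0 ↔ (∀ i, cL i a = 0) ∧ cT a = 0 := by
  constructor
  · intro h
    have h := CliffordAlgebra.involute_eq_of_mem_even h
    rw [← elt_coords a, involute_elt] at h
    refine ⟨fun i => ?_, ?_⟩
    · have := congrArg (cL i) h
      simp only [cL_elt, Pi.neg_apply] at this
      exact self_eq_neg.1 this.symm
    · have := congrArg cT h
      simp only [cT_elt] at this
      exact self_eq_neg.1 this.symm
  · rintro ⟨h1, h2⟩
    rw [← elt_coords a, elt]
    simp only [h1, h2, zero_smul, Finset.sum_const_zero, add_zero]
    refine Submodule.add_mem _ (Submodule.smul_mem _ _ ?_)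
      (Submodule.sum_mem _ fun i _ => Submodule.smul_mem _ _ ?_)
    · exact SetLike.one_mem_graded (CliffordAlgebra.evenOdd _)
    · exact CliffordAlgebra.ι_mul_ι_mem_evenOdd_zero _ _ _

theorem mem_parityPart_one {a : Grassmann} :
    a ∈ parityPart 1 ↔ body a = 0 ∧ (∀ i, cP i a = 0) := by
  constructor
  · intro h
    have h := CliffordAlgebra.involute_eq_of_mem_odd h
    rw [← elt_coords a, involute_elt] at h
    refine ⟨?_, fun i => ?_⟩
    · have := congrArg body h
      simp only [body_elt, map_neg] at this
      exact self_eq_neg.1 this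
    · have := congrArg (cP i) h
      simp only [cP_elt, map_neg] at this
      exact self_eq_neg.1 this
  · rintro ⟨h1, h2⟩
    rw [← elt_coords a, elt]
    simp only [h1, h2, zero_smul, Finset.sum_const_zero, add_zero, zero_add]
    have hξ (i : Fin 3) : ξ i ∈ parityPart 1 := CliffordAlgebra.ι_mem_evenOdd_one _ _
    have hω : ω 1 ∈ parityPart 0 := CliffordAlgebra.ι_mul_ι_mem_evenOdd_zero _ _ _
    have hΩ : Ω ∈ parityPart 1 := by
      have : Ω = ω 1 * ξ 1 := by
        rw [comm_of_deg2 (ω_mem 1), ξ_mul_ω, if_pos rfl]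
      rw [this]
      have h := CliffordAlgebra.evenOdd_mul_le (0 : QuadraticForm ℂ (Fin 3 → ℂ)) 0 1
        (Submodule.mul_mem_mul hω (hξ 1))
      rwa [zero_add] at h
    exact Submodule.add_mem _ (Submodule.sum_mem _ fun i _ => Submodule.smul_mem _ _ (hξ i))
      (Submodule.smul_mem _ _ hΩ)

/-! ### Linear substitutions in coordinates -/

/-- The algebra map `ξ j ↦ ∑ i, A i j • ξ i`. -/
abbrev gmap (A : Matrix (Fin 3) (Fin 3) ℂ) : Grassmann →ₐ[ℂ] Grassmann :=
  ExteriorAlgebra.map (Matrix.toLin' A)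

theorem gmap_mul (A B : Matrix (Fin 3) (Fin 3) ℂ) (a : Grassmann) :
    gmap A (gmap B a) = gmap (A * B) a := by
  rw [gmap, gmap, gmap, Matrix.toLin'_mul, ← ExteriorAlgebra.map_comp_map, AlgHom.comp_apply]

theorem gmap_one (a : Grassmann) : gmap 1 a = a := by
  rw [gmap, Matrix.toLin'_one, ExteriorAlgebra.map_id, AlgHom.id_apply]

theorem gmap_ξ (A : Matrix (Fin 3) (Fin 3) ℂ) (j : Fin 3) : gmap A (ξ j) = ∑ i, A i j • ξ i := by
  rw [gmap, ξ, ExteriorAlgebra.map_apply_ι, ι_eq_sum]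
  simp

/-- An algebra map is determined on the generators; on bivectors it acts by the two by two minors
and on `Ω` by the determinant. -/
theorem gmap_coords (A : Matrix (Fin 3) (Fin 3) ℂ) (a : Grassmann) :
    body (gmap A a) = body a ∧ (∀ i, cL i (gmap A a) = ∑ j, A i j * cL j a) ∧
    (∀ i, cP i (gmap A a) = ∑ j, (A (i + 1) (j + 1) * A (i + 2) (j + 2) -
      A (i + 2) (j + 1) * A (i + 1) (j + 2)) * cP j a) ∧
    cT (gmap A a) = A.det * cT a := by
  have hξ := gmap_ξ A
  have b0 (j : Fin 3) : body (gmap A (ξ j)) = 0 := by rw [hξ]; simp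
  have l0 (i j : Fin 3) : cL i (gmap A (ξ j)) = A i j := by rw [hξ]; simp
  have p0 (i j : Fin 3) : cP i (gmap A (ξ j)) = 0 := by rw [hξ]; simp
  have t0 (j : Fin 3) : cT (gmap A (ξ j)) = 0 := by rw [hξ]; simp
  have hω (j : Fin 3) : gmap A (ω j) = gmap A (ξ (j + 1)) * gmap A (ξ (j + 2)) := by
    rw [ω, map_mul]
  have hΩ : gmap A Ω = gmap A (ξ 0) * gmap A (ξ 1) * gmap A (ξ 2) := by
    rw [Ω, map_mul, map_mul]
  -- From here only the values on `ξ`, `ω` and `Ω` matter, so the map becomes opaque and its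
  -- argument is expanded in coordinates.
  generalize gmap A = f at *
  conv in (occs := *) f a => all_goals rw [← elt_coords a]
  simp only [elt, map_add, map_smul, map_one, map_sum, hω, hΩ]
  refine ⟨?_, fun i => ?_, fun i => ?_, ?_⟩
  · simp [b0]
  · simp [cL_mul, b0, l0, mul_comm]
  · simp [cP_mul, cL_mul, b0, l0, p0, mul_comm]
  · simp [cT_mul, cP_mul, cL_mul, b0, l0, p0, t0, Fin.sum_univ_three, Matrix.det_fin_three]
    ring

section
variable (A : Matrix (Fin 3) (Fin 3) ℂ) (a : Grassmann) (i : Fin 3)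
theorem body_gmap : body (gmap A a) = body a := (gmap_coords A a).1
theorem cL_gmap : cL i (gmap A a) = ∑ j, A i j * cL j a := (gmap_coords A a).2.1 i
theorem cP_gmap : cP i (gmap A a) = ∑ j, (A (i + 1) (j + 1) * A (i + 2) (j + 2) -
      A (i + 2) (j + 1) * A (i + 1) (j + 2)) * cP j a := (gmap_coords A a).2.2.1 i
theorem cT_gmap : cT (gmap A a) = A.det * cT a := (gmap_coords A a).2.2.2
end

/-- The weight of `ω l`. -/
def wt (k : Fin 3 → ℤ) (l : Fin 3) : ℤ := k (l + 1) + k (l + 2)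

/-- `ω l` and `ξ l` are complementary factors of `Ω`. Hence `Ω ∂/∂ξ_l` has the same odd weight as `ω
l`, and the two belong to one slot. -/
theorem wt_add (k : Fin 3 → ℤ) (l : Fin 3) : wt k l + k l = k 0 + k 1 + k 2 := by
  fin_cases l <;> simp [wt] <;> ring

section
variable (k : Fin 3 → ℤ) (F : ℂ → Grassmann) (x : ℂ) (i : Fin 3)
theorem body_subst (g : ℂ → Matrix (Fin 3) (Fin 3) ℂ) : body (subst g F x) = body (F x⁻¹) :=
  body_gmap _ _
theorem cL_subst : cL i (subst (diagMatrix k) F x) = x ^ (-k i) * cL i (F x⁻¹) := by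
  rw [subst, cL_gmap]
  simp [diagMatrix, Matrix.diagonal_apply]
theorem cP_subst (hx : x ≠ 0) :
    cP i (subst (diagMatrix k) F x) = x ^ (-wt k i) * cP i (F x⁻¹) := by
  rw [subst, cP_gmap, wt, neg_add, zpow_add₀ hx]
  fin_cases i <;> simp [diagMatrix, Fin.sum_univ_three]
theorem cT_subst (hx : x ≠ 0) :
    cT (subst (diagMatrix k) F x) = x ^ (-(k 0 + k 1 + k 2)) * cT (F x⁻¹) := by
  rw [subst, cT_gmap, neg_add, neg_add, zpow_add₀ hx, zpow_add₀ hx]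
  simp [diagMatrix, Fin.prod_univ_three]
  exact Or.inl (by ring)
end

/-! ### Vector fields of degree two in coordinates -/

/-- The coefficients of `ω l ∂/∂x`. -/
def pC (X : EvenVF) (l : Fin 3) (z : ℂ) : ℂ := cP l (X none z)

/-- The coefficients of `Ω ∂/∂ξ_l`. -/
def qC (X : EvenVF) (l : Fin 3) (z : ℂ) : ℂ := cT (X (some l) z)

/-- `∑ l, p l ω_l ∂/∂x + ∑ l, q l Ω ∂/∂ξ_l`. -/
def vec (p q : Fin 3 → ℂ → ℂ) : EvenVF :=
  vf (fun z => elt 0 0 (fun l => p l z) 0) fun l z => elt 0 0 0 (q l z)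

@[simp] theorem pC_vec (p q : Fin 3 → ℂ → ℂ) (l : Fin 3) (z : ℂ) : pC (vec p q) l z = p l z := by
  simp [pC, vec, vf]

@[simp] theorem qC_vec (p q : Fin 3 → ℂ → ℂ) (l : Fin 3) (z : ℂ) : qC (vec p q) l z = q l z := by
  simp [qC, vec, vf]

theorem isT2_vec {p q : Fin 3 → ℂ → ℂ} {W : Set ℂ}
    (hp : ∀ l, ∀ z ∈ W, DifferentiableAt ℂ (p l) z)
    (hq : ∀ l, ∀ z ∈ W, DifferentiableAt ℂ (q l) z) : IsT2 (vec p q) W where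
  diff o z hz := by
    rw [diffAt_iff]
    rcases o with _ | l
    · simpa [vec, vf] using fun i => hp i z hz
    · simpa [vec, vf] using hq l z hz
  deg_x z hz := by
    rw [mem_deg2]
    simp [vec, vf]
  deg_ξ i z hz := by
    rw [mem_deg3]
    simp [vec, vf]

section
variable {X : EvenVF} {W : Set ℂ}

theorem IsT2.eq_x (hX : IsT2 X W) {z : ℂ} (hz : z ∈ W) :
    X none z = elt 0 0 (fun l => pC X l z) 0 := mem_deg2.1 (hX.deg_x z hz)

theorem IsT2.eq_ξ (hX : IsT2 X W) {z : ℂ} (hz : z ∈ W) (l : Fin 3) :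
    X (some l) z = elt 0 0 0 (qC X l z) := mem_deg3.1 (hX.deg_ξ l z hz)

theorem IsT2.diff_p (hX : IsT2 X W) {z : ℂ} (hz : z ∈ W) (l : Fin 3) :
    DifferentiableAt ℂ (pC X l) z := (diffAt_iff.1 (hX.diff none z hz)).2.2.1 l

theorem IsT2.diff_q (hX : IsT2 X W) {z : ℂ} (hz : z ∈ W) (l : Fin 3) :
    DifferentiableAt ℂ (qC X l) z := (diffAt_iff.1 (hX.diff (some l) z hz)).2.2.2

/-- The action of a vector field of degree two in coordinates. -/
theorem IsT2.app_eq (hX : IsT2 X W) {z : ℂ} (hz : z ∈ W) {F : ℂ → Grassmann} (hF : DiffAt F z) :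
    app X F z = elt 0 0 (fun l => pC X l z * deriv (fun t => body (F t)) z)
      (∑ l, (pC X l z * deriv (fun t => cL l (F t)) z + qC X l z * cL l (F z))) := by
  rw [app, hX.eq_x hz]
  simp only [hX.eq_ξ hz]
  refine gext ?_ (fun i => ?_) (fun i => ?_) ?_
  · simp
  · simp [cL_mul]
  · simp [cP_mul, hF.body_dX]
  · simp [cT_mul, body_dXi, hF.cL_dX, Finset.sum_add_distrib]
end

end SuperCP1
end

/-! ### Locality and coordinate form of fields of degree two. -/

noncomputable section

namespace SuperCP1

theorem IsT2.congr {X Y : EvenVF} {W : Set ℂ} (hW : IsOpen W) (hX : IsT2 X W)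
    (h : ∀ o, ∀ z ∈ W, Y o z = X o z) : IsT2 Y W where
  diff o z hz := (hX.diff o z hz).congr (by
    filter_upwards [hW.mem_nhds hz] with t ht using h o t ht)
  deg_x z hz := by rw [h none z hz]; exact hX.deg_x z hz
  deg_ξ i z hz := by rw [h (some i) z hz]; exact hX.deg_ξ i z hz

theorem isOpen_punctured : IsOpen ({0}ᶜ : Set ℂ) := isOpen_compl_singleton

theorem eventually_ne_zero {x : ℂ} (hx : x ≠ 0) : ∀ᶠ t in nhds x, t ≠ 0 :=
  isOpen_punctured.mem_nhds hx

theorem IsT2.eq_vec {X : EvenVF} {W : Set ℂ} (hX : IsT2 X W) {z : ℂ} (hz : z ∈ W) (o) :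
    X o z = vec (pC X) (qC X) o z := by
  rcases o with _ | l
  · exact hX.eq_x hz
  · exact hX.eq_ξ hz l

/-! ### Change of charts -/

theorem hasDerivAt_zpow' (n : ℤ) {x : ℂ} (hx : x ≠ 0) :
    HasDerivAt (fun t : ℂ => t ^ n) (n * x ^ (n - 1)) x := hasDerivAt_zpow n x (Or.inl hx)

theorem diffAt_zpow_smul_ξ (n : ℤ) (i : Fin 3) {x : ℂ} (hx : x ≠ 0) :
    DiffAt (fun t => t ^ n • ξ i) x :=
  (HasD.smul (hasDerivAt_zpow' n hx) (hasD_const (ξ i) x)).diffAt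

theorem diffAt_algebraMap {f : ℂ → ℂ} {x : ℂ} (hf : DifferentiableAt ℂ f x) :
    DiffAt (fun t => algebraMap ℂ Grassmann (f t)) x := by
  simp only [Algebra.algebraMap_eq_smul_one]
  exact (HasD.smul hf.hasDerivAt (hasD_const 1 x)).diffAt

/-- The transition matrix is diagonal, so slots are not mixed. The term with `pC` in the second
component comes from differentiating `y ^ (-k l)`; it is the extension datum between the two line
bundles of the slot. -/
theorem toChart0_eq {k : Fin 3 → ℤ} {Y : EvenVF} (hY : IsT2 Y Set.univ) {x : ℂ} (hx : x ≠ 0) (o) :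
    toChart0 k Y o x = vec (fun l x => -(x ^ (2 - wt k l) * pC Y l x⁻¹))
      (fun l x => x ^ (-wt k l) * qC Y l x⁻¹ - k l * x ^ (1 - wt k l) * pC Y l x⁻¹) o x := by
  have hx' : x⁻¹ ≠ 0 := inv_ne_zero hx
  rcases o with _ | i
  · have e : app Y (fun y => algebraMap ℂ Grassmann y⁻¹) x⁻¹ =
        elt 0 0 (fun l => -(x ^ 2 * pC Y l x⁻¹)) 0 := by
      rw [hY.app_eq (Set.mem_univ _) (diffAt_algebraMap (differentiableAt_inv hx'))]
      have : deriv (fun t : ℂ => t⁻¹) x⁻¹ = -x ^ 2 := by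
        rw [deriv_inv]; field_simp
      simp [this, Algebra.algebraMap_eq_smul_one, mul_comm]
    refine gext ?_ (fun l => ?_) (fun l => ?_) ?_
    · change body (subst _ _ _) = _
      rw [body_subst, e]; simp [vec, vf]
    · change cL l (subst _ _ _) = _
      rw [cL_subst, e]; simp [vec, vf]
    · change cP l (subst _ _ _) = _
      have h2 : x ^ (2 - wt k l) = x ^ 2 * x ^ (-wt k l) := by
        rw [sub_eq_add_neg, zpow_add₀ hx, zpow_ofNat]
      rw [cP_subst _ _ _ _ hx, e]
      simp only [vec, vf, Option.elim, cP_elt, h2]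
      ring
    · change cT (subst _ _ _) = _
      rw [cT_subst _ _ _ hx, e]; simp [vec, vf]
  · have e : app Y (fun y => y ^ (-k i) • ξ i) x⁻¹ =
        elt 0 0 0 (x ^ (k i) * qC Y i x⁻¹ - k i * x ^ (k i + 1) * pC Y i x⁻¹) := by
      rw [hY.app_eq (Set.mem_univ _) (diffAt_zpow_smul_ξ _ _ hx')]
      have : ∀ l, (fun t : ℂ => cL l (t ^ (-k i) • ξ i)) =
          fun t => t ^ (-k i) * (if l = i then 1 else 0) := by
        intro l; funext t; simp
      have h1 : deriv (fun t : ℂ => t ^ (-k i)) x⁻¹ = -k i * x ^ (k i + 1) := by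
        rw [(hasDerivAt_zpow' _ hx').deriv, inv_zpow', neg_sub, sub_neg_eq_add, add_comm]
        push_cast; ring
      refine gext (by simp) (by simp) (by simp) ?_
      simp only [this, deriv_mul_const_field, h1, cT_elt]
      simp [Finset.sum_add_distrib]
      ring
    refine gext ?_ (fun l => ?_) (fun l => ?_) ?_
    · change body (subst _ _ _) = _
      rw [body_subst, e]; simp [vec, vf]
    · change cL l (subst _ _ _) = _
      rw [cL_subst, e]; simp [vec, vf]
    · change cP l (subst _ _ _) = _
      rw [cP_subst _ _ _ _ hx, e]; simp [vec, vf]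
    · change cT (subst _ _ _) = _
      have h1 : x ^ (1 - wt k i) = x * x ^ (-wt k i) := by
        rw [sub_eq_add_neg, zpow_add₀ hx, zpow_one]
      have h2 : x ^ k i ≠ 0 := zpow_ne_zero _ hx
      rw [cT_subst _ _ _ hx, e, ← wt_add k i, neg_add, zpow_add₀ hx, zpow_add₀ hx (k i),
        zpow_neg x (k i), zpow_one]
      simp only [vec, vf, Option.elim, cT_elt, h1]
      field_simp

theorem differentiableAt_zpow_mul_inv {f : ℂ → ℂ} (hf : ∀ z, DifferentiableAt ℂ f z) (n : ℤ) {x : ℂ}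
    (hx : x ≠ 0) : DifferentiableAt ℂ (fun x => x ^ n * f x⁻¹) x :=
  (hasDerivAt_zpow' n hx).differentiableAt.mul ((hf x⁻¹).comp x (differentiableAt_inv hx))

theorem isT2_toChart0 (k : Fin 3 → ℤ) {Y : EvenVF} (hY : IsT2 Y Set.univ) :
    IsT2 (toChart0 k Y) {0}ᶜ := by
  refine IsT2.congr isOpen_punctured (isT2_vec ?_ ?_) fun o z hz => toChart0_eq hY hz o
  · intro l z hz
    exact (differentiableAt_zpow_mul_inv (fun w => hY.diff_p (Set.mem_univ w) l) _ hz).neg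
  · intro l z hz
    refine (differentiableAt_zpow_mul_inv (fun w => hY.diff_q (Set.mem_univ w) l) _ hz).sub ?_
    simp only [mul_assoc]
    exact (differentiableAt_zpow_mul_inv (fun w => hY.diff_p (Set.mem_univ w) l) _ hz).const_mul _

/-! ### Coboundaries in coordinates -/

/-- The pair `(p, q)` of coefficients of `ω_l ∂/∂x` and `Ω ∂/∂ξ_l` is a coboundary; here `m` is the
weight of `ω_l` and `κ` the one of `ξ_l`. -/
def PairCob (m κ : ℤ) (p q : ℂ → ℂ) : Prop :=
  ∃ a₀ b₀ a₁ b₁ : ℂ → ℂ, Differentiable ℂ a₀ ∧ Differentiable ℂ b₀ ∧ Differentiable ℂ a₁ ∧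
    Differentiable ℂ b₁ ∧ ∀ x : ℂ, x ≠ 0 → p x = a₀ x + x ^ (2 - m) * a₁ x⁻¹ ∧
      q x = b₀ x + x ^ (-m) * b₁ x⁻¹ + κ * x ^ (1 - m) * a₁ x⁻¹

theorem PairCob.congr {m κ : ℤ} {p q p' q' : ℂ → ℂ} (h : PairCob m κ p q)
    (hp : ∀ x, x ≠ 0 → p' x = p x) (hq : ∀ x, x ≠ 0 → q' x = q x) : PairCob m κ p' q' := by
  obtain ⟨a₀, b₀, a₁, b₁, h1, h2, h3, h4, h⟩ := h
  exact ⟨a₀, b₀, a₁, b₁, h1, h2, h3, h4, fun x hx => by rw [hp x hx, hq x hx]; exact h x hx⟩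

/-- The primitives on the two charts are themselves determined by their `p` and `q` coordinates, so
`toChart0_eq` lets each slot be solved separately. The sign of `b₁` in `PairCob` is opposite to that
of `qC w₁`. -/
theorem isCoboundary_iff {k : Fin 3 → ℤ} {v : EvenVF} (hv : IsT2 v {0}ᶜ) :
    IsCoboundary k v ↔ ∀ l, PairCob (wt k l) (k l) (pC v l) (qC v l) := by
  constructor
  · rintro ⟨w₀, w₁, h0, h1, h⟩ l
    refine ⟨pC w₀ l, qC w₀ l, pC w₁ l, fun y => -qC w₁ l y, fun z => h0.diff_p (Set.mem_univ z) l,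
      fun z => h0.diff_q (Set.mem_univ z) l, fun z => h1.diff_p (Set.mem_univ z) l,
      fun z => (h1.diff_q (Set.mem_univ z) l).neg, fun x hx => ⟨?_, ?_⟩⟩
    · rw [pC, h none x hx, map_sub, toChart0_eq h1 hx]
      simp [vec, vf, pC]
    · rw [qC, h (some l) x hx, map_sub, toChart0_eq h1 hx]
      simp [vec, vf, qC]
      ring
  · intro h
    choose a₀ b₀ a₁ b₁ ha₀ hb₀ ha₁ hb₁ h using h
    have h1 : IsT2 (vec a₁ fun l y => -b₁ l y) Set.univ :=
      isT2_vec (fun l z _ => ha₁ l z) fun l z _ => (hb₁ l z).neg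
    refine ⟨vec a₀ b₀, vec a₁ fun l y => -b₁ l y, isT2_vec (fun l z _ => ha₀ l z)
      fun l z _ => hb₀ l z, h1, ?_⟩
    intro o x hx
    rw [hv.eq_vec (W := {0}ᶜ) hx o, toChart0_eq h1 hx]
    rcases o with _ | l
    · refine gext (by simp [vec, vf]) (by simp [vec, vf]) (fun l => ?_) (by simp [vec, vf])
      simp only [pC_vec, qC_vec]
      simp only [vec, vf, Option.elim, map_sub, cP_elt, (h l x hx).1]
      ring
    · refine gext (by simp [vec, vf]) (by simp [vec, vf]) (by simp [vec, vf]) ?_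
      simp only [pC_vec, qC_vec]
      simp only [vec, vf, Option.elim, map_sub, cT_elt, (h l x hx).2]
      ring

theorem app_add_left (X Y : EvenVF) (F : ℂ → Grassmann) (z : ℂ) :
    app (X + Y) F z = app X F z + app Y F z := by
  simp only [app, Pi.add_apply, add_mul, Finset.sum_add_distrib]
  abel

theorem app_smul_left (c : ℂ) (X : EvenVF) (F : ℂ → Grassmann) (z : ℂ) :
    app (c • X) F z = c • app X F z := by
  simp only [app, Pi.smul_apply, smul_mul_assoc, smul_add, Finset.smul_sum]

theorem app_add_right (X : EvenVF) {F G : ℂ → Grassmann} {z : ℂ} (hF : DiffAt F z)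
    (hG : DiffAt G z) : app X (F + G) z = app X F z + app X G z := by
  simp only [app, (hF.hasD.add hG.hasD).dX_eq, Pi.add_apply, map_add, mul_add,
    Finset.sum_add_distrib]
  abel

theorem hasD_const_smul {F : ℂ → Grassmann} {z : ℂ} (c : ℂ) (hF : DiffAt F z) :
    HasD (c • F) (c • dX F z) z := by
  have := HasD.smul (hasDerivAt_const z c) hF.hasD
  rwa [zero_smul, zero_add] at this

theorem app_smul_right (X : EvenVF) (c : ℂ) {F : ℂ → Grassmann} {z : ℂ} (hF : DiffAt F z) :
    app X (c • F) z = c • app X F z := by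
  simp only [app, (hasD_const_smul c hF).dX_eq, Pi.smul_apply, map_smul, mul_smul_comm, smul_add,
    Finset.smul_sum]

theorem IsCoboundary.congr {k : Fin 3 → ℤ} {v w : EvenVF} (hv : IsCoboundary k v)
    (h : ∀ o, ∀ x, x ≠ 0 → w o x = v o x) : IsCoboundary k w := by
  obtain ⟨w₀, w₁, h0, h1, h'⟩ := hv
  exact ⟨w₀, w₁, h0, h1, fun o x hx => by rw [h o x hx, h' o x hx]⟩

theorem isCoboundary_zero (k : Fin 3 → ℤ) : IsCoboundary k 0 := by
  rw [isCoboundary_iff (isT2_zero _)]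
  exact fun l => ⟨0, 0, 0, 0, differentiable_const _, differentiable_const _,
    differentiable_const _, differentiable_const _, fun x _ => by simp [pC, qC]⟩

theorem IsT2.add {X Y : EvenVF} {W : Set ℂ} (hX : IsT2 X W) (hY : IsT2 Y W) : IsT2 (X + Y) W where
  diff o z hz := (hX.diff o z hz).add (hY.diff o z hz)
  deg_x z hz := Submodule.add_mem _ (hX.deg_x z hz) (hY.deg_x z hz)
  deg_ξ i z hz := Submodule.add_mem _ (hX.deg_ξ i z hz) (hY.deg_ξ i z hz)

theorem IsT2.smul {X : EvenVF} {W : Set ℂ} (c : ℂ) (hX : IsT2 X W) : IsT2 (c • X) W where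
  diff o z hz := (hasD_const_smul c (hX.diff o z hz)).diffAt
  deg_x z hz := Submodule.smul_mem _ _ (hX.deg_x z hz)
  deg_ξ i z hz := Submodule.smul_mem _ _ (hX.deg_ξ i z hz)

theorem toChart0_add (k : Fin 3 → ℤ) (X Y : EvenVF) :
    toChart0 k (X + Y) = toChart0 k X + toChart0 k Y := by
  funext o x
  rcases o with _ | i <;> simp [toChart0, vf, subst, app_add_left]

theorem toChart0_smul (k : Fin 3 → ℤ) (c : ℂ) (X : EvenVF) :
    toChart0 k (c • X) = c • toChart0 k X := by
  funext o x
  rcases o with _ | i <;> simp [toChart0, vf, subst, app_smul_left]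

theorem IsCoboundary.add {k : Fin 3 → ℤ} {v w : EvenVF} (hv : IsCoboundary k v)
    (hw : IsCoboundary k w) : IsCoboundary k (v + w) := by
  obtain ⟨v₀, v₁, h0, h1, h⟩ := hv
  obtain ⟨w₀, w₁, h0', h1', h'⟩ := hw
  refine ⟨v₀ + w₀, v₁ + w₁, h0.add h0', h1.add h1', fun o x hx => ?_⟩
  rw [toChart0_add]
  simp only [Pi.add_apply, h o x hx, h' o x hx]
  abel

theorem IsCoboundary.smul {k : Fin 3 → ℤ} {v : EvenVF} (c : ℂ) (hv : IsCoboundary k v) :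
    IsCoboundary k (c • v) := by
  obtain ⟨v₀, v₁, h0, h1, h⟩ := hv
  refine ⟨c • v₀, c • v₁, h0.smul c, h1.smul c, fun o x hx => ?_⟩
  rw [toChart0_smul]
  simp only [Pi.smul_apply, h o x hx, smul_sub]

/-! ### Brackets with fields of degree zero -/

/-- The vector field `c ∂/∂x + ∑ i l, B i l ξ_i ∂/∂ξ_l`. -/
def linVF (c : ℂ → ℂ) (B : Fin 3 → Fin 3 → ℂ → ℂ) : EvenVF :=
  vf (fun x => elt (c x) 0 0 0) fun l x => elt 0 (fun i => B i l x) 0 0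

theorem IsT2.dX_x {X : EvenVF} {W : Set ℂ} (hW : IsOpen W) (hX : IsT2 X W) {z : ℂ} (hz : z ∈ W) :
    dX (X none) z = elt 0 0 (fun l => deriv (pC X l) z) 0 := by
  have h := hX.diff none z hz
  have e : ∀ᶠ t in nhds z, X none t = elt 0 0 (fun l => pC X l t) 0 := by
    filter_upwards [hW.mem_nhds hz] with t ht using hX.eq_x ht
  refine gext ?_ (fun i => ?_) (fun i => ?_) ?_
  · rw [h.body_dX, Filter.EventuallyEq.deriv_eq (e.mono fun t ht => congrArg body ht)]; simp
  · rw [h.cL_dX, Filter.EventuallyEq.deriv_eq (e.mono fun t ht => congrArg (cL i) ht)]; simp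
  · rw [h.cP_dX]; simp; rfl
  · rw [h.cT_dX, Filter.EventuallyEq.deriv_eq (e.mono fun t ht => congrArg cT ht)]; simp

theorem IsT2.dX_ξ {X : EvenVF} {W : Set ℂ} (hW : IsOpen W) (hX : IsT2 X W) {z : ℂ} (hz : z ∈ W)
    (l : Fin 3) : dX (X (some l)) z = elt 0 0 0 (deriv (qC X l) z) := by
  have h := hX.diff (some l) z hz
  have e : ∀ᶠ t in nhds z, X (some l) t = elt 0 0 0 (qC X l t) := by
    filter_upwards [hW.mem_nhds hz] with t ht using hX.eq_ξ ht l
  refine gext ?_ (fun i => ?_) (fun i => ?_) ?_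
  · rw [h.body_dX, Filter.EventuallyEq.deriv_eq (e.mono fun t ht => congrArg body ht)]; simp
  · rw [h.cL_dX, Filter.EventuallyEq.deriv_eq (e.mono fun t ht => congrArg (cL i) ht)]; simp
  · rw [h.cP_dX, Filter.EventuallyEq.deriv_eq (e.mono fun t ht => congrArg (cP i) ht)]; simp
  · rw [h.cT_dX]; simp; rfl

/-- A linear field with matrix `B` acts on bivectors, identified with covectors by the volume
element, through trace minus transpose; this gives the terms in `p`. On `Ω` it acts by the trace,
and bracketing with `∂/∂ξ_j` subtracts the matrix again. The derivative of `B` enters because `v`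
differentiates the coefficients of `u`. -/
theorem bracket_linVF {u v : EvenVF} {W : Set ℂ} (hW : IsOpen W) (hv : IsT2 v W) {c : ℂ → ℂ}
    {B : Fin 3 → Fin 3 → ℂ → ℂ} (hc : ∀ z ∈ W, DifferentiableAt ℂ c z)
    (hB : ∀ i l, ∀ z ∈ W, DifferentiableAt ℂ (B i l) z)
    (hu : ∀ o, ∀ z ∈ W, u o z = linVF c B o z) {z : ℂ} (hz : z ∈ W) (o) :
    bracket u v o z = vec
      (fun j z => c z * deriv (pC v j) z - deriv c z * pC v j z +
        (B 0 0 z + B 1 1 z + B 2 2 z) * pC v j z - ∑ i, B i j z * pC v i z)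
      (fun j z => c z * deriv (qC v j) z + (B 0 0 z + B 1 1 z + B 2 2 z) * qC v j z -
        ∑ i, (deriv (B i j) z * pC v i z + B i j z * qC v i z)) o z := by
  have e : ∀ o, u o =ᶠ[nhds z] linVF c B o := fun o => by
    filter_upwards [hW.mem_nhds hz] with t ht using hu o t ht
  have hd : ∀ o, DiffAt (linVF c B o) z := by
    rintro (_ | l)
    · simp [diffAt_iff, linVF, vf, hc z hz]
    · simpa [diffAt_iff, linVF, vf] using fun i => hB i l z hz
  rw [bracket, app_congr _ (e o), hv.app_eq hz (hd o), app, hu _ z hz]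
  simp only [hu _ z hz]
  rcases o with _ | l
  · rw [hv.dX_x hW hz, hv.eq_x hz]
    simp only [dXi_elt]
    refine gext ?_ (fun i => ?_) (fun i => ?_) ?_
    · simp [linVF, vf, vec]
    · simp [linVF, vf, vec, cL_mul]
    · simp [linVF, vf, vec, cP_mul, Fin.sum_univ_three]
      fin_cases i <;> simp <;> ring
    · simp [linVF, vf, vec, cT_mul]
  · rw [hv.dX_ξ hW hz, hv.eq_ξ hz]
    simp only [dXi_elt]
    refine gext ?_ (fun i => ?_) (fun i => ?_) ?_
    · simp [linVF, vf, vec]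
    · simp [linVF, vf, vec, cL_mul]
    · simp [linVF, vf, vec, cP_mul]
    · simp [linVF, vf, vec, cT_mul, Fin.sum_univ_three]
      ring

end SuperCP1
end

noncomputable section

namespace SuperCP1

/-! ### Invariance under `𝔰'` in coordinates -/

theorem elt_scalar (c : ℂ) : elt c 0 0 0 = c • 1 := by simp [elt]
theorem elt_linear (l : Fin 3 → ℂ) : elt 0 l 0 0 = ∑ i, l i • ξ i := by simp [elt]

theorem ePrime_eq (o) (z : ℂ) :
    ePrime o z = linVF (fun _ => 1) (fun i l _ => if i = 1 ∧ l = 0 then 1 else 0) o z := by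
  rcases o with _ | l
  · simp [ePrime, linVF, vf, elt_scalar]
  · fin_cases l <;> simp [ePrime, linVF, vf, elt_linear, Fin.sum_univ_three]

theorem fPrime_eq (k : Fin 3 → ℤ) (o) {x : ℂ} (hx : x ≠ 0) :
    fPrime k o x = linVF (fun x => -x ^ 2)
      (fun i l x => (if i = l then -(k l * x) else 0) +
        if i = 0 ∧ l = 1 then x ^ (k 1 - k 0) else 0) o x := by
  have hx' : x⁻¹ ≠ 0 := inv_ne_zero hx
  have happ (F : ℂ → Grassmann) (y : ℂ) :
      app (vf 1 ![0, fun _ => ξ 0, 0]) F y = dX F y + ξ 0 * dXi 1 (F y) := by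
    simp [app, vf, Fin.sum_univ_three]
  rcases o with _ | l
  · change gmap (diagMatrix k x) (app _ (fun y => algebraMap ℂ Grassmann y⁻¹) x⁻¹) = _
    have h1 : dX (fun y => algebraMap ℂ Grassmann y⁻¹) x⁻¹ = (-x ^ 2) • 1 := by
      have := HasD.smul (hasDerivAt_inv hx') (hasD_const 1 x⁻¹)
      simp only [Algebra.algebraMap_eq_smul_one]
      rw [this.dX_eq]
      simp
    rw [happ, h1, dXi_algebraMap]
    simp [linVF, vf, elt_scalar]
  · change gmap (diagMatrix k x) (app _ (fun y => y ^ (-k l) • ξ l) x⁻¹) = _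
    have h1 : dX (fun y => y ^ (-k l) • ξ l) x⁻¹ = (-(k l * x) * x ^ (k l)) • ξ l := by
      have := HasD.smul (hasDerivAt_zpow' (-k l) hx') (hasD_const (ξ l) x⁻¹)
      rw [this.dX_eq, smul_zero, add_zero, inv_zpow', neg_sub, sub_neg_eq_add, add_comm 1,
        zpow_add₀ hx, zpow_one]
      congr 1
      push_cast; ring
    have h2 : x ^ k l ≠ 0 := zpow_ne_zero _ hx
    rw [happ, h1, map_smul, dXi_ξ, map_add, map_smul, gmap_ξ]
    fin_cases l <;>
      simp [linVF, vf, elt_linear, Fin.sum_univ_three, diagMatrix, Matrix.diagonal_apply, smul_smul,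
        add_smul] at h2 ⊢
    · field_simp
    · rw [show k 1 - k 0 = -k 0 + k 1 by ring, zpow_add₀ hx, zpow_neg, gmap_ξ]
      simp [Fin.sum_univ_three, diagMatrix, Matrix.diagonal_apply, smul_smul, mul_comm]
      field_simp
      module
    · field_simp

theorem hPrime_eq {k : Fin 3 → ℤ} (hk : k 0 = k 1) (o) {x : ℂ} (hx : x ≠ 0) :
    bracket ePrime (fPrime k) o x = linVF (fun x => -2 * x)
      (fun i l _ => if i = l then -k l + ![-1, 1, 0] l else 0) o x := by
  have e : ∀ o, fPrime k o =ᶠ[nhds x] linVF (fun x => -x ^ 2)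
      (fun i l x => (if i = l then -(k l * x) else 0) + if i = 0 ∧ l = 1 then 1 else 0) o := by
    intro o
    filter_upwards [eventually_ne_zero hx] with t ht
    rw [fPrime_eq k o ht, hk, sub_self]
    simp only [zpow_zero]
  have e' : ∀ o, ePrime o = linVF (fun _ => 1) (fun i l _ => if i = 1 ∧ l = 0 then 1 else 0) o :=
    fun o => funext (ePrime_eq o)
  have hF {F : ℂ → ℂ} {F' : ℂ} (hF : HasDerivAt F F' x) :
      HasD (fun t => elt (F t) 0 0 0) (elt F' 0 0 0) x :=
    hasD_of_coords (by simpa using hF) (by simpa using hasDerivAt_const x (0 : ℂ))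
      (by simpa using hasDerivAt_const x (0 : ℂ)) (by simpa using hasDerivAt_const x (0 : ℂ))
  have hG {F : Fin 3 → ℂ → ℂ} {F' : Fin 3 → ℂ} (hF : ∀ i, HasDerivAt (F i) (F' i) x) :
      HasD (fun t => elt 0 (fun i => F i t) 0 0) (elt 0 F' 0 0) x :=
    hasD_of_coords (by simpa using hasDerivAt_const x (0 : ℂ)) (by simpa using hF)
      (by simpa using hasDerivAt_const x (0 : ℂ)) (by simpa using hasDerivAt_const x (0 : ℂ))
  rw [bracket, app_congr _ (e o)]
  simp only [app, (e _).eq_of_nhds, e']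
  rcases o with _ | l
  · have h1 := (hF (F := fun x => -x ^ 2) (hasDerivAt_pow 2 x).neg).dX_eq
    have h2 := (hF (hasDerivAt_const x (1 : ℂ))).dX_eq
    simp only [linVF, vf, Option.elim] at h1 h2 ⊢
    rw [h1, h2]
    simp only [dXi_elt]
    refine gext ?_ (fun i => ?_) (fun i => ?_) ?_ <;> simp [cL_mul, cP_mul, cT_mul]
  · have h2 := (hG (fun i => hasDerivAt_const x (if i = 1 ∧ l = 0 then (1 : ℂ) else 0))).dX_eq
    have h1 := (hG (F := fun i x => (if i = l then -(k l * x) else 0) +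
      if i = 0 ∧ l = 1 then 1 else 0) (F' := fun i => if i = l then -k l else 0) (fun i => by
        refine HasDerivAt.add_const _ ?_
        split_ifs
        · simpa using ((hasDerivAt_id x).const_mul (k l : ℂ)).fun_neg
        · exact hasDerivAt_const _ _)).dX_eq
    simp only [linVF, vf, Option.elim] at h1 h2 ⊢
    rw [h1, h2]
    simp only [dXi_elt]
    refine gext ?_ (fun i => ?_) (fun i => ?_) ?_
    · simp [Fin.sum_univ_three]
    · fin_cases i <;> fin_cases l <;> simp [cL_mul, Fin.sum_univ_three, hk] <;> ring
    · simp [cL_mul, cP_mul, cT_mul, Fin.sum_univ_three]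
    · simp [cL_mul, cP_mul, cT_mul, Fin.sum_univ_three]

/-- The action of the three generators of `𝔰'` on the coordinates of a vector field of degree two:
the parts which preserve the slot. -/
def InvE (k : Fin 3 → ℤ) (p q : Fin 3 → ℂ → ℂ) : Prop :=
  ∀ l, PairCob (wt k l) (k l) (fun x => deriv (p l) x - if l = 0 then p 1 x else 0)
    (fun x => deriv (q l) x - if l = 0 then q 1 x else 0)

def InvF (k : Fin 3 → ℤ) (p q : Fin 3 → ℂ → ℂ) : Prop :=
  ∀ l, PairCob (wt k l) (k l)
    (fun x => -x ^ 2 * deriv (p l) x + (2 - wt k l) * x * p l x - if l = 1 then p 0 x else 0)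
    (fun x => -x ^ 2 * deriv (q l) x - wt k l * x * q l x + k l * p l x -
      if l = 1 then q 0 x else 0)

def InvH (k : Fin 3 → ℤ) (p q : Fin 3 → ℂ → ℂ) : Prop :=
  ∀ l, PairCob (wt k l) (k l)
    (fun x => -2 * x * deriv (p l) x + (2 - wt k l + ![1, -1, 0] l) * p l x)
    (fun x => -2 * x * deriv (q l) x + (-wt k l + ![1, -1, 0] l) * q l x)

section
variable {k : Fin 3 → ℤ} {v : EvenVF}

theorem isT2_bracket_linVF {u : EvenVF} (hv : IsT2 v {0}ᶜ) {c : ℂ → ℂ}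
    {B : Fin 3 → Fin 3 → ℂ → ℂ} (hc : Differentiable ℂ c)
    (hB : ∀ i l, Differentiable ℂ (B i l))
    (hu : ∀ o, ∀ z ≠ 0, u o z = linVF c B o z) : IsT2 (bracket u v) {0}ᶜ := by
  have hd (f : ℂ → ℂ) (hf : ∀ z ∈ ({0}ᶜ : Set ℂ), DifferentiableAt ℂ f z) :
      ∀ z ∈ ({0}ᶜ : Set ℂ), DifferentiableAt ℂ (deriv f) z := fun z hz =>
    ((DifferentiableOn.deriv (fun w hw => (hf w hw).differentiableWithinAt)
      isOpen_punctured) z hz).differentiableAt (isOpen_punctured.mem_nhds hz)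
  refine IsT2.congr isOpen_punctured (isT2_vec ?_ ?_) fun o z hz =>
    bracket_linVF isOpen_punctured hv (fun z _ => hc z) (fun i l z _ => hB i l z) hu hz o
  · intro j z hz
    have h1 := hd (pC v j) (fun w hw => hv.diff_p hw j) z hz
    have h2 := hd c (fun w _ => hc w) z hz
    have h3 := fun i => hv.diff_p hz i
    have h4 := fun i l => hB i l z
    have h5 := hc z
    fun_prop
  · intro j z hz
    have h1 := hd (qC v j) (fun w hw => hv.diff_q hw j) z hz
    have h2 := fun i l => hd (B i l) (fun w _ => hB i l w) z hz
    have h3 := fun i => hv.diff_p hz i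
    have h6 := fun i => hv.diff_q hz i
    have h4 := fun i l => hB i l z
    have h5 := hc z
    fun_prop

theorem isCoboundary_bracket_iff {u : EvenVF} (hv : IsT2 v {0}ᶜ) {c : ℂ → ℂ}
    {B : Fin 3 → Fin 3 → ℂ → ℂ} (hc : Differentiable ℂ c)
    (hB : ∀ i l, Differentiable ℂ (B i l))
    (hu : ∀ o, ∀ z ≠ 0, u o z = linVF c B o z) :
    IsCoboundary k (bracket u v) ↔ ∀ j, PairCob (wt k j) (k j)
      (fun z => c z * deriv (pC v j) z - deriv c z * pC v j z +
        (B 0 0 z + B 1 1 z + B 2 2 z) * pC v j z - ∑ i, B i j z * pC v i z)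
      (fun z => c z * deriv (qC v j) z + (B 0 0 z + B 1 1 z + B 2 2 z) * qC v j z -
        ∑ i, (deriv (B i j) z * pC v i z + B i j z * qC v i z)) := by
  rw [isCoboundary_iff (isT2_bracket_linVF hv hc hB hu)]
  have h := fun z (hz : z ≠ 0) o => bracket_linVF (z := z) isOpen_punctured hv (fun z _ => hc z)
    (fun i l z _ => hB i l z) hu hz o
  have hp := fun l x hx => (congrArg (cP l) (h x hx none)).trans (pC_vec _ _ _ _)
  have hq := fun l x hx => (congrArg cT (h x hx (some l))).trans (qC_vec _ _ _ _)
  exact forall_congr' fun l => ⟨fun H => H.congr (fun x hx => (hp l x hx).symm)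
    fun x hx => (hq l x hx).symm, fun H => H.congr (hp l) (hq l)⟩

theorem pairCob_congr_iff {m κ : ℤ} {p q p' q' : ℂ → ℂ}
    (hp : ∀ x, x ≠ 0 → p' x = p x) (hq : ∀ x, x ≠ 0 → q' x = q x) :
    PairCob m κ p q ↔ PairCob m κ p' q' :=
  ⟨fun h => h.congr hp hq, fun h => h.congr (fun x hx => (hp x hx).symm)
    fun x hx => (hq x hx).symm⟩

theorem isCoboundary_bracket_ePrime (hv : IsT2 v {0}ᶜ) :
    IsCoboundary k (bracket ePrime v) ↔ InvE k (pC v) (qC v) := by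
  rw [isCoboundary_bracket_iff hv (by fun_prop) (by fun_prop) fun o z _ => ePrime_eq o z]
  refine forall_congr' fun l => pairCob_congr_iff (fun x _ => ?_) fun x _ => ?_
  · fin_cases l <;> simp [Fin.sum_univ_three]
  · fin_cases l <;> simp [Fin.sum_univ_three]

theorem isCoboundary_bracket_fPrime (hk : k 0 = k 1) (hv : IsT2 v {0}ᶜ) :
    IsCoboundary k (bracket (fPrime k) v) ↔ InvF k (pC v) (qC v) := by
  rw [isCoboundary_bracket_iff hv (c := fun x => -x ^ 2)
    (B := fun i l x => (if i = l then -(k l * x) else 0) + if i = 0 ∧ l = 1 then 1 else 0)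
    (by fun_prop) (fun i l => by split_ifs <;> fun_prop) fun o z hz => by
      rw [fPrime_eq k o hz, hk, sub_self]
      simp only [zpow_zero]]
  have hd (c : ℂ) : deriv (fun x : ℂ => c * x) = fun _ => c := by
    funext x; simp
  refine forall_congr' fun l => pairCob_congr_iff (fun x _ => ?_) fun x _ => ?_
  · fin_cases l <;> simp [Fin.sum_univ_three, wt, hk] <;> ring
  · fin_cases l <;> simp [Fin.sum_univ_three, wt, hk] <;> ring

theorem isCoboundary_bracket_hPrime (hk : k 0 = k 1) (hv : IsT2 v {0}ᶜ) :
    IsCoboundary k (bracket (bracket ePrime (fPrime k)) v) ↔ InvH k (pC v) (qC v) := by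
  rw [isCoboundary_bracket_iff hv (by fun_prop) (fun i l => by split_ifs <;> fun_prop)
    fun o z hz => hPrime_eq hk o hz]
  refine forall_congr' fun l => pairCob_congr_iff (fun x _ => ?_) fun x _ => ?_
  · fin_cases l <;> simp [Fin.sum_univ_three, wt, hk] <;> ring
  · fin_cases l <;> simp [Fin.sum_univ_three, wt, hk] <;> ring

theorem diffAt_linVF {u : EvenVF} {c : ℂ → ℂ}
    {B : Fin 3 → Fin 3 → ℂ → ℂ} (hc : Differentiable ℂ c)
    (hB : ∀ i l, Differentiable ℂ (B i l)) (hu : ∀ o, ∀ z ≠ 0, u o z = linVF c B o z) (o) {x : ℂ}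
    (hx : x ≠ 0) : DiffAt (u o) x := by
  refine DiffAt.congr (F := linVF c B o) ?_ (by
    filter_upwards [eventually_ne_zero hx] with t ht using hu o t ht)
  rcases o with _ | l
  · simp [diffAt_iff, linVF, vf, hc x]
  · simpa [diffAt_iff, linVF, vf] using fun i => hB i l x

theorem isSPrimeInvariant_iff (hk : k 0 = k 1) (hv : IsT2 v {0}ᶜ) :
    IsSPrimeInvariant k v ↔
      InvE k (pC v) (qC v) ∧ InvF k (pC v) (qC v) ∧ InvH k (pC v) (qC v) := by
  rw [← isCoboundary_bracket_ePrime hv, ← isCoboundary_bracket_fPrime hk hv,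
    ← isCoboundary_bracket_hPrime hk hv]
  constructor
  · intro h
    exact ⟨h _ (Submodule.subset_span (by simp)), h _ (Submodule.subset_span (by simp)),
      h _ (Submodule.subset_span (by simp))⟩
  · rintro ⟨he, hf, hh⟩ u hu
    -- The bracket is linear in `u` only for differentiable coefficients, because `v` is applied to
    -- them. Differentiability is therefore carried through the span induction.
    suffices (∀ o, ∀ x ≠ 0, DiffAt (u o) x) ∧ IsCoboundary k (bracket u v) from this.2
    rw [sPrime] at hu
    induction hu using Submodule.span_induction with
    | mem u hu =>
      rcases hu with rfl | rfl | rfl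
      · exact ⟨fun o x hx => diffAt_linVF (c := fun _ => 1)
          (B := fun i l _ => if i = 1 ∧ l = 0 then 1 else 0) (by fun_prop) (by fun_prop)
          (fun o z _ => ePrime_eq o z) o hx, he⟩
      · refine ⟨fun o x hx => diffAt_linVF (c := fun x => -x ^ 2)
          (B := fun i l x => (if i = l then -(k l * x) else 0) + if i = 0 ∧ l = 1 then 1 else 0)
          (by fun_prop) (fun i l => by split_ifs <;> fun_prop) (fun o z hz => ?_) o hx, hf⟩
        rw [fPrime_eq k o hz, hk, sub_self]
        simp only [zpow_zero]
      · exact ⟨fun o x hx => diffAt_linVF (c := fun x => -2 * x)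
          (B := fun i l _ => if i = l then -k l + ![-1, 1, 0] l else 0) (by fun_prop)
          (fun i l => by split_ifs <;> fun_prop) (fun o z hz => hPrime_eq hk o hz) o hx, hh⟩
    | zero =>
      refine ⟨fun o x _ => (hasD_const 0 x).diffAt, (isCoboundary_zero k).congr fun o x hx => ?_⟩
      have h0 : dX (0 : ℂ → Grassmann) x = 0 := (hasD_const 0 x).dX_eq
      simp [bracket, app, h0]
    | add u u' _ _ h h' =>
      obtain ⟨hd, h⟩ := h
      obtain ⟨hd', h'⟩ := h'
      refine ⟨fun o x hx => (hd o x hx).add (hd' o x hx), (h.add h').congr fun o x hx => ?_⟩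
      simp only [bracket, app_add_left, Pi.add_apply, app_add_right v (hd o x hx) (hd' o x hx)]
      abel
    | smul c u _ h =>
      obtain ⟨hd, h⟩ := h
      refine ⟨fun o x hx => (hasD_const_smul c (hd o x hx)).diffAt,
        (h.smul c).congr fun o x hx => ?_⟩
      change app (c • u) (v o) x - app v (c • u o) x = c • (app u (v o) x - app v (u o) x)
      rw [app_smul_left, app_smul_right v c (hd o x hx), smul_sub]
end

end SuperCP1
end

noncomputable section

namespace SuperCP1

/-! ### Laurent coefficients of functions on the punctured plane -/

section Laurent

open Complex Metric Filter Topology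

theorem sphere_one_subset : sphere (0 : ℂ) 1 ⊆ {0}ᶜ := by
  intro z hz h
  rw [Set.mem_singleton_iff.1 h] at hz
  simp at hz

/-- The coefficient of `x ^ n` in the Laurent expansion of `f`. -/
def lc (n : ℤ) (f : ℂ → ℂ) : ℂ := (2 * Real.pi * I : ℂ)⁻¹ * ∮ z in C(0, 1), z ^ (-n - 1) * f z

variable {f g : ℂ → ℂ}

theorem circleIntegrable_zpow_mul (n : ℤ) (hf : DifferentiableOn ℂ f {0}ᶜ) :
    CircleIntegrable (fun z => z ^ n * f z) 0 1 := by
  refine ContinuousOn.circleIntegrable zero_le_one ?_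
  refine ContinuousOn.mul (fun z hz => ?_) (hf.continuousOn.mono sphere_one_subset)
  exact (continuousAt_zpow₀ z n (Or.inl (sphere_one_subset hz))).continuousWithinAt

theorem lc_congr (n : ℤ) (h : ∀ z ≠ 0, f z = g z) : lc n f = lc n g := by
  rw [lc, lc]
  congr 1
  refine circleIntegral.integral_congr zero_le_one fun z hz => ?_
  simp only [h z (sphere_one_subset hz)]

theorem lc_add (n : ℤ) (hf : DifferentiableOn ℂ f {0}ᶜ) (hg : DifferentiableOn ℂ g {0}ᶜ) :
    lc n (fun z => f z + g z) = lc n f + lc n g := by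
  simp only [lc, mul_add]
  rw [circleIntegral.integral_add (circleIntegrable_zpow_mul _ hf)
    (circleIntegrable_zpow_mul _ hg), mul_add]

theorem lc_const_mul (n : ℤ) (c : ℂ) (f : ℂ → ℂ) : lc n (fun z => c * f z) = c * lc n f := by
  simp only [lc, mul_left_comm _ c]
  rw [circleIntegral.integral_const_mul]
  ring

theorem lc_sub (n : ℤ) (hf : DifferentiableOn ℂ f {0}ᶜ) (hg : DifferentiableOn ℂ g {0}ᶜ) :
    lc n (fun z => f z - g z) = lc n f - lc n g := by
  simp only [lc, mul_sub]
  rw [circleIntegral.integral_sub (circleIntegrable_zpow_mul _ hf)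
    (circleIntegrable_zpow_mul _ hg), mul_sub]

theorem lc_zpow_mul (n j : ℤ) (f : ℂ → ℂ) : lc n (fun z => z ^ j * f z) = lc (n - j) f := by
  rw [lc, lc]
  congr 1
  refine circleIntegral.integral_congr zero_le_one fun z hz => ?_
  simp only [← mul_assoc, ← zpow_add₀ (sphere_one_subset hz : z ≠ 0)]
  congr 2
  ring

/-- Integration by parts: the derivative of `z ^ (-n - 1) * f z` has zero integral around the
circle. -/
theorem lc_deriv (n : ℤ) (hf : DifferentiableOn ℂ f {0}ᶜ) :
    lc n (deriv f) = (n + 1) * lc (n + 1) f := by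
  have h0 : (∮ z in C(0, 1), ((-n - 1 : ℤ) * z ^ (-n - 1 - 1) * f z + z ^ (-n - 1) * deriv f z)) =
      0 := by
    refine circleIntegral.integral_eq_zero_of_hasDerivWithinAt
      (f := fun z => z ^ (-n - 1) * f z) zero_le_one fun z hz => ?_
    have hz' := sphere_one_subset hz
    exact ((hasDerivAt_zpow' _ hz').mul ((hf z hz').differentiableAt
      (isOpen_punctured.mem_nhds hz')).hasDerivAt).hasDerivWithinAt
  have hd := hf.deriv isOpen_punctured
  rw [circleIntegral.integral_add (by
    simp only [mul_assoc]
    exact (circleIntegrable_zpow_mul _ hf).const_smul (a := ((-n - 1 : ℤ) : ℂ)))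
      (circleIntegrable_zpow_mul _ hd)] at h0
  simp only [mul_assoc] at h0
  rw [circleIntegral.integral_const_mul] at h0
  rw [lc, lc, eq_neg_of_add_eq_zero_right h0, show -(n + 1) - 1 = -n - 1 - 1 by ring]
  push_cast
  ring

theorem lc_of_entire {n : ℤ} (hn : n < 0) (hf : Differentiable ℂ f) : lc n f = 0 := by
  rw [lc, circleIntegral_eq_zero_of_differentiable_on_off_countable zero_le_one Set.countable_empty,
    mul_zero]
  · obtain ⟨m, hm⟩ : ∃ m : ℕ, -n - 1 = m := ⟨(-n - 1).toNat, by omega⟩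
    simp only [hm, zpow_natCast]
    have := hf.continuous
    fun_prop
  · intro z _
    obtain ⟨m, hm⟩ : ∃ m : ℕ, -n - 1 = m := ⟨(-n - 1).toNat, by omega⟩
    simp only [hm, zpow_natCast]
    fun_prop

/-- The reflection `θ ↦ 2π - θ` of the parameter inverts the points of the unit circle. No
regularity of `f` is needed, since this is only a substitution in the integral. -/
theorem lc_comp_inv (n : ℤ) (f : ℂ → ℂ) : lc n (fun z => f z⁻¹) = lc (-n) f := by
  rw [lc, lc]
  congr 1
  rw [circleIntegral, circleIntegral]
  have hm (θ : ℝ) : circleMap 0 1 θ ≠ 0 := circleMap_ne_center one_ne_zero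
  have hc (θ : ℝ) : circleMap 0 1 (2 * Real.pi - θ) = (circleMap 0 1 θ)⁻¹ := by
    simp only [circleMap, zero_add, ofReal_one, one_mul, ← Complex.exp_neg]
    rw [Complex.exp_eq_exp_iff_exists_int]
    exact ⟨1, by push_cast; ring⟩
  have := intervalIntegral.integral_comp_sub_left (a := 0) (b := 2 * Real.pi) (fun θ =>
    deriv (circleMap 0 1) θ • (circleMap 0 1 θ ^ (-(-n) - 1) * f (circleMap 0 1 θ))) (2 * Real.pi)
  rw [sub_self, sub_zero] at this
  rw [← this]
  refine intervalIntegral.integral_congr fun θ _ => ?_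
  simp only [deriv_circleMap, hc, smul_eq_mul]
  rw [inv_zpow', neg_sub, neg_neg, show (1 : ℤ) - n = -n - 1 + 1 + 1 by ring,
    zpow_add₀ (hm θ), zpow_add₀ (hm θ), zpow_one]
  field_simp [hm θ]

theorem differentiableOn_comp_inv (hf : Differentiable ℂ f) :
    DifferentiableOn ℂ (fun z => f z⁻¹) {0}ᶜ := fun z hz =>
  ((hf z⁻¹).comp z (differentiableAt_inv hz)).differentiableWithinAt

theorem differentiableOn_zpow_mul (n : ℤ) (hf : DifferentiableOn ℂ f {0}ᶜ) :
    DifferentiableOn ℂ (fun z => z ^ n * f z) {0}ᶜ := fun z hz =>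
  (hasDerivAt_zpow' n hz).differentiableAt.differentiableWithinAt.mul (hf z hz)

theorem lc_zpow_mul_comp_inv {n j : ℤ} (hn : j < n) (hf : Differentiable ℂ f) :
    lc n (fun z => z ^ j * f z⁻¹) = 0 := by
  rw [lc_zpow_mul, lc_comp_inv, lc_of_entire (by omega) hf]

theorem lc_zero_of_entire (hf : Differentiable ℂ f) : lc 0 f = f 0 := by
  have := hf.diffContOnCl.circleIntegral_sub_inv_smul (c := 0) (w := 0) (R := 1) (by simp)
  simp only [sub_zero, smul_eq_mul] at this
  rw [lc]
  simp only [neg_zero, zero_sub, zpow_neg_one]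
  rw [this, ← mul_assoc, inv_mul_cancel₀ Complex.two_pi_I_ne_zero, one_mul]

theorem lc_zpow_mul_comp_inv_self (j : ℤ) (hf : Differentiable ℂ f) :
    lc j (fun z => z ^ j * f z⁻¹) = f 0 := by
  rw [lc_zpow_mul, lc_comp_inv, sub_self, neg_zero, lc_zero_of_entire hf]

theorem circleIntegral_cauchy_eq (hf : DifferentiableOn ℂ f {0}ᶜ) {z : ℂ} {r R : ℝ} (hr : ‖z‖ < r)
    (hrR : r ≤ R) : (∮ w in C(0, R), (w - z)⁻¹ * f w) = ∮ w in C(0, r), (w - z)⁻¹ * f w := by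
  have h0 : 0 < r := (norm_nonneg z).trans_lt hr
  have hd : ∀ w, r ≤ ‖w‖ → DifferentiableAt ℂ (fun w => (w - z)⁻¹ * f w) w := fun w hw => by
    have hwz : w - z ≠ 0 := sub_ne_zero.2 fun h => by rw [h] at hw; exact absurd hr hw.not_gt
    have hw0 : w ≠ 0 := norm_pos_iff.1 (h0.trans_le hw)
    have := (hf w hw0).differentiableAt (isOpen_punctured.mem_nhds hw0)
    fun_prop (disch := assumption)
  refine circleIntegral_eq_of_differentiable_on_annulus_off_countable h0 hrR Set.countable_empty
    (fun w hw => (hd w ?_).continuousAt.continuousWithinAt) fun w hw => hd w ?_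
  · simpa using hw.2
  · have := hw.1.2
    simp only [mem_closedBall, dist_zero_right, not_le] at this
    exact this.le

/-- The divided difference of `f` at `z` is holomorphic on the punctured plane, so its integrals
over the two circles agree. The kernel `(w - z)⁻¹` itself integrates to `2πi` over the outer circle
and to zero over the inner one. -/
theorem cauchy_annulus (hf : DifferentiableOn ℂ f {0}ᶜ) {z : ℂ} {r R : ℝ} (h0 : 0 < r)
    (hr : r < ‖z‖) (hR : ‖z‖ < R) : (∮ w in C(0, R), (w - z)⁻¹ * f w) -
      (∮ w in C(0, r), (w - z)⁻¹ * f w) = 2 * Real.pi * I * f z := by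
  have hz : z ≠ 0 := norm_pos_iff.1 (h0.trans hr)
  have hds : DifferentiableOn ℂ (dslope f z) {0}ᶜ :=
    (differentiableOn_dslope (isOpen_punctured.mem_nhds hz)).2 hf
  have h1 : (∮ w in C(0, R), dslope f z w) = ∮ w in C(0, r), dslope f z w := by
    refine circleIntegral_eq_of_differentiable_on_annulus_off_countable h0 (hr.trans hR).le
      Set.countable_empty (hds.continuousOn.mono fun w hw => ?_) fun w hw => ?_
    · rintro rfl
      exact hw.2 (by simpa using h0)
    · have hw0 : w ≠ 0 := by
        rintro rfl
        exact hw.1.2 (by simpa using h0.le)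
      exact (hds w hw0).differentiableAt (isOpen_punctured.mem_nhds hw0)
  have hfc : ∀ ρ : ℝ, 0 < ρ → ContinuousOn f (sphere 0 ρ) := fun ρ hρ =>
    hf.continuousOn.mono fun w hw => by
      rintro rfl
      simp at hw
      exact hρ.ne hw
  have h2 : ∀ ρ : ℝ, 0 < ρ → ρ ≠ ‖z‖ → (∮ w in C(0, ρ), dslope f z w) =
      (∮ w in C(0, ρ), (w - z)⁻¹ * f w) - f z * ∮ w in C(0, ρ), (w - z)⁻¹ := by
    intro ρ hρ hne
    have hwz : ∀ w ∈ sphere (0 : ℂ) ρ, w ≠ z := by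
      rintro w hw rfl
      simp at hw
      exact hne hw.symm
    have hi : ContinuousOn (fun w => (w - z)⁻¹) (sphere 0 ρ) := fun w hw =>
      ((continuousAt_id.sub continuousAt_const).fun_inv₀ (sub_ne_zero.2 (hwz w hw))).continuousWithinAt
    rw [← circleIntegral.integral_const_mul, ← circleIntegral.integral_sub
      (f := fun w => (w - z)⁻¹ * f w) (g := fun w => f z * (w - z)⁻¹)
      ((hi.mul (hfc ρ hρ)).circleIntegrable hρ.le)
      ((continuousOn_const.mul hi).circleIntegrable hρ.le)]
    refine circleIntegral.integral_congr hρ.le fun w hw => ?_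
    rw [dslope_of_ne _ (hwz w hw), slope, vsub_eq_sub, smul_eq_mul]
    ring
  have h3 : (∮ w in C(0, r), (w - z)⁻¹) = 0 := by
    refine circleIntegral_eq_zero_of_differentiable_on_off_countable h0.le Set.countable_empty
      (fun w hw => ?_) fun w hw => ?_
    · have hwz : w - z ≠ 0 := sub_ne_zero.2 (by rintro rfl; simp at hw; linarith)
      exact ((continuousAt_id.sub continuousAt_const).fun_inv₀ hwz).continuousWithinAt
    · have hwz : w - z ≠ 0 := sub_ne_zero.2 (by rintro rfl; simp at hw; linarith)
      fun_prop (disch := assumption)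
  have hR0 := h0.trans (hr.trans hR)
  rw [h2 R hR0 hR.ne', h2 r h0 hr.ne, h3,
    circleIntegral.integral_sub_inv_of_mem_ball (by simpa using hR)] at h1
  rw [mul_zero, sub_zero, sub_eq_iff_eq_add] at h1
  rw [h1]
  ring

/-- A holomorphic function on the punctured plane is the sum of an entire function of `z` and of an
entire function of `z⁻¹`. -/
theorem exists_laurent (hf : DifferentiableOn ℂ f {0}ᶜ) : ∃ f₀ f₁ : ℂ → ℂ, Differentiable ℂ f₀ ∧
    Differentiable ℂ f₁ ∧ ∀ z ≠ 0, f z = f₀ z + f₁ z⁻¹ := by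
  set J : ℝ → ℂ → ℂ := fun R z => (2 * Real.pi * I : ℂ)⁻¹ * ∮ w in C(0, R), (w - z)⁻¹ * f w with hJ
  -- Any circle enclosing `z` gives the same value, by `circleIntegral_cauchy_eq`. Near a given
  -- point one fixed radius therefore works, and `f₀` is a Cauchy integral there.
  set f₀ : ℂ → ℂ := fun z => J (‖z‖ + 1) z with hf₀
  have hJe : ∀ {z R}, ‖z‖ < R → f₀ z = J R z := by
    intro z R h
    rcases le_total (‖z‖ + 1) R with h' | h'
    · rw [hf₀, hJ]
      simp only
      rw [circleIntegral_cauchy_eq hf (lt_add_one ‖z‖) h']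
    · rw [hf₀, hJ]
      simp only
      rw [circleIntegral_cauchy_eq hf h h']
  have hd₀ : Differentiable ℂ f₀ := by
    intro z
    have hR : (0 : NNReal) < ‖z‖₊ + 1 := by positivity
    have hci : CircleIntegrable f 0 (‖z‖₊ + 1 : NNReal) := by
      refine ContinuousOn.circleIntegrable hR.le (hf.continuousOn.mono fun w hw => ?_)
      rintro rfl
      have h2 : (0 : ℝ) < ((‖z‖₊ + 1 : NNReal) : ℝ) := hR
      simp only [mem_sphere, dist_self] at hw
      exact h2.ne hw
    have h := (hasFPowerSeriesOn_cauchy_integral hci hR).analyticOnNhd z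
      (by
        simp only [Metric.mem_eball, edist_zero_right, enorm_eq_nnnorm]
        exact_mod_cast lt_add_one ‖z‖₊)
    refine h.differentiableAt.congr_of_eventuallyEq ?_
    have : ∀ᶠ t in 𝓝 z, ‖t‖ < ‖z‖ + 1 := continuous_norm.continuousAt.eventually
      (gt_mem_nhds (lt_add_one ‖z‖))
    filter_upwards [this] with t ht
    rw [hJe ht]
    simp [hJ]
  -- Outside the unit circle the remainder is an integral over that fixed circle; its kernel decays
  -- at infinity. This yields the removable singularity at `y = 0`.
  have hg : ∀ z, 1 < ‖z‖ → f z - f₀ z = -J 1 z := by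
    intro z hz
    have := cauchy_annulus hf one_pos hz (lt_add_one ‖z‖)
    have h2 : f z = J (‖z‖ + 1) z - J 1 z := by
      rw [hJ]
      simp only
      rw [← mul_sub, this, ← mul_assoc, inv_mul_cancel₀ Complex.two_pi_I_ne_zero, one_mul]
    rw [h2]
    ring
  refine ⟨f₀, fun y => if y = 0 then 0 else f y⁻¹ - f₀ y⁻¹, hd₀, ?_, fun z hz => ?_⟩
  · have hne : ∀ y : ℂ, y ≠ 0 →
        DifferentiableAt ℂ (fun y : ℂ => if y = 0 then 0 else f y⁻¹ - f₀ y⁻¹) y := by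
      intro y hy
      have h1 : DifferentiableAt ℂ (fun y : ℂ => f y⁻¹ - f₀ y⁻¹) y := by
        have h2 : DifferentiableAt ℂ f y⁻¹ :=
          (hf y⁻¹ (inv_ne_zero hy)).differentiableAt (isOpen_punctured.mem_nhds (inv_ne_zero hy))
        exact (h2.comp y (differentiableAt_inv hy)).sub
          ((hd₀ y⁻¹).comp y (differentiableAt_inv hy))
      refine h1.congr_of_eventuallyEq ?_
      filter_upwards [eventually_ne_zero hy] with t ht
      simp [ht]
    intro y
    by_cases hy : y = 0
    · subst hy
      refine (analyticAt_of_differentiable_on_punctured_nhds_of_continuousAt ?_ ?_).differentiableAt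
      · filter_upwards [self_mem_nhdsWithin] with t ht using hne t ht
      · obtain ⟨M, hM⟩ := (isCompact_sphere (0 : ℂ) 1).exists_bound_of_continuousOn
          (hf.continuousOn.mono sphere_one_subset)
        rw [continuousAt_iff_punctured_nhds, if_pos rfl]
        have hb : Tendsto (fun y : ℂ => (‖y‖⁻¹ - 1)⁻¹ * M) (𝓝[≠] 0) (𝓝 0) := by
          have h1 : Tendsto (fun y : ℂ => ‖y‖⁻¹) (𝓝[≠] 0) atTop := by
            have : Tendsto (fun y : ℂ => ‖y⁻¹‖) (𝓝[≠] 0) atTop :=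
              tendsto_norm_cobounded_atTop.comp Filter.tendsto_inv₀_nhdsNE_zero
            simpa using this
          have := (tendsto_inv_atTop_zero.comp (tendsto_atTop_add_const_right _ (-1) h1)).mul_const M
          simpa [sub_eq_add_neg] using this
        refine squeeze_zero_norm' ?_ hb
        have hlt : ∀ᶠ y : ℂ in 𝓝[≠] 0, ‖y‖ < 1 :=
          nhdsWithin_le_nhds (continuous_norm.continuousAt.eventually (gt_mem_nhds (by simp)))
        filter_upwards [self_mem_nhdsWithin, hlt] with y hy hy1
        have hy0 : y ≠ 0 := hy
        have hy1' : 1 < ‖y⁻¹‖ := by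
          rw [norm_inv]
          exact (one_lt_inv₀ (norm_pos_iff.2 hy0)).2 hy1
        rw [if_neg hy0, hg _ hy1', norm_neg, hJ]
        have := circleIntegral.norm_two_pi_i_inv_smul_integral_le_of_norm_le_const (c := 0) (R := 1)
          (f := fun w => (w - y⁻¹)⁻¹ * f w) (C := (‖y‖⁻¹ - 1)⁻¹ * M) zero_le_one fun w hw => by
            rw [norm_mul, norm_inv]
            have h1 : ‖y‖⁻¹ - 1 ≤ ‖w - y⁻¹‖ := by
              have h2 := norm_sub_norm_le y⁻¹ w
              rw [norm_sub_rev, norm_inv] at h2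
              have h3 : ‖w‖ = 1 := by simpa using hw
              rw [h3] at h2
              exact h2
            have h4 : 0 < ‖y‖⁻¹ - 1 := by
              rw [norm_inv] at hy1'
              linarith
            exact mul_le_mul (inv_anti₀ h4 h1) (hM w hw) (norm_nonneg _) (inv_nonneg.2 h4.le)
        simpa using this
    · exact hne y hy
  · simp [hz]

/-- Division by the variable. -/
theorem exists_eq_add_mul (hf : Differentiable ℂ f) :
    ∃ g : ℂ → ℂ, Differentiable ℂ g ∧ ∀ z, f z = f 0 + z * g z := by
  refine ⟨dslope f 0, fun z => ?_, fun z => ?_⟩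
  · exact ((differentiableOn_dslope (s := Set.univ) Filter.univ_mem).2 hf.differentiableOn
      z (Set.mem_univ z)).differentiableAt Filter.univ_mem
  · have := sub_smul_dslope f 0 z
    simp only [sub_zero, smul_eq_mul] at this
    rw [this]
    ring

/-- Functions without Laurent coefficients in the gap between `-N` and `0`. -/
theorem exists_laurent_gap (hf : DifferentiableOn ℂ f {0}ᶜ) (N : ℤ)
    (h : ∀ n : ℤ, -N < n → n < 0 → lc n f = 0) : ∃ f₀ f₁ : ℂ → ℂ, Differentiable ℂ f₀ ∧
      Differentiable ℂ f₁ ∧ ∀ z ≠ 0, f z = f₀ z + z ^ (-N) * f₁ z⁻¹ := by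
  rcases le_or_gt N 0 with hN | hN
  · obtain ⟨f₀, f₁, h0, h1, h⟩ := exists_laurent hf
    -- For `N ≤ 0` there is no gap: multiplying `f₁` by `y ^ m` cancels the factor `z ^ m`.
    obtain ⟨m, hm⟩ : ∃ m : ℕ, -N = m := ⟨(-N).toNat, by omega⟩
    refine ⟨f₀, fun y => y ^ m * f₁ y, h0, by fun_prop, fun z hz => ?_⟩
    rw [h z hz, hm, zpow_natCast, ← mul_assoc, ← mul_pow, mul_inv_cancel₀ hz, one_pow, one_mul]
  · obtain ⟨m, rfl⟩ : ∃ m : ℕ, N = m + 1 := ⟨(N - 1).toNat, by omega⟩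
    clear hN
    induction m with
    | zero =>
      obtain ⟨f₀, f₁, h0, h1, h⟩ := exists_laurent hf
      obtain ⟨g, hg, hfg⟩ := exists_eq_add_mul h1
      refine ⟨fun z => f₀ z + f₁ 0, g, by fun_prop, hg, fun z hz => ?_⟩
      rw [h z hz, hfg]
      simp
      ring
    | succ m ih =>
      obtain ⟨f₀, f₁, h0, h1, h'⟩ := ih fun n hn hn' => h n (by push_cast; omega) hn'
      -- The constant term of `f₁` is the next Laurent coefficient. It lies in the enlarged gap, so
      -- it vanishes and one more factor of the variable splits off.
      have hlc : lc (-(m + 1)) f = f₁ 0 := by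
        rw [lc_congr _ h', lc_add _ h0.differentiableOn
          (differentiableOn_zpow_mul _ (differentiableOn_comp_inv h1)),
          lc_of_entire (by omega) h0, zero_add, lc_zpow_mul_comp_inv_self _ h1]
      rw [h _ (by push_cast; omega) (by omega)] at hlc
      obtain ⟨g, hg, hfg⟩ := exists_eq_add_mul h1
      refine ⟨f₀, g, h0, hg, fun z hz => ?_⟩
      rw [h' z hz, hfg, ← hlc, zero_add, ← mul_assoc, ← zpow_neg_one, ← zpow_add₀ hz]
      congr 3

end Laurent

end SuperCP1
end

noncomputable section

namespace SuperCP1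

/-! ### Coboundaries in terms of Laurent coefficients -/

section
variable {m κ : ℤ} {p q : ℂ → ℂ}

/-- The first hypothesis solves the equation for `p`. What is left for `q` is the same problem for
`q - κ x ^ (1 - m) a₁(x⁻¹)`, whose gap also contains the exponent `1 - m`, where the correction
contributes `κ a₁(0)`. For `3 ≤ m` the number `a₁(0)` is the coefficient of `x ^ (2 - m)` in `p`.
For `m = 2` it can be chosen freely, which is useless only if `κ = 0`. For `m < 2` there is no gap.
-/
theorem pairCob_of_lc (hp : DifferentiableOn ℂ p {0}ᶜ) (hq : DifferentiableOn ℂ q {0}ᶜ)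
    (h1 : ∀ n : ℤ, 2 - m < n → n < 0 → lc n p = 0) (h2 : ∀ n : ℤ, 1 - m < n → n < 0 → lc n q = 0)
    (h3 : 3 ≤ m → lc (1 - m) q = κ * lc (2 - m) p) (h4 : m = 2 → κ = 0 → lc (-1) q = 0) :
    PairCob m κ p q := by
  obtain ⟨a₀, a₁, ha₀, ha₁, hpa⟩ := exists_laurent_gap hp (m - 2)
    fun n hn hn' => h1 n (by omega) hn'
  rw [neg_sub] at hpa
  have key : ∀ a₀ a₁ : ℂ → ℂ, Differentiable ℂ a₀ → Differentiable ℂ a₁ →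
      (∀ z ≠ 0, p z = a₀ z + z ^ (2 - m) * a₁ z⁻¹) →
      (2 ≤ m → lc (1 - m) q = κ * a₁ 0) → PairCob m κ p q := by
    intro a₀ a₁ ha₀ ha₁ hpa h5
    have hd := (differentiableOn_zpow_mul (1 - m) (differentiableOn_comp_inv ha₁))
    obtain ⟨b₀, b₁, hb₀, hb₁, hqb⟩ := exists_laurent_gap
      (hq.sub (hd.const_mul (κ : ℂ))) m fun n hn hn' => by
        have h6 := lc_sub n hq (hd.const_mul (κ : ℂ))
        rw [lc_const_mul] at h6
        refine h6.trans ?_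
        rcases (show 1 - m ≤ n by omega).eq_or_lt with h | h
        · rw [← h, lc_zpow_mul_comp_inv_self _ ha₁, h5 (by omega), sub_self]
        · rw [h2 n h hn', lc_zpow_mul_comp_inv h ha₁, mul_zero, sub_zero]
    refine ⟨a₀, b₀, a₁, b₁, ha₀, hb₀, ha₁, hb₁, fun x hx => ⟨hpa x hx, ?_⟩⟩
    rw [← hqb x hx]
    simp only [Pi.sub_apply]
    ring
  rcases lt_trichotomy m 2 with hm | hm | hm
  · exact key a₀ a₁ ha₀ ha₁ hpa fun h => by omega
  · subst hm
    by_cases hκ : κ = 0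
    · exact key a₀ a₁ ha₀ ha₁ hpa fun _ => by simp [h4 rfl hκ, hκ]
    · have hκ' : (κ : ℂ) ≠ 0 := Int.cast_ne_zero.2 hκ
      -- For `m = 2` a constant may be moved between `a₀` and `a₁`; this shift makes `κ * a₁ 0`
      -- equal to the required coefficient of `q`. It is the connecting homomorphism.
      refine key (fun z => a₀ z - (lc (1 - 2) q / κ - a₁ 0)) (fun z => a₁ z + (lc (1 - 2) q / κ - a₁ 0))
        (by fun_prop) (by fun_prop) (fun z hz => ?_) fun _ => ?_
      · rw [hpa z hz]
        simp
      · field_simp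
        ring
  · refine key a₀ a₁ ha₀ ha₁ hpa fun _ => ?_
    rw [h3 hm, lc_congr _ hpa, lc_add _ ha₀.differentiableOn
      (differentiableOn_zpow_mul _ (differentiableOn_comp_inv ha₁)),
      lc_of_entire (by omega) ha₀, zero_add, lc_zpow_mul_comp_inv_self _ ha₁]

/-- In the gap neither the entire part nor the part in `x⁻¹` has a coefficient. Together with
`PairCob.lc_q`, `PairCob.lc_pq` and `PairCob.lc_q_two` this shows that the conditions of
`pairCob_of_lc` are necessary. -/
theorem PairCob.lc_p (h : PairCob m κ p q) {n : ℤ} (hn : 2 - m < n) (hn' : n < 0) : lc n p = 0 := by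
  obtain ⟨a₀, b₀, a₁, b₁, ha₀, hb₀, ha₁, hb₁, h⟩ := h
  rw [lc_congr _ fun z hz => (h z hz).1, lc_add _ ha₀.differentiableOn
      (differentiableOn_zpow_mul _ (differentiableOn_comp_inv ha₁)),
      lc_of_entire hn' ha₀, zero_add, lc_zpow_mul_comp_inv hn ha₁]

theorem PairCob.lc_q_aux (h : PairCob m κ p q) : ∃ a₀ a₁ : ℂ → ℂ,
    Differentiable ℂ a₀ ∧ Differentiable ℂ a₁ ∧ (∀ z ≠ 0, p z = a₀ z + z ^ (2 - m) * a₁ z⁻¹) ∧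
    ∀ n : ℤ, -m < n → n < 0 → lc n q = κ * lc n (fun z => z ^ (1 - m) * a₁ z⁻¹) := by
  obtain ⟨a₀, b₀, a₁, b₁, ha₀, hb₀, ha₁, hb₁, h⟩ := h
  refine ⟨a₀, a₁, ha₀, ha₁, fun z hz => (h z hz).1, fun n hn hn' => ?_⟩
  have hd := (differentiableOn_zpow_mul (1 - m) (differentiableOn_comp_inv ha₁))
  have hd' := (differentiableOn_zpow_mul (-m) (differentiableOn_comp_inv hb₁))
  have e : ∀ z ≠ 0, q z = (b₀ z + z ^ (-m) * b₁ z⁻¹) + κ * (z ^ (1 - m) * a₁ z⁻¹) := fun z hz => by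
    rw [(h z hz).2]
    ring
  rw [lc_congr _ e, lc_add (f := fun z => b₀ z + z ^ (-m) * b₁ z⁻¹) _
      (hb₀.differentiableOn.add hd') (hd.const_mul (κ : ℂ)),
    lc_add _ hb₀.differentiableOn hd', lc_const_mul, lc_of_entire hn' hb₀,
    lc_zpow_mul_comp_inv hn hb₁, add_zero, zero_add]

theorem PairCob.lc_q (h : PairCob m κ p q) {n : ℤ} (hn : 1 - m < n) (hn' : n < 0) : lc n q = 0 := by
  obtain ⟨a₀, a₁, ha₀, ha₁, -, h⟩ := h.lc_q_aux
  rw [h n (by omega) hn', lc_zpow_mul_comp_inv hn ha₁, mul_zero]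

theorem PairCob.lc_pq (h : PairCob m κ p q) (hm : 3 ≤ m) : lc (1 - m) q = κ * lc (2 - m) p := by
  obtain ⟨a₀, a₁, ha₀, ha₁, hp, h⟩ := h.lc_q_aux
  rw [h _ (by omega) (by omega), lc_zpow_mul_comp_inv_self _ ha₁, lc_congr _ hp,
    lc_add _ ha₀.differentiableOn (differentiableOn_zpow_mul _ (differentiableOn_comp_inv ha₁)),
      lc_of_entire (by omega) ha₀, zero_add, lc_zpow_mul_comp_inv_self _ ha₁]

theorem PairCob.lc_q_two (h : PairCob 2 0 p q) : lc (-1) q = 0 := by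
  obtain ⟨a₀, a₁, ha₀, ha₁, hp, h⟩ := h.lc_q_aux
  rw [h _ (by omega) (by omega), Int.cast_zero, zero_mul]

end

theorem lc_zpow (n j : ℤ) : lc n (fun z => z ^ j) = if n = j then 1 else 0 := by
  have h := lc_zpow_mul n j (fun _ => (1 : ℂ))
  simp only [mul_one] at h
  rw [h]
  have hd : Differentiable ℂ (fun _ : ℂ => (1 : ℂ)) := differentiable_const _
  rcases lt_trichotomy n j with hn | hn | hn
  · rw [lc_of_entire (by omega) hd, if_neg hn.ne]
  · rw [hn, sub_self, lc_zero_of_entire hd, if_pos rfl]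
  · have := lc_zpow_mul_comp_inv (f := fun _ => (1 : ℂ)) hn hd
    rw [if_neg hn.ne']
    simp only [lc_zpow_mul] at this
    exact this

theorem lc_add_zpow {p : ℂ → ℂ} (hp : DifferentiableOn ℂ p {0}ᶜ) (n j : ℤ) (a : ℂ) :
    lc n (fun z => p z + a * z ^ j) = lc n p + if n = j then a else 0 := by
  have hd : DifferentiableOn ℂ (fun z : ℂ => a * z ^ j) {0}ᶜ := fun z hz =>
    ((hasDerivAt_zpow' j hz).const_mul a).differentiableAt.differentiableWithinAt
  rw [lc_add n hp hd, lc_const_mul, lc_zpow]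
  simp

theorem differentiableOn_add_zpow {p : ℂ → ℂ} (hp : DifferentiableOn ℂ p {0}ᶜ) (j : ℤ) (a : ℂ) :
    DifferentiableOn ℂ (fun z => p z + a * z ^ j) {0}ᶜ := fun z hz =>
  (hp z hz).add ((hasDerivAt_zpow' j hz).const_mul a).differentiableAt.differentiableWithinAt

theorem lc_pow_mul (n : ℤ) (j : ℕ) (f : ℂ → ℂ) : lc n (fun z => z ^ j * f z) = lc (n - j) f := by
  rw [← lc_zpow_mul]
  simp only [zpow_natCast]

theorem lc_euler {p : ℂ → ℂ} (hp : DifferentiableOn ℂ p {0}ᶜ) (n : ℤ) (a : ℂ) :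
    lc n (fun x => -x ^ 2 * deriv p x + a * x * p x) = (a - (n - 1)) * lc (n - 1) p := by
  have hd := hp.deriv isOpen_punctured
  have h1 : DifferentiableOn ℂ (fun x => (-1) * (x ^ 2 * deriv p x)) {0}ᶜ := by fun_prop
  have h2 : DifferentiableOn ℂ (fun x => a * (x ^ 1 * p x)) {0}ᶜ := by fun_prop
  have h := lc_add n h1 h2
  rw [lc_const_mul, lc_const_mul, lc_pow_mul, lc_pow_mul, lc_deriv _ hp] at h
  rw [lc_congr n fun z _ => by
    rw [show -z ^ 2 * deriv p z + a * z * p z = -1 * (z ^ 2 * deriv p z) + a * (z ^ 1 * p z) by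
      ring], h]
  have : n - (2 : ℕ) + 1 = n - 1 := by push_cast; ring
  rw [this]
  push_cast
  ring

theorem differentiableOn_euler {p : ℂ → ℂ} (hp : DifferentiableOn ℂ p {0}ᶜ) (a : ℂ) :
    DifferentiableOn ℂ (fun x => -x ^ 2 * deriv p x + a * x * p x) {0}ᶜ := by
  have hd := hp.deriv isOpen_punctured
  fun_prop

/-! ### Classification of the invariant classes -/

section
variable {m κ : ℤ} {p q : ℂ → ℂ}

theorem eq_zero_of_cast_mul {a : ℤ} {c : ℂ} (h : (a : ℂ) * c = 0) (ha : a ≠ 0) : c = 0 :=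
  (mul_eq_zero.1 h).resolve_left (Int.cast_ne_zero.2 ha)

theorem lc_euler_q (hp : DifferentiableOn ℂ p {0}ᶜ) (hq : DifferentiableOn ℂ q {0}ᶜ) (n : ℤ) :
    lc n (fun x => -x ^ 2 * deriv q x - m * x * q x + κ * p x) =
      (1 - m - n : ℤ) * lc (n - 1) q + κ * lc n p := by
  have h := lc_add n (differentiableOn_euler hq (-m)) (hp.const_mul (κ : ℂ))
  rw [lc_euler hq, lc_const_mul] at h
  rw [lc_congr n fun z _ => by
    rw [show -z ^ 2 * deriv q z - m * z * q z + κ * p z =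
      -z ^ 2 * deriv q z + -m * z * q z + κ * p z by ring], h]
  push_cast
  ring

theorem differentiableOn_euler_q (hp : DifferentiableOn ℂ p {0}ᶜ) (hq : DifferentiableOn ℂ q {0}ᶜ) :
    DifferentiableOn ℂ (fun x => -x ^ 2 * deriv q x - m * x * q x + κ * p x) {0}ᶜ := by
  have hd := hq.deriv isOpen_punctured
  fun_prop

/-- The slot on which the matrix parts of `e'` and `f'` act trivially. In the gap, `e'` lowers the
exponent of a monomial by one and `f'` raises it by one, with factors that do not vanish in the
interior of the gap. So a surviving `p` coefficient must sit at both ends of the gap, `3 - m = -1`,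
and a class from the `q` part needs `m = 2` and `κ = 0`. -/
theorem pairCob_of_invariant (hp : DifferentiableOn ℂ p {0}ᶜ) (hq : DifferentiableOn ℂ q {0}ᶜ)
    (he : PairCob m κ (deriv p) (deriv q))
    (hf : PairCob m κ (fun x => -x ^ 2 * deriv p x + (2 - m) * x * p x)
      (fun x => -x ^ 2 * deriv q x - m * x * q x + κ * p x)) :
    ∃ a d : ℂ, (m ≠ 4 → a = 0) ∧ (¬(m = 2 ∧ κ = 0) → d = 0) ∧
      PairCob m κ (fun x => p x + (-a) * x ^ (-1 : ℤ))
        (fun x => q x + (-(a * κ / 2)) * x ^ (-2 : ℤ) + (-d) * x ^ (-1 : ℤ)) := by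
  have e1 : ∀ n : ℤ, 2 - m < n → n < 0 → (n + 1 : ℤ) * lc (n + 1) p = 0 := fun n hn hn' => by
    have := he.lc_p hn hn'
    rw [lc_deriv n hp] at this
    exact_mod_cast this
  have e2 : ∀ n : ℤ, 1 - m < n → n < 0 → (n + 1 : ℤ) * lc (n + 1) q = 0 := fun n hn hn' => by
    have := he.lc_q hn hn'
    rw [lc_deriv n hq] at this
    exact_mod_cast this
  have f1 : ∀ n : ℤ, 2 - m < n → n < 0 → (3 - m - n : ℤ) * lc (n - 1) p = 0 := fun n hn hn' => by
    have := hf.lc_p hn hn'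
    rw [lc_euler hp] at this
    push_cast
    linear_combination this
  have f2 : ∀ n : ℤ, 1 - m < n → n < 0 → (1 - m - n : ℤ) * lc (n - 1) q + κ * lc n p = 0 :=
    fun n hn hn' => by rw [← lc_euler_q hp hq, hf.lc_q hn hn']
  have e3 : 3 ≤ m → (2 - m : ℤ) * lc (2 - m) q = κ * ((3 - m : ℤ) * lc (3 - m) p) := fun hm => by
    have := he.lc_pq hm
    rw [lc_deriv _ hp, lc_deriv _ hq, show 1 - m + 1 = 2 - m by ring,
      show 2 - m + 1 = 3 - m by ring] at this
    push_cast at this ⊢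
    linear_combination this
  -- These are the only coefficients that invariance under `e'` and `f'` leaves free. The companion
  -- `a κ / 2` of `x ^ (-2)` in `q` is forced by `e3` for `m = 4`.
  refine ⟨if m = 4 then lc (-1) p else 0, if m = 2 ∧ κ = 0 then lc (-1) q else 0,
    fun h => if_neg h, fun h => if_neg h, ?_⟩
  refine pairCob_of_lc (differentiableOn_add_zpow hp _ _)
    (differentiableOn_add_zpow (differentiableOn_add_zpow hq _ _) _ _)
    (fun n hn hn' => ?_) (fun n hn hn' => ?_) (fun hm => ?_) fun hm hκ => ?_
  · rw [lc_add_zpow hp]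
    -- Invariance under `f'` kills every exponent below `-1`. The exponent `-1` is killed by `e'`,
    -- unless `m = 4`, where its image leaves the gap.
    by_cases h1 : n = -1
    · subst h1
      by_cases hm : m = 4
      · simp [hm]
      · have := eq_zero_of_cast_mul (e1 (-1 - 1) (by omega) (by omega)) (by omega)
        simpa [hm] using this
    · have := eq_zero_of_cast_mul (f1 (n + 1) (by omega) (by omega)) (by omega)
      rw [add_sub_cancel_right] at this
      rw [if_neg h1, add_zero, this]
  · have hm2 : ¬ (m = 2 ∧ κ = 0) := fun h => by omega
    rw [lc_add_zpow (differentiableOn_add_zpow hq _ _), lc_add_zpow hq]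
    simp only [if_neg hm2, neg_zero, ite_self, add_zero]
    by_cases h1 : n = 2 - m
    · by_cases hm : m = 4
      · subst hm
        subst h1
        have := e3 (by omega)
        norm_num at this ⊢
        linear_combination this / 2
      · simp only [if_neg hm, zero_mul, zero_div, neg_zero, ite_self, add_zero]
        refine eq_zero_of_cast_mul (a := 2 - m) ?_ (by omega)
        rw [h1, e3 (by omega)]
        by_cases hm3 : m = 3
        · simp [hm3]
        · have := eq_zero_of_cast_mul (f1 (4 - m) (by omega) (by omega)) (by omega)
          rw [show 4 - m - 1 = 3 - m by ring] at this
          rw [this, mul_zero, mul_zero]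
    · have := eq_zero_of_cast_mul (e2 (n - 1) (by omega) (by omega)) (by omega)
      rw [sub_add_cancel] at this
      rw [this, zero_add]
      split_ifs with h2 h3
      · omega
      · simp
      · rfl
  · have hm2 : ¬ (m = 2 ∧ κ = 0) := fun h => by omega
    rw [lc_add_zpow (differentiableOn_add_zpow hq _ _), lc_add_zpow hq, lc_add_zpow hp]
    simp only [if_neg hm2, neg_zero, ite_self, add_zero]
    have := f2 (2 - m) (by omega) (by omega)
    rw [show 2 - m - 1 = 1 - m by ring, show 1 - m - (2 - m) = -1 by ring] at this
    push_cast at this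
    rw [show lc (1 - m) q = κ * lc (2 - m) p by linear_combination -this]
    by_cases hm4 : m = 4
    · subst hm4
      norm_num
    · simp [hm4]
  · rw [lc_add_zpow (differentiableOn_add_zpow hq _ _), lc_add_zpow hq]
    simp [hm, hκ]

-- The two slots form a tensor product with the standard two-dimensional module of `sl₂`, through
-- the extra terms `p₁`, `q₁` in the action of `e'` and `p₀`, `q₀` in that of `f'`. An invariant
-- needs a two-dimensional factor in the cohomology of one slot: `m - 1 = 2` for the `q` part or `m
-- - 3 = 2` for the `p` part.
set_option maxHeartbeats 800000 in
theorem pairCob_of_invariant_pair {p₀ q₀ p₁ q₁ : ℂ → ℂ} (hp₀ : DifferentiableOn ℂ p₀ {0}ᶜ)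
    (hq₀ : DifferentiableOn ℂ q₀ {0}ᶜ) (hp₁ : DifferentiableOn ℂ p₁ {0}ᶜ)
    (hq₁ : DifferentiableOn ℂ q₁ {0}ᶜ)
    (he₀ : PairCob m κ (fun x => deriv p₀ x - p₁ x) (fun x => deriv q₀ x - q₁ x))
    (he₁ : PairCob m κ (deriv p₁) (deriv q₁))
    (hf₀ : PairCob m κ (fun x => -x ^ 2 * deriv p₀ x + (2 - m) * x * p₀ x)
      (fun x => -x ^ 2 * deriv q₀ x - m * x * q₀ x + κ * p₀ x))
    (hf₁ : PairCob m κ (fun x => -x ^ 2 * deriv p₁ x + (2 - m) * x * p₁ x - p₀ x)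
      (fun x => -x ^ 2 * deriv q₁ x - m * x * q₁ x + κ * p₁ x - q₀ x)) :
    ∃ b c : ℂ, (m ≠ 3 → b = 0) ∧ (m ≠ 5 → c = 0) ∧
      PairCob m κ (fun x => p₀ x + (-c) * x ^ (-1 : ℤ))
        (fun x => q₀ x + b * x ^ (-1 : ℤ) + (-(c * κ / 3)) * x ^ (-2 : ℤ)) ∧
      PairCob m κ (fun x => p₁ x + c * x ^ (-2 : ℤ))
        (fun x => q₁ x + (-b) * x ^ (-2 : ℤ) + (2 * c * κ / 3) * x ^ (-3 : ℤ)) := by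
  have hdp₀ := hp₀.deriv isOpen_punctured
  have hdq₀ := hq₀.deriv isOpen_punctured
  have r1 : ∀ n : ℤ, 2 - m < n → n < 0 → (n + 1 : ℤ) * lc (n + 1) p₁ = 0 := fun n hn hn' => by
    have := he₁.lc_p hn hn'
    rw [lc_deriv n hp₁] at this
    exact_mod_cast this
  have s1 : ∀ n : ℤ, 1 - m < n → n < 0 → (n + 1 : ℤ) * lc (n + 1) q₁ = 0 := fun n hn hn' => by
    have := he₁.lc_q hn hn'
    rw [lc_deriv n hq₁] at this
    exact_mod_cast this
  have s1' : 3 ≤ m → (2 - m : ℤ) * lc (2 - m) q₁ = κ * ((3 - m : ℤ) * lc (3 - m) p₁) := fun hm => by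
    have := he₁.lc_pq hm
    rw [lc_deriv _ hp₁, lc_deriv _ hq₁, show 1 - m + 1 = 2 - m by ring,
      show 2 - m + 1 = 3 - m by ring] at this
    push_cast at this ⊢
    linear_combination this
  have p0 : ∀ n : ℤ, 2 - m < n → n < 0 → (n + 1 : ℤ) * lc (n + 1) p₀ - lc n p₁ = 0 :=
    fun n hn hn' => by
      have := he₀.lc_p hn hn'
      rw [lc_sub n hdp₀ hp₁, lc_deriv n hp₀] at this
      exact_mod_cast this
  have q0 : ∀ n : ℤ, 1 - m < n → n < 0 → (n + 1 : ℤ) * lc (n + 1) q₀ - lc n q₁ = 0 :=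
    fun n hn hn' => by
      have := he₀.lc_q hn hn'
      rw [lc_sub n hdq₀ hq₁, lc_deriv n hq₀] at this
      exact_mod_cast this
  have q0' : 3 ≤ m → (2 - m : ℤ) * lc (2 - m) q₀ - lc (1 - m) q₁ =
      κ * ((3 - m : ℤ) * lc (3 - m) p₀ - lc (2 - m) p₁) := fun hm => by
    have := he₀.lc_pq hm
    rw [lc_sub _ hdp₀ hp₁, lc_sub _ hdq₀ hq₁, lc_deriv _ hp₀, lc_deriv _ hq₀,
      show 1 - m + 1 = 2 - m by ring, show 2 - m + 1 = 3 - m by ring] at this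
    push_cast at this ⊢
    linear_combination this
  have p2 : ∀ n : ℤ, 2 - m < n → n < 0 → (3 - m - n : ℤ) * lc (n - 1) p₀ = 0 := fun n hn hn' => by
    have := hf₀.lc_p hn hn'
    rw [lc_euler hp₀] at this
    push_cast
    linear_combination this
  have q2 : ∀ n : ℤ, 1 - m < n → n < 0 → (1 - m - n : ℤ) * lc (n - 1) q₀ + κ * lc n p₀ = 0 :=
    fun n hn hn' => by rw [← lc_euler_q hp₀ hq₀, hf₀.lc_q hn hn']
  have r2 : ∀ n : ℤ, 2 - m < n → n < 0 → (3 - m - n : ℤ) * lc (n - 1) p₁ - lc n p₀ = 0 :=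
    fun n hn hn' => by
      have := hf₁.lc_p hn hn'
      rw [lc_sub n (differentiableOn_euler hp₁ _) hp₀, lc_euler hp₁] at this
      push_cast
      linear_combination this
  have s2 : ∀ n : ℤ, 1 - m < n → n < 0 →
      (1 - m - n : ℤ) * lc (n - 1) q₁ + κ * lc n p₁ - lc n q₀ = 0 := fun n hn hn' => by
    have := hf₁.lc_q hn hn'
    rwa [lc_sub n (differentiableOn_euler_q hp₁ hq₁) hq₀, lc_euler_q hp₁ hq₁] at this
  have s2' : 3 ≤ m → lc (1 - m) q₀ = κ * lc (2 - m) p₀ := fun hm => by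
    have := hf₁.lc_pq hm
    rw [lc_sub _ (differentiableOn_euler_q hp₁ hq₁) hq₀, lc_euler_q hp₁ hq₁,
      lc_sub _ (differentiableOn_euler hp₁ _) hp₀, lc_euler hp₁,
      show 2 - m - 1 = 1 - m by ring] at this
    push_cast at this
    linear_combination -this
  -- Here `p₀` behaves as a vector killed by `f'` and `p₁` as one killed by `e'`. So in the gap only
  -- `x ^ (-1)` survives in `p₀` and only `x ^ (3 - m)` in `p₁`.
  have hP : ∀ n : ℤ, 2 - m < n → n < -1 → lc n p₀ = 0 := fun n hn hn' => by
    have := eq_zero_of_cast_mul (p2 (n + 1) (by omega) (by omega)) (by omega)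
    rwa [add_sub_cancel_right] at this
  have hR : ∀ n : ℤ, 3 - m < n → n < 0 → lc n p₁ = 0 := fun n hn hn' => by
    have := eq_zero_of_cast_mul (r1 (n - 1) (by omega) (by omega)) (by omega)
    rwa [sub_add_cancel] at this
  have hS : ∀ n : ℤ, 2 - m < n → n < 0 → lc n q₁ = 0 := fun n hn hn' => by
    have := eq_zero_of_cast_mul (s1 (n - 1) (by omega) (by omega)) (by omega)
    rwa [sub_add_cancel] at this
  -- The relation `r2` at `-1` expresses the last coefficient of `p₀` by that of `x ^ (-2)` in `p₁`.
  -- The latter vanishes by `hR` unless `-2` is the exceptional exponent `3 - m`; for `m = 4` its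
  -- factor is zero.
  have hP' : m ≠ 5 → ∀ n : ℤ, 2 - m < n → n < 0 → lc n p₀ = 0 := fun hm n hn hn' => by
    rcases (show n ≤ -1 by omega).lt_or_eq with h | rfl
    · exact hP n hn h
    · have h := r2 (-1) hn hn'
      by_cases hm4 : m = 4
      · subst hm4
        simpa using h
      · rw [hR (-1 - 1) (by omega) (by omega), mul_zero, zero_sub] at h
        exact neg_eq_zero.1 h
  have hR' : m ≠ 5 → ∀ n : ℤ, 2 - m < n → n < 0 → lc n p₁ = 0 := fun hm n hn hn' => by
    rcases (show 3 - m ≤ n by omega).lt_or_eq with h | rfl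
    · exact hR n h hn'
    · have h := p0 _ hn hn'
      by_cases hm4 : m = 4
      · subst hm4
        simpa using h
      · rw [hP _ (by omega) (by omega), mul_zero, zero_sub] at h
        exact neg_eq_zero.1 h
  have hQ : m ≠ 3 → m ≠ 5 → ∀ n : ℤ, 1 - m < n → n < 0 → lc n q₀ = 0 := fun hm hm' n hn hn' => by
    rcases (show n ≤ -1 by omega).lt_or_eq with h | rfl
    · have h1 := q2 (n + 1) (by omega) (by omega)
      rw [hP' hm' _ (by omega) (by omega), mul_zero, add_zero, add_sub_cancel_right] at h1
      exact eq_zero_of_cast_mul h1 (by omega)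
    · have h1 := s2 (-1) (by omega) (by omega)
      by_cases hm2 : m = 2
      · omega
      · rw [hR' hm' _ (by omega) (by omega)] at h1
        have h2 : lc (-1 - 1) q₁ = 0 := by
          by_cases hm4 : m = 4
          · have := s1' (by omega)
            rw [hR' hm' _ (by omega) (by omega), mul_zero, mul_zero] at this
            subst hm4
            exact eq_zero_of_cast_mul this (by omega)
          · exact hS _ (by omega) (by omega)
        rw [h2] at h1
        simpa using h1
  have hS' : m ≠ 3 → m ≠ 5 → ∀ n : ℤ, 1 - m < n → n < 0 → lc n q₁ = 0 := fun hm hm' n hn hn' => by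
    rcases (show 2 - m ≤ n by omega).lt_or_eq with h | rfl
    · exact hS n h hn'
    · have := s1' (by omega)
      rw [hR' hm' _ (by omega) (by omega), mul_zero, mul_zero] at this
      exact eq_zero_of_cast_mul this (by omega)
  have d1 : ∀ {p : ℂ → ℂ}, DifferentiableOn ℂ p {0}ᶜ → ∀ j (a : ℂ) n, n ≠ j →
      lc n (fun z => p z + a * z ^ j) = lc n p := fun hp j a n h => by
    rw [lc_add_zpow hp, if_neg h, add_zero]
  have d2 : ∀ {p : ℂ → ℂ}, DifferentiableOn ℂ p {0}ᶜ → ∀ j (a : ℂ),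
      lc j (fun z => p z + a * z ^ j) = lc j p + a := fun hp j a => by
    rw [lc_add_zpow hp, if_pos rfl]
  have hda := fun {p : ℂ → ℂ} (hp : DifferentiableOn ℂ p {0}ᶜ) j a => differentiableOn_add_zpow hp j a
  by_cases hm3 : m = 3
  · subst hm3
    -- For `m = 3` the `p` gap is empty. The coefficient of `x ^ (-1)` in `q₀` is free and
    -- determines that of `x ^ (-2)` in `q₁`, modulo coboundaries, through `s2`.
    refine ⟨-lc (-1) q₀, 0, fun h => absurd rfl h, fun _ => rfl, ?_, ?_⟩
    · refine pairCob_of_lc (hda hp₀ _ _) (hda (hda hq₀ _ _) _ _) (fun n hn hn' => by omega)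
        (fun n hn hn' => ?_) (fun _ => ?_) fun h => by omega
      · obtain rfl : n = -1 := by omega
        rw [d1 (hda hq₀ _ _) _ _ _ (by omega), d2 hq₀, add_neg_cancel]
      · have := s2' (by omega)
        simp only [zero_mul, zero_div, neg_zero, add_zero] at this ⊢
        rwa [d1 hq₀ _ _ _ (by omega)]
    · refine pairCob_of_lc (hda hp₁ _ _) (hda (hda hq₁ _ _) _ _) (fun n hn hn' => by omega)
        (fun n hn hn' => ?_) (fun _ => ?_) fun h => by omega
      · obtain rfl : n = -1 := by omega
        have := q0 (-1) (by omega) (by omega)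
        rw [d1 (hda hq₁ _ _) _ _ _ (by omega), d1 hq₁ _ _ _ (by omega)]
        simpa using this
      · have := s2 (-1) (by omega) (by omega)
        rw [d1 (hda hq₁ _ _) _ _ _ (by omega), d1 hp₁ _ _ _ (by omega),
          show (1 : ℤ) - 3 = -2 by norm_num, d2 hq₁]
        norm_num at this ⊢
        linear_combination -this
  by_cases hm5 : m = 5
  · subst hm5
    have hp1 : lc (-2) p₁ = -lc (-1) p₀ := by
      have := r2 (-1) (by omega) (by omega)
      norm_num at this
      linear_combination -this
    -- For `m = 5` the coefficient of `x ^ (-1)` in `p₀` is free; `hp1`, `q2` and `s1'` then force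
    -- the coefficients `-c`, `c κ / 3` and `-2 c κ / 3` of the other terms.
    refine ⟨0, lc (-1) p₀, fun _ => rfl, fun h => absurd rfl h, ?_, ?_⟩
    · simp only [zero_mul, add_zero]
      refine pairCob_of_lc (hda hp₀ _ _) (hda hq₀ _ _) (fun n hn hn' => ?_)
        (fun n hn hn' => ?_) (fun _ => ?_) fun h => by omega
      · by_cases h : n = -1
        · rw [h, d2 hp₀, add_neg_cancel]
        · rw [d1 hp₀ _ _ _ h, hP n hn (by omega)]
      · obtain rfl | rfl | rfl : n = -1 ∨ n = -2 ∨ n = -3 := by omega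
        · have := s2 (-1) (by omega) (by omega)
          rw [hR (-1) (by omega) (by omega), hS (-1 - 1) (by omega) (by omega)] at this
          rw [d1 hq₀ _ _ _ (by omega)]
          simpa using this
        · have := q2 (-1) (by omega) (by omega)
          rw [d2 hq₀]
          norm_num at this
          linear_combination -this / 3
        · have := q2 (-2) (by omega) (by omega)
          rw [d1 hq₀ _ _ _ (by omega)]
          rw [hP (-2) (by omega) (by omega)] at this
          norm_num at this
          exact this
      · rw [d1 hq₀ _ _ _ (by omega), d1 hp₀ _ _ _ (by omega)]
        exact s2' (by omega)
    · simp only [neg_zero, zero_mul, add_zero]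
      refine pairCob_of_lc (hda hp₁ _ _) (hda hq₁ _ _) (fun n hn hn' => ?_)
        (fun n hn hn' => ?_) (fun _ => ?_) fun h => by omega
      · obtain rfl | rfl : n = -1 ∨ n = -2 := by omega
        · rw [d1 hp₁ _ _ _ (by omega), hR (-1) (by omega) (by omega)]
        · rw [d2 hp₁, hp1, neg_add_cancel]
      · by_cases h : n = -3
        · subst h
          have := s1' (by omega)
          norm_num at this
          rw [hp1] at this
          rw [d2 hq₁]
          linear_combination this / 3
        · rw [d1 hq₁ _ _ _ (by omega), hS n (by omega) (by omega)]
      · have h1 := q0' (by omega)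
        have h2 := q2 (-2) (by omega) (by omega)
        have h3 := hP (-2) (by omega) (by omega)
        rw [d1 hq₁ _ _ _ (by omega), d1 hp₁ _ _ _ (by omega)]
        norm_num at h1 h2 h3 ⊢
        rw [h3] at h1 h2
        linear_combination -h1 + 3 / 2 * h2
  · refine ⟨0, 0, fun _ => rfl, fun _ => rfl, ?_, ?_⟩
    · simp only [zero_mul, mul_zero, neg_zero, add_zero, zero_div]
      refine pairCob_of_lc hp₀ hq₀ (hP' hm5) (hQ hm3 hm5) s2' fun hm hκ => ?_
      subst hm hκ
      have := hf₁.lc_q_two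
      rw [lc_sub _ (differentiableOn_euler_q hp₁ hq₁) hq₀, lc_euler_q hp₁ hq₁] at this
      simpa using this
    · simp only [zero_mul, mul_zero, neg_zero, add_zero, zero_div]
      refine pairCob_of_lc hp₁ hq₁ (hR' hm5) (hS' hm3 hm5) (fun hm => ?_) fun hm hκ => ?_
      · have h1 := q0' hm
        have h2 : lc (2 - m) q₀ = 0 := hQ hm3 hm5 _ (by omega) (by omega)
        have h3 : lc (3 - m) p₀ = 0 := hP' hm5 _ (by omega) (by omega)
        rw [h2, h3] at h1
        linear_combination -h1
      · subst hm hκ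
        have := he₀.lc_q_two
        rw [lc_sub _ hdq₀ hq₁, lc_deriv _ hq₀] at this
        simpa using this

end

end SuperCP1
end

noncomputable section

namespace SuperCP1

/-! ### Isomorphisms over the identity from local operators -/

theorem analyticAt_coord (l : Grassmann →ₗ[ℂ] ℂ) {F : ℂ → Grassmann} {z : ℂ}
    (hF : ∀ᶠ t in nhds z, DiffAt F t) : AnalyticAt ℂ (fun t => l (F t)) z :=
  Complex.analyticAt_iff_eventually_differentiableAt.2
    (hF.mono fun _ ht => (ht.hasD l).differentiableAt)

/-- Differentiability of `F` in a neighbourhood makes its coordinates analytic, so the derivatives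
entering `app` are again differentiable. At the single point `z` this would not be enough. -/
theorem IsT2.diffAt_app {X : EvenVF} {W : Set ℂ} (hW : IsOpen W) (hX : IsT2 X W) {z : ℂ}
    (hz : z ∈ W) {F : ℂ → Grassmann} (hF : ∀ᶠ t in nhds z, DiffAt F t) : DiffAt (app X F) z := by
  have e : app X F =ᶠ[nhds z] fun z =>
      elt 0 0 (fun l => pC X l z * deriv (fun t => body (F t)) z)
      (∑ l, (pC X l z * deriv (fun t => cL l (F t)) z + qC X l z * cL l (F z))) := by
    filter_upwards [hW.mem_nhds hz, hF] with t ht hFt using hX.app_eq ht hFt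
  have hb : DifferentiableAt ℂ (deriv fun t => body (F t)) z :=
    (analyticAt_coord body.toLinearMap hF).deriv.differentiableAt
  have hl := fun l => (analyticAt_coord (cL l) hF)
  refine DiffAt.congr (diffAt_iff.2 ⟨?_, fun l => ?_, fun l => ?_, ?_⟩) e
  · simp
  · simp
  · simp only [cP_elt]
    exact (hX.diff_p hz l).mul hb
  · simp only [cT_elt]
    exact DifferentiableAt.fun_sum fun l _ => ((hX.diff_p hz l).mul (hl l).deriv.differentiableAt).add
      ((hX.diff_q hz l).mul (hl l).differentiableAt)

theorem Supermanifold.diffAt_trans (M : Supermanifold) {F : ℂ → Grassmann} {x : ℂ} (hx : x ≠ 0)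
    (hF : ∀ᶠ t in nhds x⁻¹, DiffAt F t) : DiffAt (M.trans F) x := by
  refine (M.diffAt_subst hx hF.self_of_nhds).add (M.v_mem.diffAt_app isOpen_punctured hx ?_)
  filter_upwards [(continuousAt_inv₀ hx).tendsto.eventually hF, eventually_ne_zero hx] with t ht ht'
  exact M.diffAt_subst ht' ht

theorem Supermanifold.eventually_diffAt_trans (M : Supermanifold) {F : ℂ → Grassmann} {x : ℂ}
    (hx : x ≠ 0) (hF : ∀ᶠ t in nhds x⁻¹, DiffAt F t) : ∀ᶠ t in nhds x, DiffAt (M.trans F) t := by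
  filter_upwards [(continuousAt_inv₀ hx).tendsto.eventually hF.eventually_nhds,
    eventually_ne_zero hx] with t ht ht' using M.diffAt_trans ht' ht

/-- An operator on germs of superfunctions which respects the algebra structure and the parity. -/
structure LocalHom where
  toFun : (ℂ → Grassmann) → ℂ → Grassmann
  congr : ∀ {F G : ℂ → Grassmann} {z : ℂ}, F =ᶠ[nhds z] G → toFun F z = toFun G z
  diff : ∀ {F : ℂ → Grassmann} {z : ℂ}, (∀ᶠ t in nhds z, DiffAt F t) → DiffAt (toFun F) z
  map_add : ∀ {F G : ℂ → Grassmann} {z : ℂ}, DiffAt F z → DiffAt G z →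
    toFun (F + G) z = toFun F z + toFun G z
  map_mul : ∀ {F G : ℂ → Grassmann} {z : ℂ}, DiffAt F z → DiffAt G z →
    toFun (F * G) z = toFun F z * toFun G z
  map_const : ∀ (r : ℂ) (z : ℂ),
    toFun (fun _ => algebraMap ℂ Grassmann r) z = algebraMap ℂ Grassmann r
  parity : ∀ {F : ℂ → Grassmann} {z : ℂ} {p : ZMod 2}, DiffAt F z →
    (∀ᶠ t in nhds z, F t ∈ parityPart p) → toFun F z ∈ parityPart p

namespace LocalHom

/-- The action on a pair of functions. -/
def onPair (Φ : Fin 2 → LocalHom) {U : Opens (OnePoint ℂ)} (f : LocalPair U) : LocalPair U :=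
  fun j z => (Φ j).toFun (f.ext j) z

theorem ext_onPair (Φ : Fin 2 → LocalHom) {U : Opens (OnePoint ℂ)} (f : LocalPair U) {j : Fin 2}
    {z : ℂ} (hz : chart j z ∈ U) : (onPair Φ f).ext j =ᶠ[nhds z] (Φ j).toFun (f.ext j) := by
  filter_upwards [eventually_mem hz] with t ht
  rw [LocalPair.ext, dif_pos ht, onPair]

theorem eventually_diffAt {M : Supermanifold} {U : Opens (OnePoint ℂ)} (s : M.sections U)
    {j : Fin 2} {z : ℂ} (hz : chart j z ∈ U) : ∀ᶠ t in nhds z, DiffAt (s.1.ext j) t :=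
  (eventually_mem hz).mono fun t ht => s.2.1 j t ht

/-- The map on sections given by operators which are compatible with the transitions. -/
def onSections (Φ : Fin 2 → LocalHom) {M N : Supermanifold}
    (hΦ : ∀ F : ℂ → Grassmann, ∀ x : ℂ, x ≠ 0 → (∀ᶠ t in nhds x⁻¹, DiffAt F t) →
      M.trans ((Φ 1).toFun F) x = (Φ 0).toFun (N.trans F) x) (U : Opens (OnePoint ℂ)) :
    N.sections U →ₐ[ℂ] M.sections U where
  toFun s := ⟨onPair Φ s.1, by
    refine ⟨fun j z hz => ((Φ j).diff (eventually_diffAt s hz)).congr (ext_onPair Φ s.1 hz),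
      fun x hx hU => ?_⟩
    have hU' : chart 1 x⁻¹ ∈ U := by rwa [chart_one_inv hx]
    rw [(ext_onPair Φ s.1 hU).eq_of_nhds, M.trans_congr hx (ext_onPair Φ s.1 hU'),
      hΦ _ _ hx (eventually_diffAt s hU')]
    refine (Φ 0).congr ?_
    filter_upwards [eventually_mem hU, eventually_ne_zero hx] with t ht ht'
    exact s.2.2 t ht' ht⟩
  map_one' := by
    refine Subtype.ext (funext fun j => funext fun z => ?_)
    have := ((Φ j).congr (LocalPair.ext_algebraMap z.2 1)).trans ((Φ j).map_const 1 z)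
    simpa [onPair] using this
  map_zero' := by
    refine Subtype.ext (funext fun j => funext fun z => ?_)
    have := ((Φ j).congr (LocalPair.ext_algebraMap z.2 0)).trans ((Φ j).map_const 0 z)
    simpa [onPair] using this
  map_mul' s t := by
    refine Subtype.ext (funext fun j => funext fun z => ?_)
    change (Φ j).toFun (LocalPair.ext (s.1 * t.1) j) z = _
    rw [LocalPair.ext_mul, (Φ j).map_mul (s.2.1 j z z.2) (t.2.1 j z z.2)]
    rfl
  map_add' s t := by
    refine Subtype.ext (funext fun j => funext fun z => ?_)
    change (Φ j).toFun (LocalPair.ext (s.1 + t.1) j) z = _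
    rw [LocalPair.ext_add, (Φ j).map_add (s.2.1 j z z.2) (t.2.1 j z z.2)]
    rfl
  commutes' r := by
    refine Subtype.ext (funext fun j => funext fun z => ?_)
    exact ((Φ j).congr (LocalPair.ext_algebraMap z.2 r)).trans ((Φ j).map_const r z)

theorem onSections_onSections {Φ Ψ : Fin 2 → LocalHom}
    (h : ∀ j F z, (∀ᶠ t in nhds z, DiffAt F t) → (Φ j).toFun ((Ψ j).toFun F) z = F z)
    {M N : Supermanifold} (hΦ) (hΨ) (U : Opens (OnePoint ℂ)) (s : M.sections U) :
    onSections (M := M) (N := N) Φ hΦ U (onSections (M := N) (N := M) Ψ hΨ U s) = s := by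
  refine Subtype.ext (funext fun j => funext fun z => ?_)
  change (Φ j).toFun ((onPair Ψ s.1).ext j) z = _
  rw [(Φ j).congr (ext_onPair Ψ s.1 z.2), h j _ _ (eventually_diffAt s z.2), LocalPair.ext,
    dif_pos z.2]

/-- An isomorphism over the identity is a pair of invertible local operators, one per chart,
intertwining the transitions. The intertwining property of the inverses need not be assumed: it
follows by cancelling `Φ`. -/
theorem isomorphicOverId {M N : Supermanifold} (Φ Ψ : Fin 2 → LocalHom)
    (h : ∀ j F z, (∀ᶠ t in nhds z, DiffAt F t) → (Φ j).toFun ((Ψ j).toFun F) z = F z)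
    (h' : ∀ j F z, (∀ᶠ t in nhds z, DiffAt F t) → (Ψ j).toFun ((Φ j).toFun F) z = F z)
    (hΦ : ∀ F : ℂ → Grassmann, ∀ x : ℂ, x ≠ 0 → (∀ᶠ t in nhds x⁻¹, DiffAt F t) →
      M.trans ((Φ 1).toFun F) x = (Φ 0).toFun (N.trans F) x) : M.IsomorphicOverId N := by
  have hd : ∀ {F : ℂ → Grassmann} {z : ℂ} (Φ : LocalHom), (∀ᶠ t in nhds z, DiffAt F t) →
      ∀ᶠ t in nhds z, DiffAt (Φ.toFun F) t := fun Φ hF =>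
    hF.eventually_nhds.mono fun t ht => Φ.diff ht
  have hΨ : ∀ F : ℂ → Grassmann, ∀ x : ℂ, x ≠ 0 → (∀ᶠ t in nhds x⁻¹, DiffAt F t) →
      N.trans ((Ψ 1).toFun F) x = (Ψ 0).toFun (M.trans F) x := by
    intro F x hx hF
    rw [← h' 0 _ x (N.eventually_diffAt_trans hx (hd (Ψ 1) hF))]
    refine (Ψ 0).congr ?_
    filter_upwards [(continuousAt_inv₀ hx).tendsto.eventually hF.eventually_nhds,
      eventually_ne_zero hx] with t ht ht'
    rw [← hΦ _ _ ht' (hd (Ψ 1) ht)]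
    refine M.trans_congr ht' ?_
    filter_upwards [ht.eventually_nhds] with y hy using h 1 _ _ hy
  refine ⟨⟨Homeomorph.refl _, fun U => AlgEquiv.ofAlgHom (onSections (M := M) (N := N) Φ hΦ U)
    (onSections (M := N) (N := M) Ψ hΨ U) (AlgHom.ext fun s => onSections_onSections h hΦ hΨ U s)
    (AlgHom.ext fun s => onSections_onSections h' hΨ hΦ U s), ?_, ?_⟩, rfl⟩
  · intro U V hVU s
    refine Subtype.ext (funext fun j => funext fun z => ?_)
    exact ((Φ j).congr (LocalPair.ext_restrict hVU s.1 z.2)).symm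
  · intro U p s hs j z
    refine (Φ j).parity (s.2.1 j z z.2) ?_
    filter_upwards [eventually_mem (U := U) z.2] with t ht
    rw [LocalPair.ext, dif_pos ht]
    exact hs j _

end LocalHom

theorem Supermanifold.IsomorphicOverId.trans {M N P : Supermanifold} (h : M.IsomorphicOverId N)
    (h' : N.IsomorphicOverId P) : M.IsomorphicOverId P := by
  obtain ⟨⟨σ, f, hf, hf'⟩, rfl⟩ := h
  obtain ⟨⟨τ, g, hg, hg'⟩, rfl⟩ := h'
  refine ⟨⟨Homeomorph.refl _, fun U => (g U).trans (f U), fun U V hVU s => ?_, fun U p s hs => ?_⟩,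
    rfl⟩
  · have := hf U V hVU (g U s)
    refine this.trans ?_
    exact congrArg (f V) (hg U V hVU s)
  · exact hf' U p _ (hg' U p s hs)

theorem Supermanifold.IsomorphicOverId.refl (M : Supermanifold) : M.IsomorphicOverId M :=
  ⟨⟨Homeomorph.refl _, fun _ => AlgEquiv.refl, fun _ _ _ _ => rfl, fun _ _ _ hs => hs⟩, rfl⟩

end SuperCP1
end

noncomputable section

namespace SuperCP1

/-! ### Exponentials of vector fields of degree two -/

theorem zmod_two_eq : ∀ p : ZMod 2, p = 0 ∨ p = 1 := by decide

theorem DiffAt.dX_mem_parityPart {F : ℂ → Grassmann} {z : ℂ} {p : ZMod 2} (hF : DiffAt F z)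
    (h : ∀ᶠ t in nhds z, F t ∈ parityPart p) : dX F z ∈ parityPart p := by
  have key : ∀ l : Grassmann →ₗ[ℂ] ℂ, (∀ᶠ t in nhds z, l (F t) = 0) → l (dX F z) = 0 := by
    intro l hl
    rw [← (hF.hasD l).deriv, Filter.EventuallyEq.deriv_eq hl, deriv_const]
  obtain rfl | rfl := zmod_two_eq p
  · rw [mem_parityPart_zero]
    exact ⟨fun i => key _ (h.mono fun t ht => (mem_parityPart_zero.1 ht).1 i),
      key _ (h.mono fun t ht => (mem_parityPart_zero.1 ht).2)⟩
  · rw [mem_parityPart_one]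
    exact ⟨key body.toLinearMap (h.mono fun t ht => (mem_parityPart_one.1 ht).1),
      fun i => key _ (h.mono fun t ht => (mem_parityPart_one.1 ht).2 i)⟩

theorem IsT2.app_mem_parityPart {X : EvenVF} {W : Set ℂ} (hX : IsT2 X W) {z : ℂ} (hz : z ∈ W)
    {F : ℂ → Grassmann} {p : ZMod 2} (hF : DiffAt F z) (h : ∀ᶠ t in nhds z, F t ∈ parityPart p) :
    app X F z ∈ parityPart p := by
  have h1 := hF.dX_mem_parityPart h
  have h2 := h.self_of_nhds
  rw [hX.app_eq hz hF, ← hF.body_dX]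
  simp only [← hF.cL_dX]
  obtain rfl | rfl := zmod_two_eq p
  · rw [mem_parityPart_zero] at *
    simp [h1.1, h2.1]
  · rw [mem_parityPart_one] at *
    simp [h1.1]

/-- A field of degree two reads only the body and the linear part of its argument and produces only
degrees two and three, so two of them compose to zero. -/
theorem IsT2.app_app {X Y : EvenVF} {W : Set ℂ} (hW : IsOpen W) (hX : IsT2 X W) (hY : IsT2 Y W)
    {z : ℂ} (hz : z ∈ W) {F : ℂ → Grassmann} (hF : ∀ᶠ t in nhds z, DiffAt F t) :
    app X (app Y F) z = 0 := by
  have e : ∀ᶠ z in nhds z, app Y F z =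
      elt 0 0 (fun l => pC Y l z * deriv (fun t => body (F t)) z)
      (∑ l, (pC Y l z * deriv (fun t => cL l (F t)) z + qC Y l z * cL l (F z))) := by
    filter_upwards [hW.mem_nhds hz, hF] with t ht hFt using hY.app_eq ht hFt
  have h0 : (fun t => body (app Y F t)) =ᶠ[nhds z] fun _ => 0 := e.mono fun t ht => by simp [ht]
  have h1 : ∀ l, (fun t => cL l (app Y F t)) =ᶠ[nhds z] fun _ => 0 := fun l =>
    e.mono fun t ht => by simp [ht]
  rw [hX.app_eq hz (hY.diffAt_app hW hz hF), h0.deriv_eq]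
  simp only [(h1 _).deriv_eq, (h1 _).eq_of_nhds]
  refine gext ?_ ?_ ?_ ?_ <;> simp

/-- The operator `id + w` for a vector field of degree two. -/
def LocalHom.expVF (w : EvenVF) (hw : IsT2 w Set.univ) : LocalHom where
  toFun F z := F z + app w F z
  congr h := by rw [h.eq_of_nhds, app_congr w h]
  diff h := h.self_of_nhds.add (hw.diffAt_app isOpen_univ (Set.mem_univ _) h)
  map_add hF hG := by
    rw [app_add_right w hF hG, Pi.add_apply]
    abel
  map_mul hF hG := by
    rw [app_mul hw (Set.mem_univ _) hF hG, Pi.mul_apply, add_mul, mul_add, mul_add,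
      app_mul_app hw (Set.mem_univ _), add_zero]
    abel
  map_const r z := by
    rw [app, (hasD_const _ z).dX_eq]
    simp only [dXi_algebraMap, mul_zero, Finset.sum_const_zero, add_zero]
  parity hF h := Submodule.add_mem _ h.self_of_nhds (hw.app_mem_parityPart (Set.mem_univ _) hF h)

theorem LocalHom.expVF_neg (w : EvenVF) (hw : IsT2 w Set.univ) (hw' : IsT2 ((-1 : ℂ) • w) Set.univ)
    {F : ℂ → Grassmann} {z : ℂ} (hF : ∀ᶠ t in nhds z, DiffAt F t) :
    (expVF ((-1 : ℂ) • w) hw').toFun ((expVF w hw).toFun F) z = F z := by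
  change (F + app w F) z + app _ (F + app w F) z = _
  rw [app_add_right _ hF.self_of_nhds (hw.diffAt_app isOpen_univ (Set.mem_univ _) hF),
    hw'.app_app isOpen_univ hw (Set.mem_univ _) hF, app_smul_left, Pi.add_apply]
  module

/-- This is what makes `toChart0` a change of charts for derivations: `toChart0` is defined by
values on the coordinates, and here the intertwining is obtained for all superfunctions. -/
theorem subst_app (k : Fin 3 → ℤ) {w : EvenVF} (hw : IsT2 w Set.univ) {F : ℂ → Grassmann} {x : ℂ}
    (hx : x ≠ 0) (hF : DiffAt F x⁻¹) :
    subst (diagMatrix k) (app w F) x = app (toChart0 k w) (subst (diagMatrix k) F) x := by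
  have hS : DiffAt (subst (diagMatrix k) F) x :=
    (glue k 0 (isT2_zero _)).diffAt_subst hx hF
  have hp := fun l => congrArg (cP l) (toChart0_eq (k := k) hw hx none)
  have hq := fun l => congrArg cT (toChart0_eq (k := k) hw hx (some l))
  change ∀ l, pC _ l x = pC (vec _ _) l x at hp
  change ∀ l, qC _ l x = qC (vec _ _) l x at hq
  simp only [pC_vec] at hp
  simp only [qC_vec] at hq
  rw [(isT2_toChart0 k hw).app_eq hx hS]
  have d1 : ∀ l : Grassmann →ₗ[ℂ] ℂ, HasDerivAt (fun t : ℂ => l (F t⁻¹)) (l (dX F x⁻¹) * -(x ^ 2)⁻¹) x :=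
    fun l => HasDerivAt.comp x (hF.hasD l) (hasDerivAt_inv hx)
  have d2 : deriv (fun t => body (subst (diagMatrix k) F t)) x = body (dX F x⁻¹) * -(x ^ 2)⁻¹ := by
    simp only [body_subst]
    exact (d1 body.toLinearMap).deriv
  have d3 : ∀ l, deriv (fun t => cL l (subst (diagMatrix k) F t)) x =
      (-k l : ℤ) * x ^ (-k l - 1) * cL l (F x⁻¹) + x ^ (-k l) * (cL l (dX F x⁻¹) * -(x ^ 2)⁻¹) := by
    intro l
    simp only [cL_subst]
    exact ((hasDerivAt_zpow' (-k l) hx).mul (d1 (cL l))).deriv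
  have hx2 : ∀ n : ℤ, x ^ (2 - n) = x ^ 2 * x ^ (-n) := fun n => by
    rw [sub_eq_add_neg, zpow_add₀ hx, zpow_ofNat]
  have hx1 : ∀ n : ℤ, x ^ (1 - n) = x * x ^ (-n) := fun n => by
    rw [sub_eq_add_neg, zpow_add₀ hx, zpow_one]
  have hx1' : ∀ n : ℤ, x ^ (-n - 1) = x⁻¹ * x ^ (-n) := fun n => by
    rw [sub_eq_add_neg, zpow_add₀ hx, zpow_neg_one, mul_comm]
  refine gext ?_ (fun l => ?_) (fun l => ?_) ?_
  · rw [body_subst, hw.app_eq (Set.mem_univ _) hF]; simp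
  · rw [cL_subst, hw.app_eq (Set.mem_univ _) hF]; simp
  · rw [cP_subst _ _ _ _ hx, hw.app_eq (Set.mem_univ _) hF, ← hF.body_dX, d2, cP_elt, cP_elt, hp,
      hx2]
    field_simp
  · rw [cT_subst _ _ _ hx, hw.app_eq (Set.mem_univ _) hF, cT_elt, cT_elt, Finset.mul_sum]
    refine Finset.sum_congr rfl fun l _ => ?_
    rw [← hF.cL_dX, d3, hp, hq, hx2, hx1, hx1', cL_subst, ← wt_add k l, neg_add, zpow_add₀ hx]
    field_simp
    push_cast
    ring

/-- The chart operators `id + w₀` and `id + w₁` intertwine the two gluings. The condition is `v + w₁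
= w₀ + v'` in the chart `x`, with no higher-order correction because of `IsT2.app_app`. -/
theorem glue_isomorphicOverId_of_isCoboundary {k : Fin 3 → ℤ} {v v' : EvenVF} (hv : IsT2 v {0}ᶜ)
    (hv' : IsT2 v' {0}ᶜ) (h : IsCoboundary k (v + (-1 : ℂ) • v')) :
    (glue k v hv).IsomorphicOverId (glue k v' hv') := by
  obtain ⟨w₀, w₁, h0, h1, h⟩ := h
  have e : ∀ w : EvenVF, (-1 : ℂ) • (-1 : ℂ) • w = w := fun w => by
    rw [smul_smul, neg_one_mul, neg_neg, one_smul]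
  have hw : ∀ j, IsT2 ((![w₀, w₁] : Fin 2 → EvenVF) j) Set.univ := fun j => by
    fin_cases j
    exacts [h0, h1]
  refine LocalHom.isomorphicOverId (fun j => LocalHom.expVF _ (hw j))
    (fun j => LocalHom.expVF _ ((hw j).smul (-1))) (fun j F z hF => ?_)
    (fun j F z hF => LocalHom.expVF_neg _ _ _ hF) fun F x hx hF => ?_
  · have h1 : IsT2 ((-1 : ℂ) • (-1 : ℂ) • (![w₀, w₁] : Fin 2 → EvenVF) j) Set.univ := by
      rw [e]; exact hw j
    have := LocalHom.expVF_neg _ ((hw j).smul (-1)) h1 hF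
    simpa only [e] using this
  · change subst (diagMatrix k) (F + app w₁ F) x + app v (subst (diagMatrix k) (F + app w₁ F)) x =
      (subst (diagMatrix k) F + app v' (subst (diagMatrix k) F)) x +
        app w₀ (subst (diagMatrix k) F + app v' (subst (diagMatrix k) F)) x
    set S := subst (diagMatrix k) with hS
    have hSd : ∀ᶠ t in nhds x, DiffAt (S F) t := by
      filter_upwards [(continuousAt_inv₀ hx).tendsto.eventually hF, eventually_ne_zero hx] with
        t ht ht'
      exact (glue k 0 (isT2_zero _)).diffAt_subst ht' ht
    have hc := isT2_toChart0 k h1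
    have hS1 : S (app w₁ F) =ᶠ[nhds x] app (toChart0 k w₁) (S F) := by
      filter_upwards [(continuousAt_inv₀ hx).tendsto.eventually hF, eventually_ne_zero hx] with
        t ht ht' using subst_app k h1 ht' ht
    have hd1 : DiffAt (S (app w₁ F)) x :=
      (hc.diffAt_app isOpen_punctured hx hSd).congr hS1
    rw [hS, subst_add, ← hS, app_add_right _ hSd.self_of_nhds hd1, app_congr _ hS1,
      hv.app_app isOpen_punctured hc hx hSd, app_add_right _ hSd.self_of_nhds
      (hv'.diffAt_app isOpen_punctured hx hSd)]
    have h0' : app w₀ (app v' (S F)) x = 0 :=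
      (IsT2.mk (fun o z _ => h0.diff o z (Set.mem_univ z)) (fun z _ => h0.deg_x z (Set.mem_univ z))
        (fun i z _ => h0.deg_ξ i z (Set.mem_univ z)) : IsT2 w₀ {0}ᶜ).app_app isOpen_punctured hv'
        hx hSd
    rw [h0', Pi.add_apply, Pi.add_apply, hS1.eq_of_nhds]
    have h2 : app (v + (-1 : ℂ) • v') (S F) x = app (w₀ + (-1 : ℂ) • toChart0 k w₁) (S F) x := by
      simp only [app, h _ x hx, Pi.add_apply, Pi.smul_apply]
      simp only [sub_eq_add_neg, neg_smul, one_smul]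
    simp only [app_add_left, app_smul_left] at h2
    rw [← sub_eq_zero] at h2 ⊢
    rw [← h2]
    module

end SuperCP1
end

noncomputable section

namespace SuperCP1

/-! ### Linear changes of the odd coordinates -/

theorem gmap_mem_parityPart (A : Matrix (Fin 3) (Fin 3) ℂ) {a : Grassmann} {p : ZMod 2}
    (h : a ∈ parityPart p) : gmap A a ∈ parityPart p := by
  obtain rfl | rfl := zmod_two_eq p
  · rw [mem_parityPart_zero] at *
    simp [cL_gmap, cT_gmap, h.1, h.2]
  · rw [mem_parityPart_one] at *
    simp [body_gmap, cP_gmap, h.1, h.2]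

theorem diffAt_gmap {h : ℂ → Matrix (Fin 3) (Fin 3) ℂ} {z : ℂ}
    (hd : ∀ i j, DifferentiableAt ℂ (fun t => h t i j) z) {F : ℂ → Grassmann} (hF : DiffAt F z) :
    DiffAt (fun t => gmap (h t) (F t)) z := by
  rw [diffAt_iff] at *
  simp only [body_gmap, cL_gmap, cP_gmap, cT_gmap, Matrix.det_fin_three]
  refine ⟨hF.1, fun i => DifferentiableAt.fun_sum fun j _ => (hd _ _).mul (hF.2.1 j),
    fun i => DifferentiableAt.fun_sum fun j _ => ?_, ?_⟩
  · exact (((hd _ _).mul (hd _ _)).sub ((hd _ _).mul (hd _ _))).mul (hF.2.2.1 j)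
  · refine DifferentiableAt.mul ?_ hF.2.2.2
    exact ((((((hd _ _).mul (hd _ _)).mul (hd _ _)).sub (((hd _ _).mul (hd _ _)).mul (hd _ _))).sub
      (((hd _ _).mul (hd _ _)).mul (hd _ _))).add (((hd _ _).mul (hd _ _)).mul (hd _ _))).add
      (((hd _ _).mul (hd _ _)).mul (hd _ _)) |>.sub (((hd _ _).mul (hd _ _)).mul (hd _ _))

/-- The substitution `ξ_j ↦ ∑ i, h i j ξ_i`. -/
def LocalHom.linear (h : ℂ → Matrix (Fin 3) (Fin 3) ℂ)
    (hd : ∀ i j, Differentiable ℂ fun t => h t i j) : LocalHom where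
  toFun F z := gmap (h z) (F z)
  congr e := by rw [e.eq_of_nhds]
  diff hF := diffAt_gmap (fun i j => hd i j _) hF.self_of_nhds
  map_add _ _ := by rw [Pi.add_apply, _root_.map_add]
  map_mul _ _ := by rw [Pi.mul_apply, _root_.map_mul]
  map_const _ _ := AlgHom.commutes _ _
  parity _ hp := gmap_mem_parityPart _ hp.self_of_nhds

/-- A linear substitution acts on bivectors by its cofactor matrix. Multiplying by the transpose of
`h` turns this into the determinant, so `hp` and `hq` need no inverse of `h`. -/
theorem app_gmap {v v' : EvenVF} {W : Set ℂ} (hv : IsT2 v W) (hv' : IsT2 v' W) {z : ℂ} (hz : z ∈ W)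
    {h : ℂ → Matrix (Fin 3) (Fin 3) ℂ} (hd : ∀ i j, DifferentiableAt ℂ (fun t => h t i j) z)
    (hdet : (h z).det ≠ 0)
    (hp : ∀ j, ∑ i, h z i j * pC v i z = (h z).det * pC v' j z)
    (hq : ∀ j, ∑ i, (deriv (fun t => h t i j) z * pC v i z + h z i j * qC v i z) =
      (h z).det * qC v' j z) {F : ℂ → Grassmann} (hF : DiffAt F z) :
    app v (fun t => gmap (h t) (F t)) z = gmap (h z) (app v' F z) := by
  rw [hv.app_eq hz (diffAt_gmap hd hF), hv'.app_eq hz hF]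
  have hL : ∀ j, DifferentiableAt ℂ (fun t => cL j (F t)) z := (diffAt_iff.1 hF).2.1
  have d1 : ∀ i, deriv (fun t => cL i (gmap (h t) (F t))) z =
      ∑ j, (deriv (fun t => h t i j) z * cL j (F z) +
        h z i j * deriv (fun t => cL j (F t)) z) := fun i => by
    simp only [cL_gmap]
    exact (HasDerivAt.fun_sum fun j _ => (hd i j).hasDerivAt.mul (hL j).hasDerivAt).deriv
  refine gext ?_ (fun l => ?_) (fun l => ?_) ?_
  · simp [body_gmap]
  · simp [cL_gmap]
  · simp only [cP_elt, cP_gmap, body_gmap]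
    simp only [← mul_assoc, ← Finset.sum_mul]
    congr 1
    -- After multiplication by the determinant, `hp` can be inserted; what remains is the adjugate
    -- identity for three by three matrices.
    refine mul_left_cancel₀ hdet ?_
    rw [Finset.mul_sum]
    have e : ∀ j, (h z).det * ((h z (l + 1) (j + 1) * h z (l + 2) (j + 2) -
        h z (l + 2) (j + 1) * h z (l + 1) (j + 2)) * pC v' j z) =
        (h z (l + 1) (j + 1) * h z (l + 2) (j + 2) -
        h z (l + 2) (j + 1) * h z (l + 1) (j + 2)) * ∑ i, h z i j * pC v i z := fun j => by
      rw [hp]; ring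
    rw [Finset.sum_congr rfl fun j _ => e j]
    simp only [Matrix.det_fin_three, Fin.sum_univ_three]
    fin_cases l <;> simp <;> ring
  · rw [cT_gmap, cT_elt, cT_elt, Finset.mul_sum]
    have e : ∀ j, (h z).det * (pC v' j z * deriv (fun t => cL j (F t)) z + qC v' j z * cL j (F z)) =
        (∑ i, h z i j * pC v i z) * deriv (fun t => cL j (F t)) z +
        (∑ i, (deriv (fun t => h t i j) z * pC v i z + h z i j * qC v i z)) * cL j (F z) :=
      fun j => by rw [hp, hq]; ring
    simp only [d1]
    simp only [e, cL_gmap, Fin.sum_univ_three]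
    ring

/-- `hD` says that the two matrix functions are one global automorphism of the underlying vector
bundle; `hp` and `hq` say that it carries one cocycle to the other exactly. -/
theorem glue_isomorphicOverId_of_linear {k : Fin 3 → ℤ} {v v' : EvenVF} (hv : IsT2 v {0}ᶜ)
    (hv' : IsT2 v' {0}ᶜ) (h h' : Fin 2 → ℂ → Matrix (Fin 3) (Fin 3) ℂ)
    (hd : ∀ a i j, Differentiable ℂ fun t => h a t i j)
    (hd' : ∀ a i j, Differentiable ℂ fun t => h' a t i j)
    (h1 : ∀ a t, h a t * h' a t = 1) (hD : ∀ x : ℂ, x ≠ 0 →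
      diagMatrix k x * h 1 x⁻¹ = h 0 x * diagMatrix k x)
    (hp : ∀ x : ℂ, x ≠ 0 → ∀ j, ∑ i, h 0 x i j * pC v i x = (h 0 x).det * pC v' j x)
    (hq : ∀ x : ℂ, x ≠ 0 → ∀ j, ∑ i, (deriv (fun t => h 0 t i j) x * pC v i x +
      h 0 x i j * qC v i x) = (h 0 x).det * qC v' j x) :
    (glue k v hv).IsomorphicOverId (glue k v' hv') := by
  refine LocalHom.isomorphicOverId (fun a => LocalHom.linear (h a) (hd a))
    (fun a => LocalHom.linear (h' a) (hd' a)) (fun a F z _ => ?_) (fun a F z _ => ?_)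
    fun F x hx hF => ?_
  · change gmap (h a z) (gmap (h' a z) (F z)) = _
    rw [gmap_mul, h1, gmap_one]
  · change gmap (h' a z) (gmap (h a z) (F z)) = _
    rw [gmap_mul, mul_eq_one_comm.1 (h1 a z), gmap_one]
  · have e : ∀ t, t ≠ 0 → subst (diagMatrix k) (fun z => gmap (h 1 z) (F z)) t =
        gmap (h 0 t) (subst (diagMatrix k) F t) := fun t ht => by
      change gmap _ (gmap _ _) = gmap _ (gmap _ _)
      rw [gmap_mul, gmap_mul, hD t ht]
    have hS : DiffAt (subst (diagMatrix k) F) x :=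
      (glue k 0 (isT2_zero _)).diffAt_subst hx hF.self_of_nhds
    have hdet : (h 0 x).det ≠ 0 := by
      have := congrArg Matrix.det (h1 0 x)
      rw [Matrix.det_mul, Matrix.det_one] at this
      exact left_ne_zero_of_mul_eq_one this
    change subst (diagMatrix k) (fun z => gmap (h 1 z) (F z)) x +
      app v (subst (diagMatrix k) fun z => gmap (h 1 z) (F z)) x =
      gmap (h 0 x) (subst (diagMatrix k) F x + app v' (subst (diagMatrix k) F) x)
    rw [map_add, e x hx, app_congr v ((eventually_ne_zero hx).mono e),
      app_gmap hv hv' hx (fun i j => hd 0 i j x) hdet (hp x hx) (hq x hx) hS]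

/-- Rescaling the odd coordinates. -/
theorem glue_isomorphicOverId_of_scale {k : Fin 3 → ℤ} {v v' : EvenVF} (hv : IsT2 v {0}ᶜ)
    (hv' : IsT2 v' {0}ᶜ) (t : Fin 3 → ℂ) (ht : ∀ i, t i ≠ 0)
    (hp : ∀ x : ℂ, x ≠ 0 → ∀ j, pC v j x = t (j + 1) * t (j + 2) * pC v' j x)
    (hq : ∀ x : ℂ, x ≠ 0 → ∀ j, qC v j x = t (j + 1) * t (j + 2) * qC v' j x) :
    (glue k v hv).IsomorphicOverId (glue k v' hv') := by
  refine glue_isomorphicOverId_of_linear hv hv' (fun _ _ => Matrix.diagonal t)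
    (fun _ _ => Matrix.diagonal fun i => (t i)⁻¹) (fun _ _ _ => differentiable_const _)
    (fun _ _ _ => differentiable_const _) (fun _ _ => ?_) (fun x _ => ?_) (fun x hx j => ?_)
    fun x hx j => ?_
  · rw [Matrix.diagonal_mul_diagonal]
    simp [ht]
  · rw [diagMatrix, Matrix.diagonal_mul_diagonal, Matrix.diagonal_mul_diagonal]
    simp only [mul_comm]
  · simp only [hp x hx]
    fin_cases j <;> simp [Matrix.diagonal_apply, Matrix.det_diagonal, Fin.prod_univ_three] <;> ring
  · simp only [hq x hx]
    fin_cases j <;> simp [Matrix.diagonal_apply, Matrix.det_diagonal, Fin.prod_univ_three] <;> ring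

end SuperCP1
end

noncomputable section

namespace SuperCP1

/-! ### The body of a section -/

section
variable {X : EvenVF} {W : Set ℂ}

theorem IsT2.body_app (hX : IsT2 X W) {z : ℂ} (hz : z ∈ W) (F : ℂ → Grassmann) :
    body (app X F z) = 0 := by
  rw [app, hX.eq_x hz]
  simp [hX.eq_ξ hz]

theorem IsT2.cL_app (hX : IsT2 X W) {z : ℂ} (hz : z ∈ W) (F : ℂ → Grassmann) (l : Fin 3) :
    cL l (app X F z) = 0 := by
  rw [app, hX.eq_x hz]
  simp [hX.eq_ξ hz, cL_mul]
end

theorem Supermanifold.body_trans (M : Supermanifold) (F : ℂ → Grassmann) {x : ℂ} (hx : x ≠ 0) :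
    body (M.trans F x) = body (F x⁻¹) := by
  rw [Supermanifold.trans, map_add, M.v_mem.body_app hx, add_zero, body_subst]

/-- The value at a point of the body of a section. -/
def Supermanifold.val (M : Supermanifold) {U : Opens (OnePoint ℂ)} (s : M.sections U)
    (p : OnePoint ℂ) : ℂ :=
  @OnePoint.rec ℂ (fun _ => ℂ) (body (s.1.ext 1 0)) (fun x => body (s.1.ext 0 x)) p

variable {M N : Supermanifold} {U V : Opens (OnePoint ℂ)}

theorem val_chart (s : M.sections U) {j : Fin 2} {z : ℂ} (hz : chart j z ∈ U) :
    M.val s (chart j z) = body (s.1.ext j z) := by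
  fin_cases j
  · rfl
  · change M.val s (chart 1 z) = body (s.1.ext 1 z)
    by_cases h : z = 0
    · subst h
      have : chart 1 0 = ∞ := by simp [chart]
      rw [this]; rfl
    · have e : chart 1 z = chart 0 z⁻¹ := by simp [chart, h]
      have h' : chart 0 z⁻¹ ∈ U := by rw [← e]; exact hz
      rw [e]
      change body (s.1.ext 0 z⁻¹) = _
      rw [s.2.2 _ (inv_ne_zero h) h', M.body_trans _ (inv_ne_zero h), inv_inv]

theorem exists_chart (p : OnePoint ℂ) : ∃ j z, chart j z = p := by
  induction p using OnePoint.rec with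
  | infty => exact ⟨1, 0, by simp [chart]⟩
  | coe x => exact ⟨0, x, rfl⟩

theorem ext_mul (s t : M.sections U) (j : Fin 2) (z : ℂ) :
    (s * t).1.ext j z = s.1.ext j z * t.1.ext j z := by
  change LocalPair.ext (s.1 * t.1) j z = _
  rw [LocalPair.ext_mul]; rfl

theorem ext_add (s t : M.sections U) (j : Fin 2) (z : ℂ) :
    (s + t).1.ext j z = s.1.ext j z + t.1.ext j z := by
  change LocalPair.ext (s.1 + t.1) j z = _
  rw [LocalPair.ext_add]; rfl

theorem ext_algebraMap (r : ℂ) {j : Fin 2} {z : ℂ} (hz : chart j z ∈ U) :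
    (algebraMap ℂ (M.sections U) r).1.ext j z = r • 1 := by
  rw [← Algebra.algebraMap_eq_smul_one]
  exact (LocalPair.ext_algebraMap hz r).eq_of_nhds

theorem ext_sub (s t : M.sections U) (j : Fin 2) (z : ℂ) :
    (s - t).1.ext j z = s.1.ext j z - t.1.ext j z := by
  rw [eq_sub_iff_add_eq, ← ext_add, sub_add_cancel]

theorem ext_one {j : Fin 2} {z : ℂ} (hz : chart j z ∈ U) :
    (1 : M.sections U).1.ext j z = 1 := by
  have := ext_algebraMap (M := M) 1 hz
  rwa [map_one, one_smul] at this

theorem ext_res (h : V ≤ U) (s : M.sections U) {j : Fin 2} {z : ℂ} (hz : chart j z ∈ V) :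
    (M.res h s).1.ext j z = s.1.ext j z :=
  (LocalPair.ext_restrict h s.1 hz).eq_of_nhds

theorem sections_ext {s t : M.sections U}
    (h : ∀ j z, chart j z ∈ U → s.1.ext j z = t.1.ext j z) : s = t := by
  refine Subtype.ext (funext fun j => funext fun z => ?_)
  have := h j z z.2
  rwa [LocalPair.ext, LocalPair.ext, dif_pos z.2, dif_pos z.2] at this

section
variable {p : OnePoint ℂ}

theorem val_mul (hp : p ∈ U) (s t : M.sections U) : M.val (s * t) p = M.val s p * M.val t p := by
  obtain ⟨j, z, rfl⟩ := exists_chart p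
  rw [val_chart _ hp, val_chart _ hp, val_chart _ hp, ext_mul, map_mul]

theorem val_sub (hp : p ∈ U) (s t : M.sections U) : M.val (s - t) p = M.val s p - M.val t p := by
  obtain ⟨j, z, rfl⟩ := exists_chart p
  rw [val_chart _ hp, val_chart _ hp, val_chart _ hp, ext_sub, map_sub]

theorem val_algebraMap (hp : p ∈ U) (r : ℂ) : M.val (algebraMap ℂ (M.sections U) r) p = r := by
  obtain ⟨j, z, rfl⟩ := exists_chart p
  rw [val_chart _ hp, ext_algebraMap r hp, map_smul, map_one, smul_eq_mul, mul_one]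

theorem val_res (hp : p ∈ U) (h : U ≤ V) (s : M.sections V) : M.val (M.res h s) p = M.val s p := by
  obtain ⟨j, z, rfl⟩ := exists_chart p
  rw [val_chart _ hp, val_chart _ (h hp), ext_res h s hp]
end

/-- At infinity compactness of the complement is required: a ball of radius `ε` in the chart `y`
confines the complement to a ball of radius `ε⁻¹` in the chart `x`. -/
theorem isOpen_of_chart {s : Set (OnePoint ℂ)} (h : ∀ j, IsOpen (chart j ⁻¹' s)) : IsOpen s := by
  rw [OnePoint.isOpen_def]
  refine ⟨fun hs => ?_, h 0⟩
  have h0 : (0 : ℂ) ∈ chart 1 ⁻¹' s := by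
    simpa [chart] using hs
  obtain ⟨ε, hε, hb⟩ := Metric.isOpen_iff.1 (h 1) 0 h0
  refine Metric.isCompact_of_isClosed_isBounded (h 0).isClosed_compl ?_
  refine (Metric.isBounded_closedBall (x := (0 : ℂ)) (r := ε⁻¹)).subset fun x hx => ?_
  by_contra hx'
  rw [mem_closedBall_zero_iff, not_le] at hx'
  have hx0 : x ≠ 0 := by
    rintro rfl
    rw [norm_zero] at hx'
    exact absurd hx' (not_lt.2 (inv_nonneg.2 hε.le))
  refine hx ?_
  have h1 : x⁻¹ ∈ Metric.ball (0 : ℂ) ε := by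
    rw [mem_ball_zero_iff, norm_inv]
    exact inv_lt_of_inv_lt₀ hε hx'
  have := hb h1
  rw [Set.mem_preimage, chart_one_inv hx0] at this
  exact this

theorem isOpen_val_ne_zero (s : M.sections U) : IsOpen {p | p ∈ U ∧ M.val s p ≠ 0} := by
  refine isOpen_of_chart fun j => ?_
  rw [isOpen_iff_mem_nhds]
  rintro z ⟨hz, hne⟩
  rw [val_chart s hz] at hne
  have hc : ContinuousAt (fun t => body (s.1.ext j t)) z :=
    (diffAt_iff.1 (s.2.1 j z hz)).1.continuousAt
  filter_upwards [eventually_mem hz, hc.eventually_ne hne] with t ht ht'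
  exact ⟨ht, by rwa [val_chart s ht]⟩

/-- The inverse of an element with nonzero body. -/
def ginv (a : Grassmann) : Grassmann :=
  -- The geometric series `1/b - n/b² + n²/b³` for body `b` and nilpotent part `n`. The square of
  -- `n` consists of twice the pairing of its linear and quadratic parts.
  elt (body a)⁻¹ (fun i => -cL i a / body a ^ 2) (fun i => -cP i a / body a ^ 2)
    (-cT a / body a ^ 2 + 2 * (∑ i, cL i a * cP i a) / body a ^ 3)

theorem mul_ginv {a : Grassmann} (h : body a ≠ 0) : a * ginv a = 1 := by
  refine gext ?_ (fun i => ?_) (fun i => ?_) ?_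
  · simp [ginv, h]
  · simp [ginv, cL_mul]; field_simp; ring
  · simp [ginv, cP_mul]; field_simp; ring
  · simp [ginv, cT_mul, Fin.sum_univ_three]; field_simp; ring

theorem ginv_mul {a : Grassmann} (h : body a ≠ 0) : ginv a * a = 1 := by
  refine gext ?_ (fun i => ?_) (fun i => ?_) ?_
  · simp [ginv, h]
  · simp [ginv, cL_mul]; field_simp; ring
  · simp [ginv, cP_mul]; field_simp; ring
  · simp [ginv, cT_mul, Fin.sum_univ_three]; field_simp; ring

theorem diffAt_ginv {F : ℂ → Grassmann} {z : ℂ} (hF : DiffAt F z) (h : body (F z) ≠ 0) :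
    DiffAt (fun t => ginv (F t)) z := by
  rw [diffAt_iff] at *
  obtain ⟨h0, h1, h2, h3⟩ := hF
  simp only [ginv, body_elt, cL_elt, cP_elt, cT_elt]
  have e2 := pow_ne_zero 2 h
  have e3 := pow_ne_zero 3 h
  refine ⟨h0.inv h, fun i => (h1 i).neg.div (h0.pow 2) e2, fun i => (h2 i).neg.div (h0.pow 2) e2,
    (h3.neg.div (h0.pow 2) e2).add (DifferentiableAt.div ?_ (h0.pow 3) e3)⟩
  exact (DifferentiableAt.fun_sum fun i _ => (h1 i).mul (h2 i)).const_mul 2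

theorem isUnit_iff_val (s : M.sections U) : IsUnit s ↔ ∀ p ∈ U, M.val s p ≠ 0 := by
  constructor
  · rintro ⟨u, rfl⟩ p hp h0
    have := val_mul hp (u : M.sections U) (u⁻¹ : (M.sections U)ˣ)
    rw [Units.mul_inv, h0, zero_mul, ← map_one (algebraMap ℂ (M.sections U)),
      val_algebraMap hp] at this
    exact one_ne_zero this
  · intro h
    have hb : ∀ j z, chart j z ∈ U → body (s.1.ext j z) ≠ 0 := fun j z hz => by
      rw [← val_chart s hz]
      exact h _ hz
    have e : ∀ j z, chart j z ∈ U →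
        LocalPair.ext (U := U) (fun j z => ginv (s.1.ext j z)) j =ᶠ[nhds z]
          fun t => ginv (s.1.ext j t) := fun j z hz => by
      filter_upwards [eventually_mem hz] with t ht
      rw [LocalPair.ext, dif_pos ht]
    let t : M.sections U := ⟨fun j z => ginv (s.1.ext j z), by
      refine ⟨fun j z hz => (diffAt_ginv (s.2.1 j z hz) (hb j z hz)).congr (e j z hz),
        fun x hx hU => ?_⟩
      have hU' : chart 1 x⁻¹ ∈ U := by rwa [chart_one_inv hx]
      rw [(e 0 x hU).eq_of_nhds, M.trans_congr hx (e 1 _ hU')]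
      have h1 : M.trans (s.1.ext 1) x * M.trans (fun t => ginv (s.1.ext 1 t)) x = 1 := by
        rw [← M.trans_mul hx (s.2.1 1 _ hU') (diffAt_ginv (s.2.1 1 _ hU') (hb 1 _ hU'))]
        have : (s.1.ext 1 * fun t => ginv (s.1.ext 1 t)) =ᶠ[nhds x⁻¹]
            fun _ => algebraMap ℂ Grassmann 1 := by
          filter_upwards [eventually_mem hU'] with t ht
          rw [Pi.mul_apply, mul_ginv (hb 1 t ht), map_one]
        rw [M.trans_congr hx this, M.trans_const, map_one]
      rw [← s.2.2 x hx hU] at h1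
      calc ginv (s.1.ext 0 x) = ginv (s.1.ext 0 x) * (s.1.ext 0 x * _) := by rw [h1, mul_one]
        _ = _ := by rw [← mul_assoc, ginv_mul (hb 0 x hU), one_mul]⟩
    have ht : ∀ j z, chart j z ∈ U → t.1.ext j z = ginv (s.1.ext j z) := fun j z hz =>
      (e j z hz).eq_of_nhds
    refine isUnit_iff_exists.2 ⟨t, sections_ext fun j z hz => ?_, sections_ext fun j z hz => ?_⟩
    · rw [ext_mul, ht j z hz, mul_ginv (hb j z hz), ext_one hz]
    · rw [ext_mul, ht j z hz, ginv_mul (hb j z hz), ext_one hz]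

/-! ### Isomorphisms in a symmetric form -/

/-- A homeomorphism of the underlying spaces together with an isomorphism of the sheaves of
algebras. -/
structure PreIso (M N : Supermanifold) where
  base : OnePoint ℂ ≃ₜ OnePoint ℂ
  pull : ∀ U V : Opens (OnePoint ℂ), (∀ p, p ∈ V ↔ base p ∈ U) → N.sections U ≃ₐ[ℂ] M.sections V
  pull_res : ∀ U V h U' V' h' (hU : U' ≤ U) (hV : V' ≤ V) (s : N.sections U),
    M.res hV (pull U V h s) = pull U' V' h' (N.res hU s)

/-- The inverse isomorphism. -/
def PreIso.symm (φ : PreIso M N) : PreIso N M where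
  base := φ.base.symm
  pull U V h := (φ.pull V U fun p => by rw [h, Homeomorph.symm_apply_apply]).symm
  pull_res U V h U' V' h' hU hV s := by
    rw [AlgEquiv.eq_symm_apply, ← φ.pull_res V U (fun p => by
      rw [h, Homeomorph.symm_apply_apply]) V' U' _ hV hU, AlgEquiv.apply_symm_apply]

/-- Admitting every open set with the points of the preimage gives a notion that can be inverted
without transport along equalities of open sets. Parity is forgotten; the obstructions below do not
need it. -/
theorem exists_preIso (φ : Supermanifold.Iso M N) : ∃ ψ : PreIso M N, ψ.base = φ.base ∧
    ∀ U h, ψ.pull U (Opens.comap (φ.base : C(OnePoint ℂ, OnePoint ℂ)) U) h = φ.pull U := by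
  have key : ∀ U V : Opens (OnePoint ℂ), (∀ p, p ∈ V ↔ φ.base p ∈ U) →
      V = Opens.comap (φ.base : C(OnePoint ℂ, OnePoint ℂ)) U := fun U V h => Opens.ext (Set.ext h)
  refine ⟨⟨φ.base, fun U V h => key U V h ▸ φ.pull U, ?_⟩, rfl, fun U _ => rfl⟩
  intro U V h U' V' h' hU hV s
  obtain rfl := key U V h
  obtain rfl := key U' V' h'
  exact φ.pull_res U U' hU s

/-- Values are determined algebraically: a section is invertible exactly where its value is nonzero.
If the pulled back section had another value at `p`, then `s - c` would become invertible near `p`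
after pulling back, although it has value zero at the image point. -/
theorem PreIso.val_pull (φ : PreIso M N) (h : ∀ p, p ∈ V ↔ φ.base p ∈ U) (s : N.sections U)
    {p : OnePoint ℂ} (hp : p ∈ V) : M.val (φ.pull U V h s) p = N.val s (φ.base p) := by
  by_contra hne
  set c := N.val s (φ.base p) with hc
  have hU := (h p).1 hp
  set t := φ.pull U V h (s - algebraMap ℂ _ c) with ht
  have htp : M.val t p ≠ 0 := by
    rw [ht, map_sub, AlgEquiv.commutes, val_sub hp, val_algebraMap hp, sub_ne_zero]
    exact hne
  let V' : Opens (OnePoint ℂ) := ⟨{p | p ∈ V ∧ M.val t p ≠ 0}, isOpen_val_ne_zero t⟩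
  let U' : Opens (OnePoint ℂ) := ⟨φ.base.symm ⁻¹' V', V'.isOpen.preimage φ.base.symm.continuous⟩
  have hV' : V' ≤ V := fun q hq => hq.1
  have h' : ∀ p, p ∈ V' ↔ φ.base p ∈ U' := fun p => by
    change _ ↔ φ.base.symm (φ.base p) ∈ V'
    rw [Homeomorph.symm_apply_apply]
  have hU' : U' ≤ U := fun q hq => by
    have := (h _).1 (hV' hq)
    rwa [Homeomorph.apply_symm_apply] at this
  have hu : IsUnit (M.res hV' t) := (isUnit_iff_val _).2 fun q hq => by
    rw [val_res hq]
    exact hq.2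
  rw [ht, φ.pull_res U V h U' V' h' hU' hV'] at hu
  have hu' : IsUnit (N.res hU' (s - algebraMap ℂ _ c)) := by
    have := hu.map (φ.pull U' V' h').symm
    rwa [AlgEquiv.symm_apply_apply] at this
  have hpU' : φ.base p ∈ U' := (h' p).1 ⟨hp, htp⟩
  refine (isUnit_iff_val _).1 hu' _ hpU' ?_
  rw [val_res hpU', val_sub hU, val_algebraMap hU, ← hc, sub_self]

end SuperCP1
end

noncomputable section

namespace SuperCP1

/-! ### Sections over the domains of the charts -/

/-- The domain of a chart. -/
def chartOpen (i : Fin 2) : Opens (OnePoint ℂ) := ⟨{p | p ≠ chart (1 - i) 0}, isOpen_ne⟩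

theorem chart_mem_chartOpen (i : Fin 2) (z : ℂ) : chart i z ∈ chartOpen i := by
  change chart i z ≠ chart (1 - i) 0
  fin_cases i
  · simp [chart]
  · by_cases h : z = 0 <;> simp [chart, h]

theorem chart_zero_mem {x : ℂ} : chart 0 x ∈ chartOpen 1 ↔ x ≠ 0 := by
  change chart 0 x ≠ chart (1 - 1) 0 ↔ _
  simp [chart]

theorem chart_one_mem {y : ℂ} : chart 1 y ∈ chartOpen 0 ↔ y ≠ 0 := by
  change chart 1 y ≠ chart (1 - 0) 0 ↔ _
  by_cases h : y = 0 <;> simp [chart, h]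

theorem mem_chartOpen (p : OnePoint ℂ) : ∃ i, p ∈ chartOpen i := by
  obtain ⟨i, z, rfl⟩ := exists_chart p
  exact ⟨i, chart_mem_chartOpen i z⟩

theorem exists_chart_of_mem {i : Fin 2} {p : OnePoint ℂ} (h : p ∈ chartOpen i) :
    ∃ z, chart i z = p := by
  obtain ⟨j, z, rfl⟩ := exists_chart p
  fin_cases i <;> fin_cases j
  · exact ⟨z, rfl⟩
  · have hz := chart_one_mem.1 h
    refine ⟨z⁻¹, ?_⟩
    have := chart_one_inv (inv_ne_zero hz)
    rw [inv_inv] at this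
    exact this.symm
  · exact ⟨z⁻¹, chart_one_inv (chart_zero_mem.1 h)⟩
  · exact ⟨z, rfl⟩

section
variable {k : Fin 3 → ℤ} {v : EvenVF} {hv : IsT2 v {0}ᶜ} {U : Opens (OnePoint ℂ)}

theorem subst_subst (k : Fin 3 → ℤ) (F : ℂ → Grassmann) {x : ℂ} (hx : x ≠ 0) :
    subst (diagMatrix k) (subst (diagMatrix k) F) x = F x := by
  change gmap _ (gmap _ _) = _
  rw [gmap_mul, inv_inv, diagMatrix, diagMatrix, Matrix.diagonal_mul_diagonal]
  have : (fun i => x ^ (-k i) * x⁻¹ ^ (-k i)) = 1 := by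
    funext i
    rw [inv_zpow, mul_inv_cancel₀ (zpow_ne_zero _ hx)]
    rfl
  rw [this, Matrix.diagonal_one', gmap_one]

/-- Inside the domain of one chart a section may be prescribed in that chart alone, because the
transition is invertible. -/
theorem exists_section (i : Fin 2) (hU : U ≤ chartOpen i) {F : ℂ → Grassmann}
    (hF : ∀ z, chart i z ∈ U → DiffAt F z) :
    ∃ s : (glue k v hv).sections U, ∀ z, chart i z ∈ U → s.1.ext i z = F z := by
  let M := glue k v hv
  have ext_eq : ∀ (f : LocalPair U) (G : ℂ → Grassmann) j z, chart j z ∈ U →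
      (∀ (t) (h : chart j t ∈ U), f j ⟨t, h⟩ = G t) → f.ext j =ᶠ[nhds z] G := fun f G j z hz h => by
    filter_upwards [eventually_mem hz] with t ht
    rw [LocalPair.ext, dif_pos ht, h]
  fin_cases i
  -- The inverse of the transition: undo `id + v` by `id - v`, then apply `subst`, which is its own
  -- inverse by `subst_subst`.
  · let G : ℂ → Grassmann := F + (-1 : ℂ) • app v F
    let f : LocalPair U := fun j z => if j = 0 then F z else subst (diagMatrix k) G z
    have hne : ∀ {z}, chart 1 z ∈ U → z ≠ 0 := fun h => chart_one_mem.1 (hU h)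
    have h1 : ∀ {z}, chart 1 z ∈ U → chart 0 z⁻¹ ∈ U := fun {z} h => by
      have := chart_one_inv (inv_ne_zero (hne h))
      rw [inv_inv] at this
      rwa [← this]
    have hFe : ∀ {z}, chart 0 z ∈ U → ∀ᶠ t in nhds z, DiffAt F t := fun h =>
      (eventually_mem h).mono fun t ht => hF t ht
    have hG : ∀ {x}, x ≠ 0 → chart 0 x ∈ U → DiffAt G x := fun hx h =>
      (hF _ h).add (hasD_const_smul _ (hv.diffAt_app isOpen_punctured hx (hFe h))).diffAt
    refine ⟨⟨f, fun j z hz => ?_, fun x hx hxU => ?_⟩, fun z hz => ?_⟩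
    · fin_cases j
      · exact (hF z hz).congr (ext_eq f F 0 z hz fun t ht => rfl)
      · exact (M.diffAt_subst (hne hz) (hG (inv_ne_zero (hne hz)) (h1 hz))).congr
          (ext_eq f _ 1 z hz fun t ht => rfl)
    · have hxU' : chart 1 x⁻¹ ∈ U := by rwa [chart_one_inv hx]
      rw [(ext_eq f F 0 x hxU fun t ht => rfl).eq_of_nhds,
        M.trans_congr hx (ext_eq f (subst (diagMatrix k) G) 1 x⁻¹ hxU' fun t ht => rfl)]
      have e : subst (diagMatrix k) (subst (diagMatrix k) G) =ᶠ[nhds x] G := by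
        filter_upwards [eventually_ne_zero hx] with t ht using subst_subst k G ht
      change F x = subst (diagMatrix k) (subst (diagMatrix k) G) x +
        app v (subst (diagMatrix k) (subst (diagMatrix k) G)) x
      have hd := hv.diffAt_app isOpen_punctured hx (hFe hxU)
      rw [e.eq_of_nhds, app_congr v e, app_add_right v (hF x hxU) (hasD_const_smul _ hd).diffAt,
        app_smul_right v _ hd, hv.app_app isOpen_punctured hv hx (hFe hxU)]
      simp [G]
    · exact (ext_eq f F 0 z hz fun t ht => rfl).eq_of_nhds
  · let f : LocalPair U := fun j z => if j = 0 then M.trans F z else F z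
    have hne : ∀ {z}, chart 0 z ∈ U → z ≠ 0 := fun h => chart_zero_mem.1 (hU h)
    have h1 : ∀ {z}, chart 0 z ∈ U → chart 1 z⁻¹ ∈ U := fun {z} h => by
      rwa [chart_one_inv (hne h)]
    have hFe : ∀ {z}, chart 1 z ∈ U → ∀ᶠ t in nhds z, DiffAt F t := fun h =>
      (eventually_mem h).mono fun t ht => hF t ht
    refine ⟨⟨f, fun j z hz => ?_, fun x hx hxU => ?_⟩, fun z hz => ?_⟩
    · fin_cases j
      · exact (M.diffAt_trans (hne hz) (hFe (h1 hz))).congr (ext_eq f _ 0 z hz fun t ht => rfl)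
      · exact (hF z hz).congr (ext_eq f F 1 z hz fun t ht => rfl)
    · rw [(ext_eq f (M.trans F) 0 x hxU fun t ht => rfl).eq_of_nhds]
      exact (M.trans_congr hx (ext_eq f F 1 x⁻¹ (h1 hxU) fun t ht => rfl)).symm
    · exact (ext_eq f F 1 z hz fun t ht => rfl).eq_of_nhds

/-- Applying `v` once more to the vanishing expression kills the second-order term. So the field
annihilates the substituted function, and then this function vanishes itself. -/
theorem trans_injective {F : ℂ → Grassmann} {x : ℂ} (hx : x ≠ 0)
    (hF : ∀ᶠ t in nhds x⁻¹, DiffAt F t) (h : ∀ᶠ t in nhds x, (glue k v hv).trans F t = 0) :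
    F x⁻¹ = 0 := by
  have hS : ∀ᶠ t in nhds x, DiffAt (subst (diagMatrix k) F) t := by
    filter_upwards [(continuousAt_inv₀ hx).tendsto.eventually hF, eventually_ne_zero hx] with
      t ht ht' using (glue k v hv).diffAt_subst ht' ht
  have h0 : (glue k v hv).trans F =ᶠ[nhds x] fun _ => algebraMap ℂ Grassmann 0 := by
    filter_upwards [h] with t ht
    rw [ht, map_zero]
  have h1 : app v (subst (diagMatrix k) F) x = 0 := by
    have h2 := app_congr v h0
    rw [app.eq_def v (fun _ => algebraMap ℂ Grassmann 0), (hasD_const _ x).dX_eq] at h2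
    simp only [dXi_algebraMap, mul_zero, Finset.sum_const_zero, add_zero] at h2
    rw [← h2]
    change _ = app v (subst (diagMatrix k) F + app v (subst (diagMatrix k) F)) x
    rw [app_add_right v hS.self_of_nhds (hv.diffAt_app isOpen_punctured hx hS),
      hv.app_app isOpen_punctured hv hx hS, add_zero]
  have h2 : subst (diagMatrix k) F x = 0 := by
    have := h.self_of_nhds
    change subst (diagMatrix k) F x + app v (subst (diagMatrix k) F) x = 0 at this
    rwa [h1, add_zero] at this
  rw [← subst_subst k F (inv_ne_zero hx)]
  change gmap _ (subst (diagMatrix k) F x⁻¹⁻¹) = _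
  rw [inv_inv, h2, map_zero]

theorem sections_ext_of_chart (i : Fin 2) (hU : U ≤ chartOpen i)
    {s t : (glue k v hv).sections U} (h : ∀ z, chart i z ∈ U → s.1.ext i z = t.1.ext i z) :
    s = t := by
  rw [← sub_eq_zero]
  set d := s - t with hd
  have h : ∀ z, chart i z ∈ U → d.1.ext i z = 0 := fun z hz => by rw [hd, ext_sub, h z hz, sub_self]
  refine sections_ext fun j z hz => ?_
  have hz0 : (0 : (glue k v hv).sections U).1.ext j z = 0 := by
    have := ext_algebraMap (M := glue k v hv) 0 hz
    rwa [map_zero, zero_smul] at this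
  rw [hz0]
  fin_cases i <;> fin_cases j
  · exact h z hz
  · have hne := chart_one_mem.1 (hU hz)
    have hz' : chart 0 z⁻¹ ∈ U := by
      have := chart_one_inv (inv_ne_zero hne)
      rw [inv_inv] at this
      rwa [← this]
    have := trans_injective (k := k) (v := v) (hv := hv) (F := d.1.ext 1) (inv_ne_zero hne) (by
      rw [inv_inv]
      exact LocalHom.eventually_diffAt d hz) (by
      filter_upwards [eventually_mem hz', eventually_ne_zero (inv_ne_zero hne)] with t ht ht'
      rw [← d.2.2 t ht' ht]
      exact h t ht)
    rwa [inv_inv] at this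
  · have hne := chart_zero_mem.1 (hU hz)
    have hz' : chart 1 z⁻¹ ∈ U := by rwa [chart_one_inv hne]
    change d.1.ext 0 z = 0
    rw [d.2.2 z hne hz]
    have : d.1.ext 1 =ᶠ[nhds z⁻¹] fun _ => algebraMap ℂ Grassmann 0 := by
      filter_upwards [eventually_mem hz'] with t ht
      rw [map_zero]
      exact h t ht
    rw [(glue k v hv).trans_congr hne this, (glue k v hv).trans_const, map_zero]
  · exact h z hz
end

end SuperCP1
end

noncomputable section

namespace SuperCP1

/-! ### The transition in coordinates -/

section
variable {k : Fin 3 → ℤ} {v : EvenVF} {hv : IsT2 v {0}ᶜ} {F : ℂ → Grassmann} {x : ℂ}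

theorem cL_trans_glue (hx : x ≠ 0) (l : Fin 3) :
    cL l ((glue k v hv).trans F x) = x ^ (-k l) * cL l (F x⁻¹) := by
  change cL l (subst (diagMatrix k) F x + app v (subst (diagMatrix k) F) x) = _
  rw [map_add, hv.cL_app hx, add_zero, cL_subst]

theorem cP_trans_glue (hx : x ≠ 0) (hF : DiffAt F x⁻¹) (l : Fin 3) :
    cP l ((glue k v hv).trans F x) =
      x ^ (-wt k l) * cP l (F x⁻¹) + pC v l x * deriv (fun t => body (F t⁻¹)) x := by
  have hS : DiffAt (subst (diagMatrix k) F) x := (glue k v hv).diffAt_subst hx hF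
  change cP l (subst (diagMatrix k) F x + app v (subst (diagMatrix k) F) x) = _
  rw [map_add, hv.app_eq hx hS, cP_subst _ _ _ _ hx, cP_elt]
  simp only [body_subst]

theorem cT_trans_glue (hx : x ≠ 0) (hF : DiffAt F x⁻¹) :
    cT ((glue k v hv).trans F x) = x ^ (-(k 0 + k 1 + k 2)) * cT (F x⁻¹) +
      ∑ l, (pC v l x * deriv (fun t => t ^ (-k l) * cL l (F t⁻¹)) x +
        qC v l x * (x ^ (-k l) * cL l (F x⁻¹))) := by
  have hS : DiffAt (subst (diagMatrix k) F) x := (glue k v hv).diffAt_subst hx hF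
  change cT (subst (diagMatrix k) F x + app v (subst (diagMatrix k) F) x) = _
  rw [map_add, hv.app_eq hx hS, cT_subst _ _ _ hx, cT_elt]
  simp only [cL_subst]
end

/-! ### An obstruction to isomorphisms -/

/-- The projection to the body and `e` times the `ω 2` component. -/
def proj (e : ℂ) (a : Grassmann) : Grassmann :=
  elt (body a) 0 (fun l => if l = 2 then e * cP 2 a else 0) 0

theorem diffAt_proj (e : ℂ) {F : ℂ → Grassmann} {z : ℂ} (hF : DiffAt F z) :
    DiffAt (fun t => proj e (F t)) z := by
  rw [diffAt_iff] at *
  simp only [proj, body_elt, cL_elt, cP_elt, cT_elt]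
  refine ⟨hF.1, fun _ => differentiableAt_const _, fun l => ?_, differentiableAt_const _⟩
  split_ifs
  · exact (hF.2.2.1 2).const_mul e
  · exact differentiableAt_const _

/-- The transition of `N` commutes with the projection. -/
def ProjCompat (e : ℂ) (N : Supermanifold) : Prop :=
  ∀ (F : ℂ → Grassmann) (x : ℂ), x ≠ 0 → DiffAt F x⁻¹ →
    N.trans (fun t => proj e (F t)) x = proj e (N.trans F x)

theorem projCompat_zero (N : Supermanifold) (h : ∀ l x, x ≠ 0 → pC N.v l x = 0) :
    ProjCompat 0 N := by
  intro F x hx hF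
  have hS := N.diffAt_subst hx (diffAt_proj 0 hF)
  have e : ∀ t, cL t (subst N.g (fun t => proj 0 (F t)) x) = 0 := fun t => by
    simp [subst, cL_gmap, proj]
  rw [Supermanifold.trans, N.v_mem.app_eq hx hS]
  refine gext ?_ (fun l => ?_) (fun l => ?_) ?_
  · simp [proj, N.body_trans F hx, body_subst]
  · rw [map_add, e]
    simp [proj]
  · simp [proj, h _ x hx, subst, cP_gmap]
  · simp only [map_add, cT_elt, e]
    simp [proj, h _ x hx, subst, cT_gmap]

theorem projCompat_one {k : Fin 3 → ℤ} {v : EvenVF} (hv : IsT2 v {0}ᶜ)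
    (h0 : ∀ x, x ≠ 0 → pC v 0 x = 0) (h1 : ∀ x, x ≠ 0 → pC v 1 x = 0) :
    ProjCompat 1 (glue k v hv) := by
  intro F x hx hF
  have hF' := diffAt_proj 1 hF
  refine gext ?_ (fun l => ?_) (fun l => ?_) ?_
  · rw [Supermanifold.body_trans _ _ hx]
    simp [proj, Supermanifold.body_trans _ _ hx]
  · rw [cL_trans_glue hx]
    simp [proj]
  · rw [cP_trans_glue hx hF', proj, proj, cP_elt, cP_elt, cP_trans_glue hx hF]
    simp only [proj, body_elt]
    fin_cases l
    · simp [h0 x hx]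
    · simp [h1 x hx]
    · simp
  · rw [cT_trans_glue hx hF']
    simp [proj]

theorem ProjCompat.exists_section {e : ℂ} {N : Supermanifold} (hN : ProjCompat e N)
    {U : Opens (OnePoint ℂ)} (s : N.sections U) :
    ∃ s' : N.sections U, ∀ j z, chart j z ∈ U → s'.1.ext j z = proj e (s.1.ext j z) := by
  let f : LocalPair U := fun j z => proj e (s.1.ext j z)
  have h : ∀ j z, chart j z ∈ U → f.ext j =ᶠ[nhds z] fun t => proj e (s.1.ext j t) :=
    fun j z hz => by
      filter_upwards [eventually_mem hz] with t ht
      rw [LocalPair.ext, dif_pos ht]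
  refine ⟨⟨f, fun j z hz => (diffAt_proj e (s.2.1 j z hz)).congr (h j z hz), fun x hx hU => ?_⟩,
    fun j z hz => (h j z hz).eq_of_nhds⟩
  have hU' : chart 1 x⁻¹ ∈ U := by rwa [chart_one_inv hx]
  rw [(h 0 x hU).eq_of_nhds, N.trans_congr hx (h 1 _ hU'), hN _ _ hx (s.2.1 1 _ hU'),
    ← s.2.2 x hx hU]

theorem diffAt_smul_one (z : ℂ) : DiffAt (fun z : ℂ => z • (1 : Grassmann)) z :=
  (HasD.smul (hasDerivAt_id z) (hasD_const 1 z)).diffAt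

/-- The coordinates `x` and `y` of the source are moved to `N`, projected there, and pulled back to
functions `X` and `Y` with bodies `x` and `y`. The product `XY - 1` is negligible by `hL`, so `Y` is
the inverse of `X` in the components of `L`. Comparing this with the transition of `Y` solves the
`p` part of the coboundary equation, with the `ω l` coefficients of `X` and `Y` as primitives. -/
theorem PreIso.exists_splitting {k : Fin 3 → ℤ} {v : EvenVF} {hv : IsT2 v {0}ᶜ} {N : Supermanifold}
    (φ : PreIso (glue k v hv) N) {e : ℂ} (hN : ProjCompat e N) (L : Set (Fin 3))
    (hL : ∀ (U V : Opens (OnePoint ℂ)) (h : ∀ p, p ∈ V ↔ φ.base p ∈ U) (s : N.sections U),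
      (∀ j z, chart j z ∈ U → ∃ c, s.1.ext j z = elt 0 0 (fun l => if l = 2 then e * c else 0) 0) →
      ∀ x, V ≤ chartOpen 0 → chart 0 x ∈ V → (∀ l, cL l ((φ.pull U V h s).1.ext 0 x) = 0) ∧
        ∀ l ∈ L, cP l ((φ.pull U V h s).1.ext 0 x) = 0) (l : Fin 3) (hl : l ∈ L) :
    ∃ a₀ a₁ : ℂ → ℂ, Differentiable ℂ a₀ ∧ Differentiable ℂ a₁ ∧ ∀ x : ℂ, x ≠ 0 →
      pC v l x = a₀ x + x ^ (2 - wt k l) * a₁ x⁻¹ := by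
  let W : Opens (OnePoint ℂ) → Opens (OnePoint ℂ) := fun V =>
    ⟨φ.base.symm ⁻¹' V, V.isOpen.preimage φ.base.symm.continuous⟩
  have hW : ∀ V p, p ∈ V ↔ φ.base p ∈ W V := fun V p => by
    change _ ↔ φ.base.symm (φ.base p) ∈ V
    rw [Homeomorph.symm_apply_apply]
  have key : ∀ i : Fin 2, ∃ (s' : N.sections (W (chartOpen i))),
      (∀ j z, chart j z ∈ W (chartOpen i) → ∃ b c, s'.1.ext j z =
        elt b 0 (fun l => if l = 2 then e * c else 0) 0) ∧
      ∀ z, N.val s' (φ.base (chart i z)) = z := by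
    intro i
    obtain ⟨X, hX⟩ := exists_section (hv := hv) (k := k) i le_rfl (F := fun z => z • 1)
      fun z _ => diffAt_smul_one z
    set S := (φ.pull (W (chartOpen i)) (chartOpen i) (hW _)).symm X with hS
    obtain ⟨S', hS'⟩ := hN.exists_section S
    refine ⟨S', fun j z hz => ⟨_, _, hS' j z hz⟩, fun z => ?_⟩
    have hz := chart_mem_chartOpen i z
    have h1 : N.val S' (φ.base (chart i z)) = N.val S (φ.base (chart i z)) := by
      obtain ⟨j, w, hw⟩ := exists_chart (φ.base (chart i z))
      have hw' : chart j w ∈ W (chartOpen i) := by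
        rw [hw]; exact (hW _ _).1 hz
      rw [← hw, val_chart _ hw', val_chart _ hw', hS' j w hw', proj, body_elt]
    rw [h1, ← φ.val_pull (hW _) S hz, hS, AlgEquiv.apply_symm_apply, val_chart _ hz, hX z hz]
    simp
  obtain ⟨S, hS, hSv⟩ := key 0
  obtain ⟨R, hR, hRv⟩ := key 1
  set X := φ.pull _ _ (hW _) S with hX
  set Y := φ.pull _ _ (hW _) R with hY
  have hXb : ∀ z, body (X.1.ext 0 z) = z := fun z => by
    rw [← val_chart X (chart_mem_chartOpen 0 z), hX, φ.val_pull _ _ (chart_mem_chartOpen 0 z), hSv]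
  have hYb : ∀ z, body (Y.1.ext 1 z) = z := fun z => by
    rw [← val_chart Y (chart_mem_chartOpen 1 z), hY, φ.val_pull _ _ (chart_mem_chartOpen 1 z), hRv]
  have hXd : ∀ z, DiffAt (X.1.ext 0) z := fun z => X.2.1 0 z (chart_mem_chartOpen 0 z)
  have hYd : ∀ z, DiffAt (Y.1.ext 1) z := fun z => Y.2.1 1 z (chart_mem_chartOpen 1 z)
  refine ⟨fun x => cP l (X.1.ext 0 x), fun y => cP l (Y.1.ext 1 y),
    fun x => (diffAt_iff.1 (hXd x)).2.2.1 l, fun y => (diffAt_iff.1 (hYd y)).2.2.1 l,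
    fun x hx => ?_⟩
  let V := chartOpen 0 ⊓ chartOpen 1
  have hV0 : V ≤ chartOpen 0 := inf_le_left
  have hV1 : V ≤ chartOpen 1 := inf_le_right
  have hW0 : W V ≤ W (chartOpen 0) := fun p hp => hV0 hp
  have hW1 : W V ≤ W (chartOpen 1) := fun p hp => hV1 hp
  have hxV : chart 0 x ∈ V := ⟨chart_mem_chartOpen 0 x, chart_zero_mem.2 hx⟩
  -- Projected functions have only a body and an `ω 2` part, so their product does too; the bodies
  -- are inverse because the values are `x` and `x⁻¹` at corresponding points.
  have hD : ∀ j z, chart j z ∈ W V → ∃ c, (N.res hW0 S * N.res hW1 R - 1).1.ext j z =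
      elt 0 0 (fun l => if l = 2 then e * c else 0) 0 := by
    intro j z hz
    obtain ⟨b, c, hb⟩ := hS j z (hW0 hz)
    obtain ⟨b', c', hb'⟩ := hR j z (hW1 hz)
    have h1 : b * b' = 1 := by
      have hp : φ.base.symm (chart j z) ∈ V := hz
      obtain ⟨w, hw⟩ := exists_chart_of_mem (hV0 hp)
      have hw0 : w ≠ 0 := chart_zero_mem.1 (by rw [hw]; exact hV1 hp)
      have e1 := hSv w
      have e2 := hRv w⁻¹
      rw [chart_one_inv hw0, hw, Homeomorph.apply_symm_apply, val_chart _ (hW1 hz), hb',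
        body_elt] at e2
      rw [hw, Homeomorph.apply_symm_apply, val_chart _ (hW0 hz), hb, body_elt] at e1
      rw [e1, e2, mul_inv_cancel₀ hw0]
    refine ⟨b * c' + c * b', ?_⟩
    rw [ext_sub, ext_mul, ext_res _ _ hz, ext_res _ _ hz, ext_one hz, hb, hb', elt_mul]
    refine gext ?_ (fun l => ?_) (fun l => ?_) ?_
    · simp [h1]
    · simp
    · simp; split_ifs <;> ring
    · simp
  obtain ⟨hcL, hcP⟩ := hL _ _ (hW V) _ hD x hV0 hxV
  have hprod : φ.pull _ _ (hW V) (N.res hW0 S * N.res hW1 R - 1) =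
      (glue k v hv).res hV0 X * (glue k v hv).res hV1 Y - 1 := by
    rw [map_sub, map_mul, map_one, ← φ.pull_res _ _ (hW _) _ _ (hW V) hW0 hV0,
      ← φ.pull_res _ _ (hW _) _ _ (hW V) hW1 hV1]
  rw [hprod, ext_sub, ext_mul, ext_res _ _ hxV, ext_res _ _ hxV, ext_one hxV,
    Y.2.2 x hx (hV1 hxV)] at hcL hcP
  have hYb' : body ((glue k v hv).trans (Y.1.ext 1) x) = x⁻¹ := by
    rw [Supermanifold.body_trans _ _ hx, hYb]
  simp only [map_sub, cL_mul, cL_one, hXb, hYb', sub_zero] at hcL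
  have hp := hcP l hl
  have hder : deriv (fun t : ℂ => body (Y.1.ext 1 t⁻¹)) x = -(x ^ 2)⁻¹ := by
    simp only [hYb]
    exact deriv_inv
  rw [map_sub, cP_mul, cP_one, hXb, hYb', sub_zero, cP_trans_glue hx (hYd _), hder] at hp
  have e0 : x ^ (2 - wt k l) = x ^ 2 * x ^ (-wt k l) := by
    rw [sub_eq_add_neg, zpow_add₀ hx, zpow_ofNat]
  -- Parity is not known for `X` and `Y`, so linear parts may occur. They are proportional, and
  -- their cross product in the `ω l` component drops out.
  have hm : ∀ i, cL i ((glue k v hv).trans (Y.1.ext 1) x) = -(x ^ 2)⁻¹ * cL i (X.1.ext 0 x) :=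
    fun i => by
      refine mul_left_cancel₀ hx ?_
      linear_combination (norm := (field_simp; ring)) hcL i
  rw [hm, hm] at hp
  rw [e0]
  linear_combination (norm := (field_simp; ring)) (-x) * hp

/-- If the transition of `N` has no `∂/∂x` part, functions without nilpotent part form a subalgebra
compatible with it. With `e = 0` the error `XY - 1` is exactly zero, so every slot splits. -/
theorem PreIso.exists_splitting_zero {k : Fin 3 → ℤ} {v : EvenVF} {hv : IsT2 v {0}ᶜ}
    {N : Supermanifold} (φ : PreIso (glue k v hv) N) (h : ∀ l x, x ≠ 0 → pC N.v l x = 0)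
    (l : Fin 3) : ∃ a₀ a₁ : ℂ → ℂ, Differentiable ℂ a₀ ∧ Differentiable ℂ a₁ ∧ ∀ x : ℂ, x ≠ 0 →
      pC v l x = a₀ x + x ^ (2 - wt k l) * a₁ x⁻¹ := by
  refine φ.exists_splitting (projCompat_zero N h) Set.univ (fun U V hUV s hs x hV hx => ?_) l
    (Set.mem_univ l)
  have h0 : s = 0 := sections_ext fun j z hz => by
    obtain ⟨c, hc⟩ := hs j z hz
    have h0 := ext_algebraMap (M := N) 0 hz
    rw [map_zero, zero_smul] at h0
    rw [hc, h0]
    refine gext ?_ ?_ ?_ ?_ <;> simp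
  have h1 := ext_algebraMap (M := glue k v hv) 0 hx
  rw [map_zero, zero_smul] at h1
  rw [h0, map_zero, h1]
  simp

end SuperCP1
end

noncomputable section

namespace SuperCP1

/-! ### A vanishing result for the linear part of an isomorphism -/

/-- The image of an open set under the underlying homeomorphism. -/
def PreIso.image {M N : Supermanifold} (φ : PreIso M N) (V : Opens (OnePoint ℂ)) :
    Opens (OnePoint ℂ) :=
  ⟨φ.base.symm ⁻¹' V, V.isOpen.preimage φ.base.symm.continuous⟩

theorem PreIso.mem_image {M N : Supermanifold} (φ : PreIso M N) (V : Opens (OnePoint ℂ))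
    (p : OnePoint ℂ) : p ∈ V ↔ φ.base p ∈ φ.image V := by
  change _ ↔ φ.base.symm (φ.base p) ∈ V
  rw [Homeomorph.symm_apply_apply]

/-- The transport of sections to the target. -/
def PreIso.push {M N : Supermanifold} (φ : PreIso M N) (V : Opens (OnePoint ℂ)) :
    M.sections V ≃ₐ[ℂ] N.sections (φ.image V) :=
  (φ.pull (φ.image V) V (φ.mem_image V)).symm

section
variable {M N : Supermanifold} (φ : PreIso M N)

theorem PreIso.val_push {V : Opens (OnePoint ℂ)} (s : M.sections V) {q : OnePoint ℂ}
    (hq : q ∈ φ.image V) : N.val (φ.push V s) q = M.val s (φ.base.symm q) := by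
  have := φ.val_pull (φ.mem_image V) (φ.push V s) (p := φ.base.symm q) hq
  rw [Homeomorph.apply_symm_apply] at this
  rw [← this, push, AlgEquiv.apply_symm_apply]

theorem PreIso.push_res {V V' : Opens (OnePoint ℂ)} (h : V' ≤ V)
    (h' : φ.image V' ≤ φ.image V) (s : M.sections V) :
    φ.push V' (M.res h s) = N.res h' (φ.push V s) := by
  rw [push, AlgEquiv.symm_apply_eq, ← φ.pull_res _ _ (φ.mem_image V) _ _ _ h' h, push,
    AlgEquiv.apply_symm_apply]

theorem PreIso.body_push_ext {V : Opens (OnePoint ℂ)} (s : M.sections V) {i j : Fin 2} {z w : ℂ}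
    (hz : chart i z ∈ V) (h : φ.base.symm (chart j w) = chart i z) :
    body ((φ.push V s).1.ext j w) = body (s.1.ext i z) := by
  have hw : chart j w ∈ φ.image V := by
    change φ.base.symm (chart j w) ∈ V
    rwa [h]
  rw [← val_chart _ hw, φ.val_push s hw, h, val_chart _ hz]
end

theorem eventually_differentiableAt_body {M : Supermanifold} {U : Opens (OnePoint ℂ)}
    (s : M.sections U) {j : Fin 2} {z : ℂ} (hz : chart j z ∈ U) :
    ∀ᶠ t in nhds z, DifferentiableAt ℂ (fun t => body (s.1.ext j t)) t :=
  (LocalHom.eventually_diffAt s hz).mono fun _ ht => (diffAt_iff.1 ht).1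

section
variable {k : Fin 3 → ℤ} {v v' : EvenVF} {hv : IsT2 v {0}ᶜ} {hv' : IsT2 v' {0}ᶜ}

/-- The coordinate of a chart, as a section. -/
theorem exists_coord (k : Fin 3 → ℤ) {v : EvenVF} (hv : IsT2 v {0}ᶜ) (i : Fin 2) :
    ∃ s : (glue k v hv).sections (chartOpen i), ∀ z, s.1.ext i z = z • 1 := by
  obtain ⟨s, hs⟩ := exists_section (hv := hv) (k := k) i le_rfl fun z _ => diffAt_smul_one z
  exact ⟨s, fun z => hs z (chart_mem_chartOpen i z)⟩

/-- An odd coordinate of a chart, as a section. -/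
theorem exists_oddCoord (k : Fin 3 → ℤ) {v : EvenVF} (hv : IsT2 v {0}ᶜ) (i : Fin 2) (a : Fin 3) :
    ∃ s : (glue k v hv).sections (chartOpen i), ∀ z, s.1.ext i z = ξ a := by
  obtain ⟨s, hs⟩ := exists_section (hv := hv) (k := k) i le_rfl
    fun z _ => (hasD_const (ξ a) z).diffAt
  exact ⟨s, fun z => hs z (chart_mem_chartOpen i z)⟩

/-- The body of the transported coordinate expresses the base map in charts. Pulling back a
coordinate of the target gives a holomorphic left inverse, so the chain rule excludes a zero
derivative; in particular the base homeomorphism is biholomorphic. -/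
theorem PreIso.deriv_body_push_ne_zero (φ : PreIso (glue k v hv) (glue k v' hv')) {i : Fin 2}
    {X : (glue k v hv).sections (chartOpen i)} (hX : ∀ z, X.1.ext i z = z • 1) {j : Fin 2} {w : ℂ}
    (hw : chart j w ∈ φ.image (chartOpen i)) :
    deriv (fun t => body ((φ.push _ X).1.ext j t)) w ≠ 0 := by
  set F := fun t => body ((φ.push _ X).1.ext j t) with hF
  have hFz : ∀ t z, φ.base.symm (chart j t) = chart i z → F t = z := fun t z h => by
    rw [hF]
    simp only
    rw [φ.body_push_ext X (chart_mem_chartOpen i z) h, hX]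
    simp
  obtain ⟨Z, hZ⟩ := exists_coord k hv' j
  let V : Opens (OnePoint ℂ) := ⟨φ.base ⁻¹' chartOpen j, (chartOpen j).isOpen.preimage
    φ.base.continuous⟩
  have hV : ∀ p, p ∈ V ↔ φ.base p ∈ chartOpen j := fun p => Iff.rfl
  set H := fun z => body ((φ.pull _ V hV Z).1.ext i z) with hH
  have hHF : ∀ᶠ t in nhds w, H (F t) = t := by
    filter_upwards [eventually_mem hw] with t ht
    obtain ⟨z, hz⟩ := exists_chart_of_mem (i := i) (p := φ.base.symm (chart j t)) ht
    have hzt : φ.base (chart i z) = chart j t := by rw [hz, Homeomorph.apply_symm_apply]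
    have hzV : chart i z ∈ V := by
      change φ.base (chart i z) ∈ chartOpen j
      rw [hzt]
      exact chart_mem_chartOpen j t
    rw [hFz t z hz.symm, hH]
    simp only
    rw [← val_chart _ hzV, φ.val_pull hV Z hzV, hzt, val_chart _ (chart_mem_chartOpen j t), hZ]
    simp
  obtain ⟨z, hz⟩ := exists_chart_of_mem (i := i) (p := φ.base.symm (chart j w)) hw
  have hzV : chart i z ∈ V := by
    change φ.base (chart i z) ∈ chartOpen j
    rw [hz, Homeomorph.apply_symm_apply]
    exact chart_mem_chartOpen j w
  have hFd : DifferentiableAt ℂ F w := (eventually_differentiableAt_body _ hw).self_of_nhds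
  have hHd : DifferentiableAt ℂ H (F w) := by
    rw [hFz w z hz.symm]
    exact (eventually_differentiableAt_body _ hzV).self_of_nhds
  intro h0
  have h1 := (hHd.hasDerivAt.comp w hFd.hasDerivAt).deriv
  have h2 : H ∘ F =ᶠ[nhds w] id := hHF
  rw [h2.deriv_eq, deriv_id, h0, mul_zero] at h1
  exact one_ne_zero h1

/-- Since `k a = 2`, the odd coordinates of the two charts satisfy `η = y² ξ` up to a multiple of
`Ω`, and this relation is transported to the target. -/
theorem PreIso.cL_push_oddCoord_chart (φ : PreIso (glue k v hv) (glue k v' hv')) {a : Fin 3}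
    (ha : k a = 2)
    {Y : (glue k v hv).sections (chartOpen 1)} (hY : ∀ z, Y.1.ext 1 z = z • 1)
    {Ξ : ∀ i, (glue k v hv).sections (chartOpen i)} (hΞ : ∀ i z, (Ξ i).1.ext i z = ξ a)
    {j : Fin 2} {w : ℂ} (hw : ∀ i, chart j w ∈ φ.image (chartOpen i)) (l : Fin 3) :
    cL l ((φ.push _ (Ξ 1)).1.ext j w) =
      body ((φ.push _ Y).1.ext j w) ^ 2 * cL l ((φ.push _ (Ξ 0)).1.ext j w) := by
  let V := chartOpen 0 ⊓ chartOpen 1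
  have hV0 : V ≤ chartOpen 0 := inf_le_left
  have hV1 : V ≤ chartOpen 1 := inf_le_right
  have hW0 : φ.image V ≤ φ.image (chartOpen 0) := fun p hp => hV0 hp
  have hW1 : φ.image V ≤ φ.image (chartOpen 1) := fun p hp => hV1 hp
  have hwV : chart j w ∈ φ.image V := ⟨hw 0, hw 1⟩
  let M := glue k v hv
  set y := M.res hV1 Y
  set η := M.res hV1 (Ξ 1)
  set θ := M.res hV0 (Ξ 0)
  obtain ⟨Θ₂, hΘ₂⟩ := exists_oddCoord k hv 0 2
  have hxV : ∀ x, chart 0 x ∈ V → x ≠ 0 := fun x h => chart_zero_mem.1 (hV1 h)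
  have hc : ∀ x, chart 0 x ∈ V → (η - y * y * θ).1.ext 0 x =
      elt 0 0 0 (cT ((η - y * y * θ).1.ext 0 x)) := by
    intro x hxU
    have hx := hxV x hxU
    have e1 : ∀ F : ℂ → Grassmann, ∀ s : M.sections (chartOpen 1), s.1.ext 1 = F →
      (M.res hV1 s).1.ext 0 x = M.trans F x := fun F s h => by
      rw [ext_res _ _ hxU, s.2.2 x hx (hV1 hxU), h]
    have eη := e1 _ (Ξ 1) (funext (hΞ 1))
    have ey := e1 _ Y (funext hY)
    have eθ : θ.1.ext 0 x = ξ a := by rw [ext_res _ _ hxU, hΞ]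
    have dξ : DiffAt (fun _ : ℂ => ξ a) x⁻¹ := (hasD_const _ _).diffAt
    have by' : body (y.1.ext 0 x) = x⁻¹ := by
      rw [ey, Supermanifold.body_trans _ _ hx]; simp
    have ly : ∀ l, cL l (y.1.ext 0 x) = 0 := fun l => by
      rw [ey, cL_trans_glue hx]; simp
    refine gext ?_ (fun l => ?_) (fun l => ?_) (by simp)
    · rw [ext_sub, ext_mul, eη, eθ, map_sub, map_mul, Supermanifold.body_trans _ _ hx]
      simp
    · rw [ext_sub, ext_mul, ext_mul, eη, eθ, map_sub, cL_mul, cL_mul, cL_trans_glue hx, ly, map_mul,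
        by']
      simp only [cL_elt, cL_ξ, body_ξ]
      split_ifs with h
      · rw [h, ha, zpow_neg, zpow_ofNat]
        simp; ring
      · simp
    · rw [ext_sub, ext_mul, ext_mul, eη, eθ, map_sub, cP_mul, cL_mul, cL_mul, cP_trans_glue hx dξ]
      simp [ly]
  obtain ⟨D, hD⟩ := exists_section (hv := hv) (k := k) 0 hV0
    (F := fun x => cT ((η - y * y * θ).1.ext 0 x) • ω 2) (fun x hx =>
      (HasD.smul (diffAt_iff.1 ((η - y * y * θ).2.1 0 x hx)).2.2.2.hasDerivAt
        (hasD_const (ω 2) x)).diffAt)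
  -- The error is written as a product of two sections with zero body. Bodies are preserved by the
  -- isomorphism, so the transported error is again such a product and has no linear part.
  have hprod : η - y * y * θ = D * M.res hV0 Θ₂ := by
    refine sections_ext_of_chart 0 hV0 fun x hx => ?_
    rw [hc x hx, ext_mul, hD x hx, ext_res _ _ hx, hΘ₂, smul_mul_assoc, comm_of_deg2 (ω_mem 2),
      ξ_mul_ω, if_pos rfl]
    simp [elt]
  have hbody : ∀ s : M.sections V, (∀ x, chart 0 x ∈ V → body (s.1.ext 0 x) = 0) →
      body ((φ.push V s).1.ext j w) = 0 := by
    intro s hs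
    obtain ⟨z, hz⟩ := exists_chart_of_mem (i := 0) (hV0 hwV : φ.base.symm (chart j w) ∈ _)
    have hzV : chart 0 z ∈ V := by rw [hz]; exact hwV
    rw [φ.body_push_ext s hzV hz.symm, hs z hzV]
  have h1 := congrArg (fun s => cL l ((φ.push V s).1.ext j w)) hprod
  simp only [map_sub, map_mul] at h1
  rw [ext_sub, ext_mul, ext_mul, ext_mul, map_sub, cL_mul, cL_mul, cL_mul _ _ l, map_mul,
    hbody D (fun x hx => by rw [hD x hx]; simp),
    hbody (M.res hV0 Θ₂) (fun x hx => by rw [ext_res _ _ hx, hΘ₂]; simp),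
    hbody θ (fun x hx => by rw [ext_res _ _ hx, hΞ]; simp)] at h1
  rw [φ.push_res hV1 hW1, φ.push_res hV0 hW0, φ.push_res hV1 hW1, ext_res _ _ hwV, ext_res _ _ hwV,
    ext_res _ _ hwV] at h1
  linear_combination h1
end

end SuperCP1
end

/-! ### Vanishing of a block of the linear part, and the obstruction for `(2,2,3)`. -/

noncomputable section

namespace SuperCP1

section
variable {k : Fin 3 → ℤ} {v v' : EvenVF} {hv : IsT2 v {0}ᶜ} {hv' : IsT2 v' {0}ᶜ}

/-- The bundle `O(-1)` has no global sections: `f` tends to zero at infinity, so Liouville's theorem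
applies. -/
theorem eq_zero_of_differentiable {f g : ℂ → ℂ} (hf : Differentiable ℂ f) (hg : Differentiable ℂ g)
    (h : ∀ x, x ≠ 0 → f x = -x⁻¹ * g x⁻¹) : f = 0 ∧ g = 0 := by
  have hf0 : ∀ x, f x = 0 := fun x => by
    refine hf.apply_eq_of_tendsto_cocompact x ?_
    rw [← Metric.cobounded_eq_cocompact]
    have h1 : Filter.Tendsto (fun x : ℂ => -x⁻¹ * g x⁻¹) (Bornology.cobounded ℂ)
        (nhds (-0 * g 0)) := by
      have h0 := Filter.tendsto_inv₀_cobounded (α := ℂ)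
      exact h0.neg.mul (hg.continuous.continuousAt.tendsto.comp h0)
    rw [neg_zero, zero_mul] at h1
    refine h1.congr' ?_
    have : ∀ᶠ x : ℂ in Bornology.cobounded ℂ, x ≠ 0 := by
      filter_upwards [eventually_cobounded_le_norm (1 : ℝ)] with x hx h0
      rw [h0, norm_zero] at hx
      linarith
    filter_upwards [this] with x hx using (h x hx).symm
  have hg0 : ∀ y, y ≠ 0 → g y = 0 := fun y hy => by
    have := h y⁻¹ (inv_ne_zero hy)
    rw [hf0, inv_inv] at this
    simpa [hy] using this.symm
  refine ⟨funext hf0, funext fun y => ?_⟩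
  by_cases hy : y = 0
  · subst hy
    have h1 : Filter.Tendsto g (nhdsWithin 0 {0}ᶜ) (nhds (g 0)) :=
      hg.continuous.continuousAt.tendsto.mono_left nhdsWithin_le_nhds
    have h2 : Filter.Tendsto g (nhdsWithin 0 {0}ᶜ) (nhds 0) := by
      refine tendsto_const_nhds.congr' ?_
      filter_upwards [self_mem_nhdsWithin] with y hy using (hg0 y hy).symm
    exact tendsto_nhds_unique h1 h2
  · exact hg0 y hy

-- An odd coordinate of weight two changes under a change of source chart like the differential of
-- the even coordinate, up to sign. Dividing its transported linear coefficient by the derivative of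
-- the transported even coordinate removes the dependence on the source chart, for any base map. In
-- the target the numerator has weight three and the derivative weight two, so the quotient is a
-- section of `O(-1)` and vanishes.
open Classical in
theorem PreIso.cL_two_push_oddCoord (φ : PreIso (glue k v hv) (glue k v' hv')) {a : Fin 3}
    (ha : k a = 2) (hk : k 2 = 3)
    {Ξ : ∀ i, (glue k v hv).sections (chartOpen i)} (hΞ : ∀ i z, (Ξ i).1.ext i z = ξ a)
    {i j : Fin 2} {w : ℂ} (hw : chart j w ∈ φ.image (chartOpen i)) :
    cL 2 ((φ.push _ (Ξ i)).1.ext j w) = 0 := by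
  choose X hX using exists_coord k hv
  set F : Fin 2 → Fin 2 → ℂ → ℂ := fun i j t => body ((φ.push _ (X i)).1.ext j t) with hF
  set L : Fin 2 → Fin 2 → ℂ → ℂ := fun i j t => cL 2 ((φ.push _ (Ξ i)).1.ext j t) with hL
  -- The sign compensates for `dy = -y² dx`, so that the quotients of the two source charts agree on
  -- the overlap and glue to `R`.
  set r : Fin 2 → Fin 2 → ℂ → ℂ := fun i j t =>
    (if i = 0 then 1 else -1) * (L i j t / deriv (F i j) t) with hr
  set R : Fin 2 → ℂ → ℂ := fun j t => if chart j t ∈ φ.image (chartOpen 0) then r 0 j t else r 1 j t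
    with hR
  have hF0 : ∀ {i j w}, chart j w ∈ φ.image (chartOpen i) → deriv (F i j) w ≠ 0 := fun {i j w} hw =>
    φ.deriv_body_push_ne_zero (hX i) hw
  have hFd : ∀ {i j w}, chart j w ∈ φ.image (chartOpen i) → AnalyticAt ℂ (F i j) w :=
    fun {i j w} hw => Complex.analyticAt_iff_eventually_differentiableAt.2
      (eventually_differentiableAt_body _ hw)
  have hLd : ∀ {i j w}, chart j w ∈ φ.image (chartOpen i) → DifferentiableAt ℂ (L i j) w :=
    fun {i j w} hw => (diffAt_iff.1 ((φ.push _ (Ξ i)).2.1 j w hw)).2.1 2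
  have hrd : ∀ {i j w}, chart j w ∈ φ.image (chartOpen i) → DifferentiableAt ℂ (r i j) w :=
    fun {i j w} hw => ((hLd hw).div (hFd hw).deriv.differentiableAt (hF0 hw)).const_mul _
  have hcross : ∀ {j w}, (∀ i, chart j w ∈ φ.image (chartOpen i)) → r 0 j w = r 1 j w := by
    intro j w hw
    have hprod : ∀ {t}, (∀ i, chart j t ∈ φ.image (chartOpen i)) → F 0 j t * F 1 j t = 1 := by
      intro t ht
      obtain ⟨z, hz⟩ := exists_chart_of_mem (i := 0) (p := φ.base.symm (chart j t)) (ht 0)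
      have hz0 : z ≠ 0 := chart_zero_mem.1 (by rw [hz]; exact ht 1)
      simp only [hF]
      rw [φ.body_push_ext (X 0) (chart_mem_chartOpen 0 z) hz.symm,
        φ.body_push_ext (X 1) (chart_mem_chartOpen 1 z⁻¹) (by rw [chart_one_inv hz0, hz]), hX, hX]
      simp [hz0]
    have h1 : (fun t => F 0 j t * F 1 j t) =ᶠ[nhds w] fun _ => 1 := by
      filter_upwards [eventually_mem (hw 0), eventually_mem (hw 1)] with t h0 h1
      exact hprod fun i => by
        fin_cases i
        exacts [h0, h1]
    have h2 : deriv (F 0 j) w * F 1 j w + F 0 j w * deriv (F 1 j) w = 0 := by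
      have := h1.deriv_eq
      rw [deriv_const] at this
      rw [← this]
      exact ((hFd (hw 0)).differentiableAt.hasDerivAt.mul
        (hFd (hw 1)).differentiableAt.hasDerivAt).deriv.symm
    have h3 : L 1 j w = F 1 j w ^ 2 * L 0 j w :=
      φ.cL_push_oddCoord_chart ha (hX 1) hΞ hw 2
    have h4 := hprod hw
    have h5 : F 1 j w ≠ 0 := right_ne_zero_of_mul_eq_one h4
    have h6 := hF0 (hw 0)
    have h7 := hF0 (hw 1)
    simp only [hr, if_pos, one_ne_zero, if_false, h3]
    rw [one_mul, neg_one_mul, ← neg_div, div_eq_div_iff h6 h7]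
    have h8 : deriv (F 1 j) w = - F 1 j w ^ 2 * deriv (F 0 j) w := by
      linear_combination F 1 j w * h2 - deriv (F 1 j) w * h4
    rw [h8]
    ring
  have hRr : ∀ {i j w}, chart j w ∈ φ.image (chartOpen i) → R j w = r i j w := by
    intro i j w hw
    simp only [hR]
    fin_cases i
    · exact if_pos hw
    · split_ifs with h
      · exact hcross fun i => by
          fin_cases i
          exacts [h, hw]
      · rfl
  have hcov : ∀ j w, ∃ i, chart j w ∈ φ.image (chartOpen i) := fun j w => mem_chartOpen _
  have hRd : ∀ j, Differentiable ℂ (R j) := fun j w => by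
    obtain ⟨i, hi⟩ := hcov j w
    refine (hrd hi).congr_of_eventuallyEq ?_
    filter_upwards [eventually_mem hi] with t ht using hRr ht
  have hRR : ∀ x, x ≠ 0 → R 0 x = -x⁻¹ * R 1 x⁻¹ := by
    intro x hx
    obtain ⟨i, hi⟩ := hcov 0 x
    have hi' : chart 1 x⁻¹ ∈ φ.image (chartOpen i) := by rwa [chart_one_inv hx]
    rw [hRr hi, hRr hi']
    have h1 : F i 0 =ᶠ[nhds x] fun t => F i 1 t⁻¹ := by
      filter_upwards [eventually_mem hi, eventually_ne_zero hx] with t ht ht'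
      simp only [hF]
      rw [(φ.push _ (X i)).2.2 t ht' ht, Supermanifold.body_trans _ _ ht']
    have h2 : deriv (F i 0) x = deriv (F i 1) x⁻¹ * -(x ^ 2)⁻¹ := by
      rw [h1.deriv_eq]
      exact ((hFd hi').differentiableAt.hasDerivAt.comp x (hasDerivAt_inv hx)).deriv
    have h3 : L i 0 x = (x ^ 3)⁻¹ * L i 1 x⁻¹ := by
      simp only [hL]
      rw [(φ.push _ (Ξ i)).2.2 x hx hi, cL_trans_glue hx, hk, zpow_neg]
      norm_cast
    have h4 := hF0 hi'
    simp only [hr]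
    rw [h2, h3]
    field_simp
  obtain ⟨h0, h1⟩ := eq_zero_of_differentiable (hRd 0) (hRd 1) hRR
  have h2 : R j w = 0 := by
    fin_cases j
    · exact congrFun h0 w
    · exact congrFun h1 w
  rw [hRr hw] at h2
  have h3 := hF0 hw
  simp only [hr, mul_eq_zero, div_eq_zero_iff, h3, or_false] at h2
  rcases h2 with h2 | h2
  · split_ifs at h2
    · exact absurd h2 one_ne_zero
    · exact absurd h2 (neg_ne_zero.2 one_ne_zero)
  · exact h2

/-- The target is compatible with keeping the `ω 2` component. A multiple of `ω 2 = ξ 0 * ξ 1`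
annihilates the transported `ξ 0` and `ξ 1`, whose `ξ 2` coefficient is zero. Hence its pullback
annihilates `ξ 0` and `ξ 1`, which removes its linear part and its `ω 0` and `ω 1` parts; this is
the condition `hL` of `PreIso.exists_splitting`. -/
theorem PreIso.exists_splitting_of_slot_two (φ : PreIso (glue k v hv) (glue k v' hv'))
    (h0 : k 0 = 2) (h1 : k 1 = 2) (h2 : k 2 = 3) (hp0 : ∀ x, x ≠ 0 → pC v' 0 x = 0)
    (hp1 : ∀ x, x ≠ 0 → pC v' 1 x = 0) :
    ∃ a₀ a₁ : ℂ → ℂ, Differentiable ℂ a₀ ∧ Differentiable ℂ a₁ ∧ ∀ x : ℂ, x ≠ 0 →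
      pC v 0 x = a₀ x + x ^ (2 - wt k 0) * a₁ x⁻¹ := by
  refine φ.exists_splitting (projCompat_one hv' hp0 hp1) {0, 1} (fun U V hUV s hs x hV hx => ?_) 0
    (by simp)
  have key : ∀ a : Fin 3, k a = 2 → (φ.pull U V hUV s).1.ext 0 x * ξ a = 0 := by
    intro a ha
    choose Ξ hΞ using fun i => exists_oddCoord k hv i a
    have hU : U ≤ φ.image (chartOpen 0) := fun q hq => by
      refine hV ((hUV (φ.base.symm q)).2 ?_)
      rwa [Homeomorph.apply_symm_apply]
    have hz : s * (glue k v' hv').res hU (φ.push _ (Ξ 0)) = 0 := sections_ext fun j w hw => by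
      obtain ⟨c, hc⟩ := hs j w hw
      have hz0 := ext_algebraMap (M := glue k v' hv') 0 hw
      rw [map_zero, zero_smul] at hz0
      have hL := φ.cL_two_push_oddCoord ha h2 hΞ (hU hw)
      have hb : body ((φ.push _ (Ξ 0)).1.ext j w) = 0 := by
        obtain ⟨z, hz⟩ := exists_chart_of_mem (i := 0) (p := φ.base.symm (chart j w)) (hU hw)
        rw [φ.body_push_ext (Ξ 0) (chart_mem_chartOpen 0 z) hz.symm, hΞ, body_ξ]
      rw [hz0, ext_mul, ext_res _ _ hw, hc]
      refine gext ?_ (fun l => ?_) (fun l => ?_) ?_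
      · simp
      · simp [cL_mul]
      · simp [cP_mul, hb]
      · simp [cT_mul, hb, Fin.sum_univ_three, hL]
    have h3 := congrArg (φ.pull U V hUV) hz
    rw [map_mul, map_zero, ← φ.pull_res _ _ (φ.mem_image _) _ _ hUV hU hV, PreIso.push,
      AlgEquiv.apply_symm_apply] at h3
    have h4 := ext_algebraMap (M := glue k v hv) 0 hx
    rw [map_zero, zero_smul] at h4
    rw [← h4, ← h3, ext_mul, ext_res _ _ hx, hΞ]
  generalize (φ.pull U V hUV s).1.ext 0 x = b at key
  have k0 := key 0 h0
  have k1 := key 1 h1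
  have e1 := congrArg (cP 1) k0
  have e2 := congrArg (cP 2) k0
  have e3 := congrArg (cP 2) k1
  have t0 := congrArg cT k0
  have t1 := congrArg cT k1
  simp [cP_mul, cT_mul] at e1 e2 e3 t0 t1
  refine ⟨fun l => ?_, fun l hl => ?_⟩
  · fin_cases l
    exacts [e3, e2, e1]
  · rcases hl with rfl | rfl
    exacts [t0, t1]
end

end SuperCP1
end

noncomputable section

namespace SuperCP1

/-! ### Split supermanifolds -/

section
variable {k : Fin 3 → ℤ} {v : EvenVF} {hv : IsT2 v {0}ᶜ}

/-- The action of an endomorphism on a function of `x` is governed by its action on `x`. No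
continuity is needed: dividing `f` by `t - x` with remainder gives a first-order Taylor formula
inside the algebra. -/
theorem cP_endo_of_body {V : Opens (OnePoint ℂ)} (hV : V ≤ chartOpen 0)
    (θ : (glue k v hv).sections V →ₐ[ℂ] (glue k v hv).sections V)
    (hval : ∀ s x, chart 0 x ∈ V → body ((θ s).1.ext 0 x) = body (s.1.ext 0 x))
    {X : (glue k v hv).sections V} (hX : ∀ x, chart 0 x ∈ V → X.1.ext 0 x = x • 1)
    (hX1 : ∀ x l, chart 0 x ∈ V → cL l ((θ X).1.ext 0 x) = 0) {f : ℂ → ℂ}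
    (hf : ∀ x, chart 0 x ∈ V → DifferentiableAt ℂ f x)
    {s : (glue k v hv).sections V} (hs : ∀ x, chart 0 x ∈ V → s.1.ext 0 x = f x • 1)
    {x : ℂ} (hx : chart 0 x ∈ V) (l : Fin 3) : cL l ((θ s).1.ext 0 x) = 0 ∧
      cP l ((θ s).1.ext 0 x) = deriv f x * cP l ((θ X).1.ext 0 x) := by
  have hopen : {t | chart 0 t ∈ V} ∈ nhds x := eventually_mem hx
  have hg : ∀ t, chart 0 t ∈ V → DifferentiableAt ℂ (dslope f x) t := fun t ht =>
    ((Complex.differentiableOn_dslope hopen).2 fun t ht =>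
      (hf t ht).differentiableWithinAt).differentiableAt (eventually_mem ht)
  obtain ⟨g, hg⟩ := exists_section (hv := hv) (k := k) 0 hV (F := fun t => dslope f x t • 1)
    fun t ht => (HasD.smul (hg t ht).hasDerivAt (hasD_const 1 t)).diffAt
  have e : s = algebraMap ℂ _ (f x) + (X - algebraMap ℂ _ x) * g := by
    refine sections_ext_of_chart 0 hV fun t ht => ?_
    rw [hs t ht, ext_add, ext_algebraMap _ ht, ext_mul, ext_sub, hX t ht, ext_algebraMap _ ht,
      hg t ht, ← sub_smul, smul_mul_smul_comm, mul_one, ← add_smul]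
    congr 1
    have := sub_smul_dslope f x t
    rw [smul_eq_mul] at this
    rw [this]; ring
  have e1 : (θ s).1.ext 0 x = f x • 1 + ((θ X).1.ext 0 x - x • 1) * (θ g).1.ext 0 x := by
    rw [e, map_add, AlgHom.commutes, map_mul, map_sub, AlgHom.commutes, ext_add,
      ext_algebraMap _ hx, ext_mul, ext_sub, ext_algebraMap _ hx]
  have hb : body ((θ X).1.ext 0 x) = x := by rw [hval _ _ hx, hX x hx]; simp
  have hgb : body ((θ g).1.ext 0 x) = deriv f x := by
    rw [hval _ _ hx, hg x hx, dslope_same]; simp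
  rw [e1]
  constructor
  · simp [cL_mul, hb, hX1 x _ hx]
  · simp [cP_mul, hb, hX1 x _ hx, hgb, mul_comm]

/-- The endomorphism is applied to the transition formulas of the coordinates. The cocycle terms
with `ω` are multiplied by 4 and those with `Ω` by 8, while the transition of the image coordinates
produces factors 1 and 2. The differences `-3` and `-6` are invertible, and the rest of each
identity is holomorphic data on the two charts. -/
theorem isCoboundary_of_endo (θ : ∀ U, (glue k v hv).sections U →ₐ[ℂ] (glue k v hv).sections U)
    (hres : ∀ U V (h : V ≤ U) s, (glue k v hv).res h (θ U s) = θ V ((glue k v hv).res h s))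
    (hval : ∀ U s j z, chart j z ∈ U → body ((θ U s).1.ext j z) = body (s.1.ext j z))
    (hX : ∀ i (X : (glue k v hv).sections (chartOpen i)), (∀ z, X.1.ext i z = z • 1) →
      ∀ z l, cL l ((θ _ X).1.ext i z) = 0)
    (hΞ : ∀ i a (Ξ : (glue k v hv).sections (chartOpen i)), (∀ z, Ξ.1.ext i z = ξ a) →
      ∀ z l, cL l ((θ _ Ξ).1.ext i z) = (if l = a then 2 else 0) ∧ cP l ((θ _ Ξ).1.ext i z) = 0) :
    IsCoboundary k v := by
  rw [isCoboundary_iff hv]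
  intro a
  let M := glue k v hv
  let V := chartOpen 0 ⊓ chartOpen 1
  have hV0 : V ≤ chartOpen 0 := inf_le_left
  have hV1 : V ≤ chartOpen 1 := inf_le_right
  have hxV : ∀ {x}, chart 0 x ∈ V ↔ x ≠ 0 := fun {x} =>
    ⟨fun h => chart_zero_mem.1 (hV1 h), fun h => ⟨chart_mem_chartOpen 0 x, chart_zero_mem.2 h⟩⟩
  choose X hXe using exists_coord k hv
  choose Ξ hΞe using fun i b => exists_oddCoord k hv i b
  have hdθ : ∀ i (s : M.sections (chartOpen i)) z, DiffAt ((θ _ s).1.ext i) z := fun i s z =>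
    (θ _ s).2.1 i z (chart_mem_chartOpen i z)
  have hdcP : ∀ i (s : M.sections (chartOpen i)),
      Differentiable ℂ fun z => cP a ((θ _ s).1.ext i z) := fun i s z =>
    (diffAt_iff.1 (hdθ i s z)).2.2.1 a
  have hdcT : ∀ i (s : M.sections (chartOpen i)),
      Differentiable ℂ fun z => cT ((θ _ s).1.ext i z) := fun i s z =>
    (diffAt_iff.1 (hdθ i s z)).2.2.2
  have scalar : ∀ f : ℂ → ℂ, (∀ x, x ≠ 0 → DifferentiableAt ℂ f x) →
      ∃ s : M.sections V, ∀ x, chart 0 x ∈ V → s.1.ext 0 x = f x • 1 := fun f hf =>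
    exists_section (hv := hv) (k := k) 0 hV0 fun x hx =>
      (HasD.smul (hf x (hxV.1 hx)).hasDerivAt (hasD_const 1 x)).diffAt
  set x₀ := M.res hV0 (X 0) with hx₀
  set y₁ := M.res hV1 (X 1) with hy₁
  have hx₀e : ∀ x, chart 0 x ∈ V → x₀.1.ext 0 x = x • 1 := fun x hx => by
    rw [hx₀, ext_res _ _ hx, hXe]
  have hθ0 : ∀ (s : M.sections (chartOpen 0)) x, x ≠ 0 →
      (θ V (M.res hV0 s)).1.ext 0 x = (θ _ s).1.ext 0 x := fun s x hx => by
    rw [← hres, ext_res _ _ (hxV.2 hx)]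
  have hθ1 : ∀ (s : M.sections (chartOpen 1)) x, x ≠ 0 →
      (θ V (M.res hV1 s)).1.ext 0 x = M.trans ((θ _ s).1.ext 1) x := fun s x hx => by
    rw [← hres, ext_res _ _ (hxV.2 hx)]
    exact (θ _ s).2.2 x hx (hV1 (hxV.2 hx))
  have hx₀1 : ∀ x l, chart 0 x ∈ V → cL l ((θ V x₀).1.ext 0 x) = 0 := fun x l hx => by
    rw [hx₀, hθ0 _ _ (hxV.1 hx), hX 0 (X 0) (hXe 0)]
  have taylor := fun {f : ℂ → ℂ} (hf : ∀ x, x ≠ 0 → DifferentiableAt ℂ f x) {s : M.sections V}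
      (hs : ∀ x, chart 0 x ∈ V → s.1.ext 0 x = f x • 1) {x : ℂ} (hx : x ≠ 0) =>
    cP_endo_of_body hV0 (θ V) (fun s x hx => hval V s 0 x hx) hx₀e hx₀1
      (fun x hx => hf x (hxV.1 hx)) hs (hxV.2 hx)
  have hΞb : ∀ b x, x ≠ 0 → body ((θ V (M.res hV0 (Ξ 0 b))).1.ext 0 x) = 0 := fun b x hx => by
    rw [hval _ _ _ _ (hxV.2 hx), ext_res _ _ (hxV.2 hx), hΞe, body_ξ]
  have hΞL : ∀ b l x, x ≠ 0 → cL l ((θ V (M.res hV0 (Ξ 0 b))).1.ext 0 x) = if l = b then 2 else 0 :=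
    fun b l x hx => by rw [hθ0 _ _ hx, (hΞ 0 b _ (hΞe 0 b) x l).1]
  have hΞP : ∀ b l x, x ≠ 0 → cP l ((θ V (M.res hV0 (Ξ 0 b))).1.ext 0 x) = 0 :=
    fun b l x hx => by rw [hθ0 _ _ hx, (hΞ 0 b _ (hΞe 0 b) x l).2]
  have hinv : ∀ x : ℂ, x ≠ 0 → HasDerivAt (fun x : ℂ => x⁻¹) (-(x ^ 2)⁻¹) x := fun x hx =>
    hasDerivAt_inv hx
  have hp : ∀ l x, x ≠ 0 → DifferentiableAt ℂ (pC v l) x := fun l x hx => hv.diff_p hx l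
  have hq : ∀ l x, x ≠ 0 → DifferentiableAt ℂ (qC v l) x := fun l x hx => hv.diff_q hx l
  -- the even coordinate
  have E1 : ∀ x, x ≠ 0 → (-3) * pC v a x = cP a ((θ _ (X 0)).1.ext 0 x) +
      x ^ (2 - wt k a) * cP a ((θ _ (X 1)).1.ext 1 x⁻¹) := by
    obtain ⟨f, hf⟩ := scalar (fun x => x⁻¹) fun x hx => (hinv x hx).differentiableAt
    have hcd : ∀ l x, x ≠ 0 → DifferentiableAt ℂ (fun x => pC v l x * -(x ^ 2)⁻¹) x :=
      fun l x hx => (hp l x hx).mul (((differentiableAt_id.pow 2).inv (pow_ne_zero 2 hx)).neg)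
    choose c hc using fun l => scalar (fun x => pC v l x * -(x ^ 2)⁻¹) (hcd l)
    -- The gluing formula for `y`, written with actual sections so that the endomorphism can be
    -- applied factor by factor.
    have e : y₁ = f + ∑ l, c l * (M.res hV0 (Ξ 0 (l + 1)) * M.res hV0 (Ξ 0 (l + 2))) := by
      refine sections_ext_of_chart 0 hV0 fun x hx => ?_
      have hx' := hxV.1 hx
      have h1 : y₁.1.ext 0 x = M.trans (fun z => z • 1) x := by
        rw [hy₁, ext_res _ _ hx, (X 1).2.2 x hx' (hV1 hx), show (X 1).1.ext 1 = fun z => z • 1 from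
          funext (hXe 1)]
      have hd : DiffAt (fun z : ℂ => z • (1 : Grassmann)) x⁻¹ := diffAt_smul_one _
      have hbd : deriv (fun t : ℂ => body (t⁻¹ • (1 : Grassmann))) x = -(x ^ 2)⁻¹ := by
        rw [← (hinv x hx').deriv]
        congr 1
        funext t; simp
      simp only [Fin.sum_univ_three, ext_add, ext_mul]
      rw [h1, hf x hx, hc 0 x hx, hc 1 x hx, hc 2 x hx]
      simp only [ext_res _ _ hx, hΞe]
      refine gext ?_ (fun l => ?_) (fun l => ?_) ?_
      · rw [Supermanifold.body_trans _ _ hx']; simp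
      · rw [cL_trans_glue hx']; simp [cL_mul]
      · rw [cP_trans_glue hx' hd, hbd]
        simp [cP_mul]
        fin_cases l <;> simp
      · rw [cT_trans_glue hx' hd]; simp [cT_mul]
    intro x hx
    have h := congrArg (fun s => cP a ((θ V s).1.ext 0 x)) e
    simp only [hy₁] at h
    rw [hθ1 _ x hx, cP_trans_glue hx (hdθ 1 _ _)] at h
    have hbd : deriv (fun t : ℂ => body ((θ _ (X 1)).1.ext 1 t⁻¹)) x = -(x ^ 2)⁻¹ := by
      rw [← (hinv x hx).deriv]
      congr 1
      funext t
      rw [hval _ _ _ _ (chart_mem_chartOpen 1 _), hXe]; simp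
    have hcb : ∀ l, body ((θ V (c l)).1.ext 0 x) = pC v l x * -(x ^ 2)⁻¹ := fun l => by
      rw [hval _ _ _ _ (hxV.2 hx), hc l x (hxV.2 hx)]; simp
    rw [hbd] at h
    simp only [Fin.sum_univ_three, map_add, map_mul, ext_add, ext_mul] at h
    rw [(taylor (fun x hx => (hinv x hx).differentiableAt) hf hx a).2, (hinv x hx).deriv, hx₀,
      hθ0 _ x hx] at h
    simp only [cP_mul, cL_mul, map_mul, hΞb _ x hx, hΞL _ _ x hx, hΞP _ _ x hx, hcb] at h
    have h2 : x ^ (2 - wt k a) = x ^ 2 * x ^ (-wt k a) := by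
      rw [sub_eq_add_neg, zpow_add₀ hx, zpow_ofNat]
    rw [h2]
    have h3 : x ^ (-wt k a) * cP a ((θ _ (X 1)).1.ext 1 x⁻¹) + pC v a x * -(x ^ 2)⁻¹ =
        -(x ^ 2)⁻¹ * cP a ((θ _ (X 0)).1.ext 0 x) + 4 * (pC v a x * -(x ^ 2)⁻¹) := by
      rw [h]
      fin_cases a <;> simp <;> ring
    linear_combination (norm := (field_simp; ring)) (-x ^ 2) * h3
  -- the odd coordinates
  have E2 : ∀ x, x ≠ 0 → (-6) * (qC v a x - k a * x⁻¹ * pC v a x) =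
      cT ((θ _ (Ξ 0 a)).1.ext 0 x) - 2 * k a * x⁻¹ * cP a ((θ _ (X 0)).1.ext 0 x) -
      x ^ (-wt k a) * cT ((θ _ (Ξ 1 a)).1.ext 1 x⁻¹) := by
    have hz : ∀ x : ℂ, x ≠ 0 → HasDerivAt (fun x : ℂ => x ^ (-k a)) ((-k a : ℤ) * x ^ (-k a - 1)) x :=
      fun x hx => hasDerivAt_zpow' _ hx
    obtain ⟨g, hg⟩ := scalar (fun x => x ^ (-k a)) fun x hx => (hz x hx).differentiableAt
    have hcd : ∀ x, x ≠ 0 → DifferentiableAt ℂ (fun x => pC v a x * ((-k a : ℤ) * x ^ (-k a - 1)) +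
        qC v a x * x ^ (-k a)) x := fun x hx =>
      ((hp a x hx).mul ((hasDerivAt_zpow' _ hx).differentiableAt.const_mul _)).add
        ((hq a x hx).mul (hz x hx).differentiableAt)
    obtain ⟨c, hc⟩ := scalar _ hcd
    have hΞd : ∀ (r : ℂ) (l : Fin 3) (x : ℂ), x ≠ 0 → deriv (fun t => t ^ (-k l) * if l = a then r else 0) x
        = if l = a then r * ((-k a : ℤ) * x ^ (-k a - 1)) else 0 := fun r l x hx => by
      split_ifs with h
      · rw [h, ((hz x hx).mul_const r).deriv, mul_comm]
      · simp
    have e : M.res hV1 (Ξ 1 a) = g * M.res hV0 (Ξ 0 a) +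
        c * (M.res hV0 (Ξ 0 0) * M.res hV0 (Ξ 0 1) * M.res hV0 (Ξ 0 2)) := by
      refine sections_ext_of_chart 0 hV0 fun x hx => ?_
      have hx' := hxV.1 hx
      have h1 : (M.res hV1 (Ξ 1 a)).1.ext 0 x = M.trans (fun _ => ξ a) x := by
        rw [ext_res _ _ hx, (Ξ 1 a).2.2 x hx' (hV1 hx), show (Ξ 1 a).1.ext 1 = fun _ => ξ a from
          funext (hΞe 1 a)]
      have hd : DiffAt (fun _ : ℂ => ξ a) x⁻¹ := (hasD_const _ _).diffAt
      rw [h1, ext_add, ext_mul, ext_mul, ext_mul, ext_mul, hg x hx, hc x hx]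
      simp only [ext_res _ _ hx, hΞe]
      change _ = _ + _ • 1 * Ω
      refine gext ?_ (fun l => ?_) (fun l => ?_) ?_
      · rw [Supermanifold.body_trans _ _ hx']; simp
      · rw [cL_trans_glue hx']
        by_cases h : l = a
        · subst h; simp
        · simp [h]
      · rw [cP_trans_glue hx' hd]; simp
      · rw [cT_trans_glue hx' hd]
        simp only [cL_ξ, hΞd 1 _ x hx']
        simp [Finset.sum_add_distrib]
    intro x hx
    have h := congrArg (fun s => cT ((θ V s).1.ext 0 x)) e
    rw [hθ1 _ x hx, cT_trans_glue hx (hdθ 1 _ _)] at h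
    simp only [(hΞ 1 a _ (hΞe 1 a) _ _).1, hΞd 2 _ x hx, map_add, map_mul, ext_add, ext_mul] at h
    have tg := fun l => (taylor (fun x hx => (hz x hx).differentiableAt) hg hx l)
    have hcb : body ((θ V c).1.ext 0 x) = pC v a x * ((-k a : ℤ) * x ^ (-k a - 1)) +
        qC v a x * x ^ (-k a) := by
      rw [hval _ _ _ _ (hxV.2 hx), hc x (hxV.2 hx)]; simp
    have hgb : body ((θ V g).1.ext 0 x) = x ^ (-k a) := by
      rw [hval _ _ _ _ (hxV.2 hx), hg x (hxV.2 hx)]; simp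
    simp only [cT_mul, cP_mul, cL_mul, map_mul, hΞb _ x hx, hΞL _ _ x hx, hΞP _ _ x hx, hcb, hgb,
      (tg _).1, (tg _).2, (hz x hx).deriv] at h
    rw [hx₀, hθ0 _ x hx, hθ0 _ x hx] at h
    have e1 : x ^ (-k a - 1) = x⁻¹ * x ^ (-k a) := by
      rw [sub_eq_add_neg, zpow_add₀ hx, zpow_neg_one, mul_comm]
    have e2 : x ^ (-(k 0 + k 1 + k 2)) = x ^ (-k a) * x ^ (-wt k a) := by
      rw [← wt_add k a, ← zpow_add₀ hx]
      congr 1; ring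
    rw [e1, e2] at h
    have h0 : x ^ (-k a) ≠ 0 := zpow_ne_zero _ hx
    -- In the `Ω` component the transition of the image of `η` contributes the factor 2, and the
    -- product of three doubled odd coordinates the factor 8.
    have h3 : x ^ (-k a) * (x ^ (-wt k a) * cT ((θ _ (Ξ 1 a)).1.ext 1 x⁻¹) +
        2 * (qC v a x - k a * x⁻¹ * pC v a x)) = x ^ (-k a) * (cT ((θ _ (Ξ 0 a)).1.ext 0 x) -
        2 * k a * x⁻¹ * cP a ((θ _ (X 0)).1.ext 0 x) + 8 * (qC v a x - k a * x⁻¹ * pC v a x)) := by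
      have := h
      push_cast at this
      have ha : a = 0 ∨ a = 1 ∨ a = 2 := by
        clear * - a
        revert a; decide
      clear_value x₀ y₁
      rcases ha with rfl | rfl | rfl <;> simp [Fin.sum_univ_three, -zpow_neg] at this <;>
        linear_combination this
    have h4 := mul_left_cancel₀ h0 h3
    linear_combination h4
  refine ⟨fun x => (-1 / 3) * cP a ((θ _ (X 0)).1.ext 0 x),
    fun x => (-1 / 6) * cT ((θ _ (Ξ 0 a)).1.ext 0 x),
    fun y => (-1 / 3) * cP a ((θ _ (X 1)).1.ext 1 y),
    fun y => (1 / 6) * cT ((θ _ (Ξ 1 a)).1.ext 1 y), (hdcP 0 _).const_mul _, (hdcT 0 _).const_mul _,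
    (hdcP 1 _).const_mul _, (hdcT 1 _).const_mul _, fun x hx => ⟨?_, ?_⟩⟩
  · linear_combination (-1 / 3) * E1 x hx
  · have e1 : x ^ (2 - wt k a) = x * x ^ (1 - wt k a) := by
      rw [← zpow_one_add₀ hx]
      congr 1; ring
    have h1 := E1 x hx
    rw [e1] at h1
    linear_combination (norm := (field_simp; ring)) (-1 / 6) * E2 x hx +
      (-1 / 3) * k a * x⁻¹ * h1
end

end SuperCP1
end

/-! ### Dilations, parity and non-splitness. -/

noncomputable section

namespace SuperCP1

theorem Supermanifold.IsomorphicOverId.exists_family {M N : Supermanifold}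
    (h : M.IsomorphicOverId N) : ∃ P : ∀ U, N.sections U ≃ₐ[ℂ] M.sections U,
      (∀ U V (hVU : V ≤ U) s, M.res hVU (P U s) = P V (N.res hVU s)) ∧
      (∀ U p s, N.HasParity p s → M.HasParity p (P U s)) ∧
      ∀ U s j z, chart j z ∈ U → body ((P U s).1.ext j z) = body (s.1.ext j z) := by
  obtain ⟨φ, hφ⟩ := h
  obtain ⟨ψ, hb, hψ⟩ := exists_preIso φ
  obtain ⟨σ, pull, pull_res, pull_parity⟩ := φ
  subst hφ
  refine ⟨pull, pull_res, pull_parity, fun U s j z hz => ?_⟩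
  have hp : ∀ p, p ∈ U ↔ ψ.base p ∈ U := fun p => by rw [hb]; rfl
  have h1 := ψ.val_pull hp s hz
  rw [hb] at h1
  rw [← val_chart _ hz, ← val_chart s hz]
  exact (congrArg (fun e : N.sections U ≃ₐ[ℂ] M.sections U => M.val (e s) (chart j z))
    (hψ U hp)).symm.trans h1

theorem hasParity_iff {M : Supermanifold} {U : Opens (OnePoint ℂ)} {p : ZMod 2}
    {s : M.sections U} :
    M.HasParity p s ↔ ∀ j z, chart j z ∈ U → s.1.ext j z ∈ parityPart p := by
  have : ∀ j z (hz : chart j z ∈ U), s.1.ext j z = s.1 j ⟨z, hz⟩ := fun j z hz => by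
    rw [LocalPair.ext, dif_pos hz]
  constructor
  · intro h j z hz
    rw [this j z hz]
    exact h j ⟨z, hz⟩
  · intro h j z
    rw [← this j z z.2]
    exact h j z z.2

/-- The automorphisms which multiply the odd coordinates by a scalar. -/
theorem exists_dilation {N : Supermanifold} (hN : N.v = 0) (t : ℂ) :
    ∃ D : ∀ U, N.sections U →ₐ[ℂ] N.sections U,
      ∀ U s j z, chart j z ∈ U → (D U s).1.ext j z = elt (body (s.1.ext j z))
        (fun l => t * cL l (s.1.ext j z)) (fun l => t ^ 2 * cP l (s.1.ext j z))
        (t ^ 3 * cT (s.1.ext j z)) := by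
  let Φ : Fin 2 → LocalHom := fun _ => LocalHom.linear (fun _ => Matrix.diagonal fun _ => t)
    fun _ _ => differentiable_const _
  have hΦ : ∀ F : ℂ → Grassmann, ∀ x : ℂ, x ≠ 0 → (∀ᶠ t in nhds x⁻¹, DiffAt F t) →
      N.trans ((Φ 1).toFun F) x = (Φ 0).toFun (N.trans F) x := by
    intro F x _ _
    have h0 : ∀ (G : ℂ → Grassmann), N.trans G x = subst N.g G x := fun G => by
      rw [Supermanifold.trans, hN]
      simp [app]
    rw [h0]
    change gmap (N.g x) (gmap _ _) = gmap _ (N.trans F x)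
    rw [h0]
    change _ = gmap _ (gmap _ _)
    rw [gmap_mul, gmap_mul]
    congr 2
    ext i j
    simp [mul_comm]
  refine ⟨fun U => LocalHom.onSections (M := N) (N := N) Φ hΦ U, fun U s j z hz => ?_⟩
  have h1 : (LocalHom.onSections (M := N) (N := N) Φ hΦ U s).1.ext j z =
      gmap (Matrix.diagonal fun _ => t) (s.1.ext j z) :=
    (LocalHom.ext_onPair Φ s.1 hz).eq_of_nhds
  rw [h1]
  refine gext ?_ (fun i => ?_) (fun i => ?_) ?_
  · simp [body_gmap]
  · simp [cL_gmap, Matrix.diagonal_apply]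
  · rw [cP_gmap, cP_elt]
    fin_cases i <;> simp [Fin.sum_univ_three, sq]
  · simp [cT_gmap, Matrix.det_diagonal]

theorem eq_zero_of_hasParity {M : Supermanifold} {U : Opens (OnePoint ℂ)} {s : M.sections U}
    (h0 : M.HasParity 0 s) (h1 : M.HasParity 1 s) : s = 0 := by
  refine sections_ext fun j z hz => ?_
  have hz0 := ext_algebraMap (M := M) 0 hz
  rw [map_zero, zero_smul] at hz0
  have h0 := mem_parityPart_zero.1 (hasParity_iff.1 h0 j z hz)
  have h1 := mem_parityPart_one.1 (hasParity_iff.1 h1 j z hz)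
  rw [hz0]
  exact gext (by simp [h1.1]) (by simp [h0.1]) (by simp [h1.2]) (by simp [h0.2])

theorem HasParity.sub {M : Supermanifold} {U : Opens (OnePoint ℂ)} {s t : M.sections U} {p : ZMod 2}
    (hs : M.HasParity p s) (ht : M.HasParity p t) : M.HasParity p (s - t) := by
  rw [hasParity_iff] at *
  intro j z hz
  rw [ext_sub]
  exact Submodule.sub_mem _ (hs j z hz) (ht j z hz)

/-- Isomorphisms to a split supermanifold reflect the parity. -/
theorem hasParity_of_apply {M N : Supermanifold} (hN : N.v = 0) {U : Opens (OnePoint ℂ)}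
    (P : N.sections U ≃ₐ[ℂ] M.sections U)
    (hP : ∀ p s, N.HasParity p s → M.HasParity p (P s)) {s : N.sections U} {p : ZMod 2}
    (hs : M.HasParity p (P s)) : N.HasParity p s := by
  obtain ⟨D, hD⟩ := exists_dilation hN (-1)
  have hadd : N.HasParity 0 (s + D U s) := hasParity_iff.2 fun j z hz => by
    rw [ext_add, hD U s j z hz, mem_parityPart_zero]
    constructor
    · intro i; simp
    · simp; ring
  have hsub : N.HasParity 1 (s - D U s) := hasParity_iff.2 fun j z hz => by
    rw [ext_sub, hD U s j z hz, mem_parityPart_one]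
    constructor
    · simp
    · intro i; simp
  have h0 := hP _ _ hadd
  have h1 := hP _ _ hsub
  obtain rfl | rfl := zmod_two_eq p
  -- The dilation by `-1` splits `s` into an even and an odd section. The image of the odd one is
  -- odd, and it is also a difference of even sections, hence zero.
  · have h2 : s - D U s = 0 := by
      rw [← map_eq_zero_iff P P.injective]
      refine eq_zero_of_hasParity ?_ h1
      have e : P (s - D U s) = P s - (P (s + D U s) - P s) := by
        rw [map_sub, map_add]; abel
      rw [e]
      exact HasParity.sub hs (HasParity.sub h0 hs)
    rw [sub_eq_zero] at h2
    rw [hasParity_iff]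
    intro j z hz
    have h3 : _ = _ := congrArg (fun s : N.sections U => s.1.ext j z) h2
    have h4 := hD U s j z hz
    rw [← h3] at h4
    rw [mem_parityPart_zero]
    refine ⟨fun i => ?_, ?_⟩
    · have := congrArg (cL i) h4
      rw [cL_elt] at this
      linear_combination this / 2
    · have := congrArg cT h4
      rw [cT_elt] at this
      linear_combination this / 2
  · have h2 : s + D U s = 0 := by
      rw [← map_eq_zero_iff P P.injective]
      refine eq_zero_of_hasParity h0 ?_
      have e : P (s + D U s) = P s - (P (s - D U s) - P s) := by
        rw [map_sub, map_add]; abel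
      rw [e]
      exact HasParity.sub hs (HasParity.sub h1 hs)
    rw [hasParity_iff]
    intro j z hz
    have h3 : _ = _ := congrArg (fun s : N.sections U => s.1.ext j z) h2
    have h4 := hD U s j z hz
    have hz0 := ext_algebraMap (M := N) 0 hz
    rw [map_zero, zero_smul] at hz0
    rw [ext_add, h4, hz0] at h3
    rw [mem_parityPart_one]
    refine ⟨?_, fun i => ?_⟩
    · have := congrArg body h3
      rw [map_add, body_elt, map_zero] at this
      linear_combination this / 2
    · have := congrArg (cP i) h3
      rw [map_add, cP_elt, map_zero] at this
      linear_combination this / 2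

/-- The transition preserves parity in both directions: once the linear part or the body vanishes
near a point, the correction by `v` in degree three or two vanishes too, and only an invertible
factor remains. -/
theorem hasParity_of_chart {k : Fin 3 → ℤ} {v : EvenVF} {hv : IsT2 v {0}ᶜ}
    {U : Opens (OnePoint ℂ)} {i : Fin 2} (hU : U ≤ chartOpen i) {p : ZMod 2}
    {s : (glue k v hv).sections U} (h : ∀ z, chart i z ∈ U → s.1.ext i z ∈ parityPart p) :
    (glue k v hv).HasParity p s := by
  have key : ∀ x, x ≠ 0 → chart 0 x ∈ U →
      ((∀ᶠ t in nhds x, s.1.ext 0 t ∈ parityPart p) ∨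
        ∀ᶠ t in nhds x, s.1.ext 1 t⁻¹ ∈ parityPart p) →
      s.1.ext 0 x ∈ parityPart p ∧ s.1.ext 1 x⁻¹ ∈ parityPart p := by
    intro x hx hxU he
    have hd : ∀ t, t ≠ 0 → chart 0 t ∈ U → DiffAt (s.1.ext 1) t⁻¹ := fun t ht htU =>
      s.2.1 1 t⁻¹ (by rwa [chart_one_inv ht])
    obtain rfl | rfl := zmod_two_eq p
    · have hL : ∀ᶠ t in nhds x, ∀ l, cL l (s.1.ext 1 t⁻¹) = 0 := by
        rcases he with he | he
        · filter_upwards [he, eventually_mem hxU, eventually_ne_zero hx] with t ht htU ht' l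
          have h1 := (mem_parityPart_zero.1 ht).1 l
          rw [s.2.2 t ht' htU, cL_trans_glue ht'] at h1
          exact (mul_eq_zero.1 h1).resolve_left (zpow_ne_zero _ ht')
        · filter_upwards [he] with t ht using (mem_parityPart_zero.1 ht).1
      have hL0 : ∀ l, cL l (s.1.ext 0 x) = 0 := fun l => by
        rw [s.2.2 x hx hxU, cL_trans_glue hx, hL.self_of_nhds, mul_zero]
      have hder : ∀ l, deriv (fun t => t ^ (-k l) * cL l (s.1.ext 1 t⁻¹)) x = 0 := fun l => by
        have : (fun t => t ^ (-k l) * cL l (s.1.ext 1 t⁻¹)) =ᶠ[nhds x] fun _ => 0 := by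
          filter_upwards [hL] with t ht
          rw [ht, mul_zero]
        rw [this.deriv_eq, deriv_const]
      have hT : cT (s.1.ext 0 x) = x ^ (-(k 0 + k 1 + k 2)) * cT (s.1.ext 1 x⁻¹) := by
        rw [s.2.2 x hx hxU, cT_trans_glue hx (hd x hx hxU)]
        simp only [hder, hL.self_of_nhds, mul_zero, add_zero, Finset.sum_const_zero]
      rw [mem_parityPart_zero, mem_parityPart_zero]
      rcases he with he | he
      · have h0 := (mem_parityPart_zero.1 he.self_of_nhds).2
        exact ⟨⟨hL0, h0⟩, hL.self_of_nhds,
          (mul_eq_zero.1 (hT.symm.trans h0)).resolve_left (zpow_ne_zero _ hx)⟩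
      · have h0 := (mem_parityPart_zero.1 he.self_of_nhds).2
        exact ⟨⟨hL0, by rw [hT, h0, mul_zero]⟩, hL.self_of_nhds, h0⟩
    · have hB : ∀ᶠ t in nhds x, body (s.1.ext 1 t⁻¹) = 0 := by
        rcases he with he | he
        · filter_upwards [he, eventually_mem hxU, eventually_ne_zero hx] with t ht htU ht'
          have h1 := (mem_parityPart_one.1 ht).1
          rwa [s.2.2 t ht' htU, Supermanifold.body_trans _ _ ht'] at h1
        · filter_upwards [he] with t ht using (mem_parityPart_one.1 ht).1
      have hB0 : body (s.1.ext 0 x) = 0 := by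
        rw [s.2.2 x hx hxU, Supermanifold.body_trans _ _ hx, hB.self_of_nhds]
      have hder : deriv (fun t => body (s.1.ext 1 t⁻¹)) x = 0 := by
        have : (fun t => body (s.1.ext 1 t⁻¹)) =ᶠ[nhds x] fun _ => 0 := hB
        rw [this.deriv_eq, deriv_const]
      have hP : ∀ l, cP l (s.1.ext 0 x) = x ^ (-wt k l) * cP l (s.1.ext 1 x⁻¹) := fun l => by
        rw [s.2.2 x hx hxU, cP_trans_glue hx (hd x hx hxU), hder, mul_zero, add_zero]
      rw [mem_parityPart_one, mem_parityPart_one]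
      rcases he with he | he
      · have h0 := (mem_parityPart_one.1 he.self_of_nhds).2
        exact ⟨⟨hB0, h0⟩, hB.self_of_nhds, fun l =>
          (mul_eq_zero.1 ((hP l).symm.trans (h0 l))).resolve_left (zpow_ne_zero _ hx)⟩
      · have h0 := (mem_parityPart_one.1 he.self_of_nhds).2
        exact ⟨⟨hB0, fun l => by rw [hP, h0, mul_zero]⟩, hB.self_of_nhds, h0⟩
  rw [hasParity_iff]
  intro j z hz
  fin_cases i <;> fin_cases j
  · exact h z hz
  · have hne := chart_one_mem.1 (hU hz)
    have hz' : chart 0 z⁻¹ ∈ U := by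
      have := chart_one_inv (inv_ne_zero hne)
      rw [inv_inv] at this
      rwa [← this]
    have := (key z⁻¹ (inv_ne_zero hne) hz' (Or.inl ((eventually_mem hz').mono h))).2
    rwa [inv_inv] at this
  · have hne := chart_zero_mem.1 (hU hz)
    refine (key z hne hz (Or.inr ?_)).1
    filter_upwards [eventually_mem hz, eventually_ne_zero hne] with t ht ht'
    exact h t⁻¹ (by
      change chart 1 t⁻¹ ∈ U
      rwa [chart_one_inv ht'])
  · exact h z hz

/-- The split model is an arbitrary bundle, not assumed to be `diagMatrix k`, but it always admits
the dilation by 2. Its conjugate on the glued supermanifold satisfies the hypotheses of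
`isCoboundary_of_endo`. -/
theorem isCoboundary_of_isSplit {k : Fin 3 → ℤ} {v : EvenVF} {hv : IsT2 v {0}ᶜ}
    (h : (glue k v hv).IsSplit) : IsCoboundary k v := by
  obtain ⟨N, hN, h⟩ := h
  obtain ⟨P, hres, hpar, hbody⟩ := h.exists_family
  obtain ⟨D, hD⟩ := exists_dilation hN 2
  let M := glue k v hv
  have hres' : ∀ U V (hVU : V ≤ U) (s : M.sections U),
      N.res hVU ((P U).symm s) = (P V).symm (M.res hVU s) := fun U V hVU s => by
    rw [AlgEquiv.eq_symm_apply, ← hres, AlgEquiv.apply_symm_apply]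
  have hbody' : ∀ U (s : M.sections U) j z, chart j z ∈ U →
      body (((P U).symm s).1.ext j z) = body (s.1.ext j z) := fun U s j z hz => by
    rw [← hbody U _ j z hz, AlgEquiv.apply_symm_apply]
  have hpar' : ∀ U (s : M.sections U) p, M.HasParity p s → N.HasParity p ((P U).symm s) :=
    fun U s p hs => hasParity_of_apply hN (P U) (hpar U) (by rwa [AlgEquiv.apply_symm_apply])
  have hDpar : ∀ U (s : N.sections U) p, N.HasParity p s → N.HasParity p (D U s) :=
    fun U s p hs => by
      rw [hasParity_iff] at *
      intro j z hz
      have := hs j z hz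
      rw [hD U s j z hz]
      obtain rfl | rfl := zmod_two_eq p
      · rw [mem_parityPart_zero] at *
        simp [this.1, this.2]
      · rw [mem_parityPart_one] at *
        simp [this.1, this.2]
  have hDres : ∀ U V (hVU : V ≤ U) (s : N.sections U), N.res hVU (D U s) = D V (N.res hVU s) :=
    fun U V hVU s => sections_ext fun j z hz => by
      rw [ext_res _ _ hz, hD _ _ _ _ hz, hD _ _ _ _ (hVU hz), ext_res _ _ hz]
  let θ : ∀ U, M.sections U →ₐ[ℂ] M.sections U := fun U =>
    ((P U).toAlgHom.comp (D U)).comp (P U).symm.toAlgHom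
  have hθ : ∀ U s, θ U s = P U (D U ((P U).symm s)) := fun U s => rfl
  refine isCoboundary_of_endo θ (fun U V hVU s => ?_) (fun U s j z hz => ?_)
    (fun i X hX z l => ?_) fun i a Ξ hΞ z l => ?_
  · rw [hθ, hθ, hres, hDres, hres']
  · rw [hθ, hbody U _ j z hz, hD _ _ _ _ hz, body_elt, hbody' U s j z hz]
  · have hXpar : M.HasParity 0 X := hasParity_of_chart le_rfl fun w _ => by
      rw [hX, mem_parityPart_zero]
      simp
    have := hasParity_iff.1 (hpar _ _ _ (hDpar _ _ _ (hpar' _ X 0 hXpar))) i z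
      (chart_mem_chartOpen i z)
    exact (mem_parityPart_zero.1 this).1 l
  · have hΞpar : M.HasParity 1 Ξ := hasParity_of_chart le_rfl fun w _ => by
      rw [hΞ, mem_parityPart_one]
      simp
    choose Z hZ using fun c => exists_oddCoord k hv i c
    set s := (P _).symm Ξ with hs
    -- For odd `s` the dilation differs from doubling only in degree three, so `d` is annihilated by
    -- every section with zero body, in particular by the transported odd coordinates.
    set d := D _ s - (s + s) with hd
    have hspar := hasParity_iff.1 (hpar' _ _ _ hΞpar)
    have hds : ∀ c, d * (P _).symm (Z c) = 0 := fun c => sections_ext fun j w hw => by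
      have hz0 := ext_algebraMap (M := N) 0 hw
      rw [map_zero, zero_smul] at hz0
      have h1 := mem_parityPart_one.1 (hspar j w hw)
      have hb : body (((P _).symm (Z c)).1.ext j w) = 0 := by
        obtain ⟨t, rt⟩ := exists_chart_of_mem hw
        rw [hbody' _ _ _ _ hw, ← val_chart _ hw, ← rt, val_chart _ (chart_mem_chartOpen i t), hZ,
          body_ξ]
      rw [hz0, ext_mul, hd, ext_sub, ext_add, hD _ _ _ _ hw]
      rw [← hs] at h1
      refine gext ?_ (fun l => ?_) (fun l => ?_) ?_
      · simp [h1.1]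
      · simp [cL_mul, h1.1, two_mul]
      · simp [cP_mul, h1.1, h1.2, hb, two_mul]
      · simp [cT_mul, h1.1, h1.2, hb, two_mul]
    -- Being annihilated by all odd coordinates forces the linear and quadratic parts to vanish.
    -- Degree information thus passes through an isomorphism that is not assumed to respect the
    -- grading.
    have hPd : ∀ c, (P _ d).1.ext i z * ξ c = 0 := fun c => by
      have h1 := congrArg (P _) (hds c)
      rw [map_mul, map_zero, AlgEquiv.apply_symm_apply] at h1
      have hz0 := ext_algebraMap (M := M) 0 (chart_mem_chartOpen i z)
      rw [map_zero, zero_smul] at hz0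
      rw [← hZ c z, ← ext_mul, h1, hz0]
    have e : θ _ Ξ = P _ d + (Ξ + Ξ) := by
      rw [hθ, hd, map_sub, map_add, hs, AlgEquiv.apply_symm_apply]
      abel
    rw [e, ext_add, ext_add, hΞ]
    generalize (P _ d).1.ext i z = b at hPd
    have e01 := congrArg (cP 2) (hPd 0)
    have e02 := congrArg (cP 1) (hPd 0)
    have e12 := congrArg (cP 2) (hPd 1)
    have t0 := congrArg cT (hPd 0)
    have t1 := congrArg cT (hPd 1)
    have t2 := congrArg cT (hPd 2)
    simp [cP_mul, cT_mul] at e01 e02 e12 t0 t1 t2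
    have hL : cL l b = 0 := by
      fin_cases l
      exacts [e12, e01, e02]
    have hP : cP l b = 0 := by
      fin_cases l
      exacts [t0, t1, t2]
    constructor
    · rw [map_add, map_add, hL, cL_ξ]
      split_ifs <;> norm_num
    · rw [map_add, map_add, hP]
      simp

end SuperCP1
end

noncomputable section

namespace SuperCP1

/-! ### Normal forms of invariant cocycles -/

/-- The coefficients of `∂/∂x` of the cocycle `invariantVF k α β γ δ`. -/
def invariantP (α γ : ℂ) : Fin 3 → ℂ → ℂ :=
  ![fun x => γ * x ^ (-1 : ℤ), fun x => -γ * x ^ (-2 : ℤ), fun x => α * x ^ (-1 : ℤ)]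

/-- The coefficients of the `∂/∂ξ_l` of the cocycle `invariantVF k α β γ δ`. -/
def invariantQ (k : Fin 3 → ℤ) (α β γ δ : ℂ) : Fin 3 → ℂ → ℂ :=
  ![fun x => -β * x ^ (-1 : ℤ) + γ * k 0 / 3 * x ^ (-2 : ℤ),
    fun x => β * x ^ (-2 : ℤ) + -(2 * γ * k 0 / 3) * x ^ (-3 : ℤ),
    fun x => δ * x ^ (-1 : ℤ) + α * k 2 / 2 * x ^ (-2 : ℤ)]

/-- The linear combination of the cocycles `A, B, C, D` with the given coefficients. -/
def invariantVF (k : Fin 3 → ℤ) (α β γ δ : ℂ) : EvenVF :=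
  vec (invariantP α γ) (invariantQ k α β γ δ)

theorem isT2_invariantVF (k : Fin 3 → ℤ) (α β γ δ : ℂ) : IsT2 (invariantVF k α β γ δ) {0}ᶜ := by
  have h : ∀ (a : ℂ) (n : ℤ), ∀ z ∈ ({0}ᶜ : Set ℂ), DifferentiableAt ℂ (fun x => a * x ^ n) z :=
    fun a n z hz => ((hasDerivAt_zpow' n hz).const_mul a).differentiableAt
  refine isT2_vec (fun l z hz => ?_) fun l z hz => ?_
  · fin_cases l
    exacts [h _ _ z hz, h _ _ z hz, h _ _ z hz]
  · fin_cases l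
    exacts [(h _ _ z hz).add (h _ _ z hz), (h _ _ z hz).add (h _ _ z hz),
      (h _ _ z hz).add (h _ _ z hz)]

theorem pC_invariantVF (k : Fin 3 → ℤ) (α β γ δ : ℂ) :
    pC (invariantVF k α β γ δ) = invariantP α γ := by
  funext l x
  exact pC_vec _ _ l x

theorem qC_invariantVF (k : Fin 3 → ℤ) (α β γ δ : ℂ) :
    qC (invariantVF k α β γ δ) = invariantQ k α β γ δ := by
  funext l x
  exact qC_vec _ _ l x

theorem cocycleA_eq {k : Fin 3 → ℤ} {κ : ℤ} (h : k 2 = κ) :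
    cocycleA κ = invariantVF k 1 0 0 0 := by
  funext o x
  rcases o with _ | l
  · simp [cocycleA, invariantVF, vec, vf, elt, invariantP, Fin.sum_univ_three, ω]
  · fin_cases l <;>
      simp [cocycleA, invariantVF, vec, vf, elt, invariantQ, Ω, ← h, div_eq_mul_inv, zpow_neg]
    congr 1; ring

theorem cocycleB_eq (k : Fin 3 → ℤ) : cocycleB = invariantVF k 0 1 0 0 := by
  funext o x
  rcases o with _ | l
  · simp [cocycleB, invariantVF, vec, vf, elt, invariantP, Fin.sum_univ_three, ω]
  · fin_cases l <;>
      simp [cocycleB, invariantVF, vec, vf, elt, invariantQ, Ω, zpow_neg]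

theorem cocycleC_eq {k : Fin 3 → ℤ} {κ : ℤ} (h : k 0 = κ) :
    cocycleC κ = invariantVF k 0 0 1 0 := by
  funext o x
  rcases o with _ | l
  · simp [cocycleC, invariantVF, vec, vf, elt, invariantP, Fin.sum_univ_three, ω]
    rw [ξ_mul_swap 2 0]
    simp
  · fin_cases l <;>
      simp [cocycleC, invariantVF, vec, vf, elt, invariantQ, Ω, ← h, div_eq_mul_inv, zpow_neg] <;> congr 1 <;> ring

theorem cocycleD_eq (k : Fin 3 → ℤ) : cocycleD = invariantVF k 0 0 0 1 := by
  funext o x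
  rcases o with _ | l
  · simp [cocycleD, invariantVF, vec, vf, elt, invariantP, Fin.sum_univ_three, ω]
  · fin_cases l <;>
      simp [cocycleD, invariantVF, vec, vf, elt, invariantQ, Ω, zpow_neg]

/-- Slot 2 is handled by `pairCob_of_invariant` and slots 0 and 1 by `pairCob_of_invariant_pair`.
Invariance under `[e', f']` is not used, being a consequence of the other two. -/
theorem exists_isCoboundary_sub_invariantVF {k : Fin 3 → ℤ} (hk : k 0 = k 1) {v : EvenVF}
    (hv : IsT2 v {0}ᶜ) (h : IsSPrimeInvariant k v) :
    ∃ α β γ δ : ℂ, (wt k 2 ≠ 4 → α = 0) ∧ (wt k 0 ≠ 3 → β = 0) ∧ (wt k 0 ≠ 5 → γ = 0) ∧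
      (¬(wt k 2 = 2 ∧ k 2 = 0) → δ = 0) ∧
      IsCoboundary k (v + (-1 : ℂ) • invariantVF k α β γ δ) := by
  obtain ⟨he, hf, -⟩ := (isSPrimeInvariant_iff hk hv).1 h
  have hp : ∀ l, DifferentiableOn ℂ (pC v l) {0}ᶜ := fun l z hz =>
    (hv.diff_p hz l).differentiableWithinAt
  have hq : ∀ l, DifferentiableOn ℂ (qC v l) {0}ᶜ := fun l z hz =>
    (hv.diff_q hz l).differentiableWithinAt
  have hw : wt k 1 = wt k 0 := by simp [wt, hk, add_comm]
  have he0 := he 0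
  have he1 := he 1
  have he2 := he 2
  have hf0 := hf 0
  have hf1 := hf 1
  have hf2 := hf 2
  simp [hw, ← hk] at he0 he1 he2 hf0 hf1 hf2
  obtain ⟨α, δ, hα, hδ, h2⟩ := pairCob_of_invariant (hp 2) (hq 2) he2 (by simpa using hf2)
  obtain ⟨β, γ, hβ, hγ, h0, h1⟩ := pairCob_of_invariant_pair (hp 0) (hq 0) (hp 1) (hq 1) he0 he1
    (by simpa using hf0) (by simpa using hf1)
  refine ⟨α, β, γ, δ, hα, hβ, hγ, hδ, ?_⟩
  rw [isCoboundary_iff (hv.add ((isT2_invariantVF _ _ _ _ _).smul _))]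
  have hpC : ∀ l x, pC (v + (-1 : ℂ) • invariantVF k α β γ δ) l x =
      pC v l x - invariantP α γ l x := fun l x => by
    rw [← pC_invariantVF k α β γ δ]
    simp [pC, sub_eq_add_neg]
  have hqC : ∀ l x, qC (v + (-1 : ℂ) • invariantVF k α β γ δ) l x =
      qC v l x - invariantQ k α β γ δ l x := fun l x => by
    rw [← qC_invariantVF k α β γ δ]
    simp [qC, sub_eq_add_neg]
  intro l
  fin_cases l
  · refine h0.congr (fun x _ => ?_) fun x _ => ?_
    · rw [hpC]; simp [invariantP]; ring
    · rw [hqC]; simp [invariantQ]; ring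
  · change PairCob (wt k 1) (k 1) _ _
    rw [hw, ← hk]
    refine h1.congr (fun x _ => ?_) fun x _ => ?_
    · rw [hpC]; simp [invariantP]
    · rw [hqC]; simp [invariantQ]; ring
  · refine h2.congr (fun x _ => ?_) fun x _ => ?_
    · rw [hpC]; simp [invariantP]; ring
    · rw [hqC]; simp [invariantQ]; ring

/-- Each parameter is the coefficient of `x ^ (-1)` in one component, up to sign, and in the stated
weight this exponent lies in the gap of that component, or is the exceptional exponent of
`PairCob.lc_q_two`. -/
theorem eq_zero_of_isCoboundary_invariantVF {k : Fin 3 → ℤ} {α β γ δ : ℂ}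
    (h : IsCoboundary k (invariantVF k α β γ δ)) :
    (wt k 2 = 4 → α = 0) ∧ (wt k 0 = 3 → β = 0) ∧ (wt k 0 = 5 → γ = 0) ∧
      (wt k 2 = 2 → k 2 = 0 → δ = 0) := by
  rw [isCoboundary_iff (isT2_invariantVF _ _ _ _ _)] at h
  have h0 := h 0
  have h2 := h 2
  refine ⟨fun hm => ?_, fun hm => ?_, fun hm => ?_, fun hm hκ => ?_⟩
  · rw [hm] at h2
    have := h2.lc_p (n := -1) (by norm_num) (by norm_num)
    rw [pC_invariantVF] at this
    simpa [invariantP, lc_const_mul, lc_zpow, -Int.reduceNeg, -zpow_neg] using this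
  · rw [hm] at h0
    have := h0.lc_q (n := -1) (by norm_num) (by norm_num)
    rw [qC_invariantVF] at this
    simp only [invariantQ, Matrix.cons_val_zero] at this
    rw [lc_add_zpow, lc_const_mul, lc_zpow] at this
    · simpa using this
    · exact fun z hz => ((hasDerivAt_zpow' _ hz).const_mul _).differentiableAt.differentiableWithinAt
  · rw [hm] at h0
    have := h0.lc_p (n := -1) (by norm_num) (by norm_num)
    rw [pC_invariantVF] at this
    simpa [invariantP, lc_const_mul, lc_zpow, -Int.reduceNeg, -zpow_neg] using this
  · rw [hm, hκ] at h2
    have := h2.lc_q_two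
    rw [qC_invariantVF] at this
    simp only [invariantQ, Matrix.cons_val_two, Matrix.tail_cons, Matrix.head_cons] at this
    rw [lc_add_zpow, lc_const_mul, lc_zpow] at this
    · simpa using this
    · exact fun z hz => ((hasDerivAt_zpow' _ hz).const_mul _).differentiableAt.differentiableWithinAt

end SuperCP1
end

/-! ### Invariance of the normal forms. -/

noncomputable section

namespace SuperCP1

section
variable {k : Fin 3 → ℤ} {α β γ δ : ℂ}

theorem pairCob_of_const {m κ : ℤ} {p q : ℂ → ℂ} (a₀ b₀ a₁ b₁ : ℂ)
    (hp : ∀ x, x ≠ 0 → p x = a₀ + x ^ (2 - m) * a₁)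
    (hq : ∀ x, x ≠ 0 → q x = b₀ + x ^ (-m) * b₁ + κ * x ^ (1 - m) * a₁) : PairCob m κ p q :=
  ⟨fun _ => a₀, fun _ => b₀, fun _ => a₁, fun _ => b₁, differentiable_const _,
    differentiable_const _, differentiable_const _, differentiable_const _,
    fun x hx => ⟨hp x hx, hq x hx⟩⟩

theorem deriv_const_mul_zpow_add (a b : ℂ) (m n : ℤ) {x : ℂ} (hx : x ≠ 0) :
    deriv (fun x : ℂ => a * x ^ m + b * x ^ n) x =
      a * (m * x ^ (m - 1)) + b * (n * x ^ (n - 1)) :=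
  (((hasDerivAt_zpow' m hx).const_mul a).add ((hasDerivAt_zpow' n hx).const_mul b)).deriv

theorem deriv_invariantP (α γ : ℂ) (l : Fin 3) {x : ℂ} (hx : x ≠ 0) :
    deriv (invariantP α γ l) x =
      ![-γ * x ^ (-2 : ℤ), 2 * γ * x ^ (-3 : ℤ), -α * x ^ (-2 : ℤ)] l := by
  have h : ∀ (a : ℂ) (n : ℤ), deriv (fun x : ℂ => a * x ^ n) x = a * (n * x ^ (n - 1)) :=
    fun a n => ((hasDerivAt_zpow' n hx).const_mul a).deriv
  fin_cases l
  · refine (h _ _).trans ?_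
    norm_num
  · refine (h _ _).trans ?_
    norm_num
    ring
  · refine (h _ _).trans ?_
    norm_num

theorem deriv_invariantQ (k : Fin 3 → ℤ) (α β γ δ : ℂ) (l : Fin 3) {x : ℂ} (hx : x ≠ 0) :
    deriv (invariantQ k α β γ δ l) x =
      ![β * x ^ (-2 : ℤ) - 2 * γ * k 0 / 3 * x ^ (-3 : ℤ),
        -2 * β * x ^ (-3 : ℤ) + 2 * γ * k 0 * x ^ (-4 : ℤ),
        -δ * x ^ (-2 : ℤ) - α * k 2 * x ^ (-3 : ℤ)] l := by
  fin_cases l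
  · refine (deriv_const_mul_zpow_add _ _ _ _ hx).trans ?_
    norm_num [-zpow_neg]
    ring
  · refine (deriv_const_mul_zpow_add _ _ _ _ hx).trans ?_
    norm_num [-zpow_neg]
    ring
  · refine (deriv_const_mul_zpow_add _ _ _ _ hx).trans ?_
    norm_num [-zpow_neg]
    ring

/-- The brackets with the normal forms are sums of monomials at the ends of the gap, so constants
suffice as primitives. The weight conditions make the exponents match. -/
theorem isSPrimeInvariant_invariantVF (hk : k 0 = k 1) (hα : α = 0 ∨ wt k 2 = 4)
    (hβ : β = 0 ∨ wt k 0 = 3) (hγ : γ = 0 ∨ wt k 0 = 5) (hδ : δ = 0 ∨ wt k 2 = 2 ∧ k 2 = 0) :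
    IsSPrimeInvariant k (invariantVF k α β γ δ) := by
  have hw : wt k 1 = wt k 0 := by simp [wt, hk, add_comm]
  rw [isSPrimeInvariant_iff hk (isT2_invariantVF _ _ _ _ _), pC_invariantVF, qC_invariantVF]
  refine ⟨fun l => ?_, fun l => ?_, fun l => ?_⟩
  · fin_cases l
    · refine pairCob_of_const 0 0 0 0 (fun x hx => ?_) fun x hx => ?_
      · simp only [deriv_invariantP _ _ _ hx]
        simp [invariantP, -zpow_neg]
      · simp only [deriv_invariantQ _ _ _ _ _ _ hx]
        simp [invariantQ, -zpow_neg]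
        ring
    · refine pairCob_of_const 0 0 (2 * γ) (-2 * β) (fun x hx => ?_) fun x hx => ?_
      · simp only [deriv_invariantP _ _ _ hx]
        simp [-zpow_neg, hw]
        rcases hγ with h | h <;> simp [h, -zpow_neg]
        ring
      · simp only [deriv_invariantQ _ _ _ _ _ _ hx]
        simp [-zpow_neg, hw, ← hk]
        rcases hγ with h | h <;> rcases hβ with h' | h'
        all_goals first | (exfalso; omega) | skip
        all_goals simp [h, h', -zpow_neg]
        all_goals ring
    · refine pairCob_of_const 0 0 (-α) (-δ) (fun x hx => ?_) fun x hx => ?_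
      · simp only [deriv_invariantP _ _ _ hx]
        simp [-zpow_neg]
        rcases hα with h | h <;> simp [h, -zpow_neg]
        ring
      · simp only [deriv_invariantQ _ _ _ _ _ _ hx]
        simp [-zpow_neg]
        rcases hα with h | h <;> rcases hδ with h' | ⟨h', h''⟩
        all_goals first | (exfalso; omega) | skip
        all_goals simp [h, h', -zpow_neg]
        all_goals ring
  · fin_cases l
    · refine pairCob_of_const (-2 * γ) (2 * β) 0 0 (fun x hx => ?_) fun x hx => ?_
      · simp only [deriv_invariantP _ _ _ hx]
        simp [invariantP]
        rcases hγ with h | h <;> simp [h]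
        field_simp
        ring
      · simp only [deriv_invariantQ _ _ _ _ _ _ hx]
        simp [invariantP, invariantQ]
        rcases hγ with h | h <;> rcases hβ with h' | h'
        all_goals first | (exfalso; omega) | skip
        all_goals simp [h, h']
        all_goals field_simp
        all_goals ring
    · refine pairCob_of_const 0 0 0 0 (fun x hx => ?_) fun x hx => ?_
      · simp only [deriv_invariantP _ _ _ hx]
        simp [invariantP, hw]
        rcases hγ with h | h <;> simp [h]
        field_simp
        ring
      · simp only [deriv_invariantQ _ _ _ _ _ _ hx]
        simp [invariantP, invariantQ, hw, ← hk]
        rcases hγ with h | h <;> rcases hβ with h' | h'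
        all_goals first | (exfalso; omega) | skip
        all_goals simp [h, h']
        all_goals field_simp
        all_goals ring
    · refine pairCob_of_const (-α) (-δ) 0 0 (fun x hx => ?_) fun x hx => ?_
      · simp only [deriv_invariantP _ _ _ hx]
        simp [invariantP]
        rcases hα with h | h <;> simp [h]
        field_simp
        ring
      · simp only [deriv_invariantQ _ _ _ _ _ _ hx]
        simp [invariantP, invariantQ]
        rcases hα with h | h <;> rcases hδ with h' | ⟨h', h''⟩
        all_goals first | (exfalso; omega) | skip
        all_goals simp [h, h']
        all_goals field_simp
        all_goals ring
  · refine pairCob_of_const 0 0 0 0 (fun x hx => ?_) fun x hx => ?_ <;> fin_cases l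
    · simp only [deriv_invariantP _ _ _ hx]
      simp [invariantP]
      rcases hγ with h | h <;> simp [h]
      field_simp
      ring
    · simp only [deriv_invariantP _ _ _ hx]
      simp [invariantP, hw]
      rcases hγ with h | h <;> simp [h]
      field_simp
      ring
    · simp only [deriv_invariantP _ _ _ hx]
      simp [invariantP]
      rcases hα with h | h <;> simp [h]
      field_simp
      ring
    · simp only [deriv_invariantQ _ _ _ _ _ _ hx]
      simp [invariantQ]
      rcases hγ with h | h <;> rcases hβ with h' | h'
      all_goals first | (exfalso; omega) | skip
      all_goals simp [h, h']
      all_goals field_simp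
      all_goals ring
    · simp only [deriv_invariantQ _ _ _ _ _ _ hx]
      simp [invariantQ, hw]
      rcases hγ with h | h <;> rcases hβ with h' | h'
      all_goals first | (exfalso; omega) | skip
      all_goals simp [h, h']
      all_goals field_simp
      all_goals ring
    · simp only [deriv_invariantQ _ _ _ _ _ _ hx]
      simp [invariantQ]
      rcases hα with h | h <;> rcases hδ with h' | ⟨h', h''⟩
      all_goals first | (exfalso; omega) | skip
      all_goals simp [h, h']
      all_goals field_simp
      all_goals ring
end

end SuperCP1
end

noncomputable section

namespace SuperCP1

/-! ### Isomorphisms between the normal forms -/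

section
variable {k : Fin 3 → ℤ} {α β γ δ : ℂ}

theorem glue_invariantVF_isomorphicOverId_of_scale {a b α' β' γ' δ' : ℂ} (ha : a ≠ 0) (hb : b ≠ 0)
    (hα : α = a * α') (hβ : β = b * β') (hγ : γ = b * γ') (hδ : δ = a * δ') :
    (glue k _ (isT2_invariantVF k α β γ δ)).IsomorphicOverId
      (glue k _ (isT2_invariantVF k α' β' γ' δ')) := by
  -- Scaling `ξ 0`, `ξ 1` by `r` and `ξ 2` by `b / r` multiplies `ω 2` by `r² = a` and both `ω 0`
  -- and `ω 1` by `b`.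
  obtain ⟨r, hr⟩ := IsAlgClosed.exists_pow_nat_eq a (n := 2) two_pos
  have hr0 : r ≠ 0 := by
    rintro rfl
    exact ha (by rw [← hr]; simp)
  have h1 : r * (b / r) = b := mul_div_cancel₀ b hr0
  have h2 : b / r * r = b := div_mul_cancel₀ b hr0
  have h3 : r * r = a := by rw [← sq, hr]
  refine glue_isomorphicOverId_of_scale _ _ ![r, r, b / r] (fun i => ?_) (fun x _ j => ?_)
    fun x _ j => ?_
  · fin_cases i
    exacts [hr0, hr0, div_ne_zero hb hr0]
  · rw [pC_invariantVF, pC_invariantVF]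
    fin_cases j <;> simp [invariantP, h1, h2, h3, hα, hγ] <;> ring
  · rw [qC_invariantVF, qC_invariantVF]
    fin_cases j <;> simp [invariantQ, h1, h2, h3, hα, hβ, hγ, hδ] <;> ring

/-- Because `k 0 - k 2 = 1`, multiples of `ξ 2` by sections of `O(1)` can be added to `ξ 0` and `ξ
1`. Such a shear moves the `A` part by a multiple of `B` plus a coboundary, so `B` is absorbed. -/
theorem glue_invariantVF_isomorphicOverId_of_one (h0 : k 0 = 2) (h1 : k 1 = 2) (h2 : k 2 = 1)
    (hα : α ≠ 0) : (glue k _ (isT2_invariantVF k α β 0 0)).IsomorphicOverId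
      (glue k _ (isT2_invariantVF k α 0 0 0)) := by
  -- The size of the shear is chosen to cancel `β`; the factor `3 / 2` is found by comparing the `q`
  -- parts of slots 0 and 1.
  set s := 2 * β / (3 * α) with hs
  have hsα : s * α = 2 * β / 3 := by
    rw [hs]
    field_simp
  -- What the shear leaves over. It is a coboundary: in slot 0 it extends over the chart `x`, and in
  -- slot 1, of weight 3, it comes from the constant `a₁ = s * α` on the chart `y`.
  let w : EvenVF := vec ![fun _ => s * α, fun x => s * α * x ^ (-1 : ℤ), 0]
    ![0, fun x => 2 * (s * α) * x ^ (-2 : ℤ), 0]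
  have hw : IsT2 w {0}ᶜ := by
    have h : ∀ (a : ℂ) (n : ℤ), ∀ z ∈ ({0}ᶜ : Set ℂ), DifferentiableAt ℂ (fun x => a * x ^ n) z :=
      fun a n z hz => ((hasDerivAt_zpow' n hz).const_mul a).differentiableAt
    refine isT2_vec (fun l z hz => ?_) fun l z hz => ?_
    · fin_cases l
      exacts [differentiableAt_const _, h _ _ z hz, differentiableAt_const _]
    · fin_cases l
      exacts [differentiableAt_const _, h _ _ z hz, differentiableAt_const _]
  let v := invariantVF k α 0 0 0 + w
  have hv : IsT2 v {0}ᶜ := (isT2_invariantVF _ _ _ _ _).add hw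
  have hpv : ∀ l x, pC v l x = invariantP α 0 l x + pC w l x := fun l x => by
    rw [← pC_invariantVF k α 0 0 0]
    simp [pC, v]
  have hqv : ∀ l x, qC v l x = invariantQ k α 0 0 0 l x + qC w l x := fun l x => by
    rw [← qC_invariantVF k α 0 0 0]
    simp [qC, v]
  let B : ℂ → ℂ → Matrix (Fin 3) (Fin 3) ℂ := fun a b => !![1, 0, 0; 0, 1, 0; a, b, 1]
  refine Supermanifold.IsomorphicOverId.trans (glue_isomorphicOverId_of_linear (v' := v) _ hv
    (fun i t => if i = 0 then B (s * t) s else B s (s * t))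
    (fun i t => if i = 0 then B (-s * t) (-s) else B (-s) (-s * t)) (fun i a b => ?_)
    (fun i a b => ?_) (fun i t => ?_) (fun x hx => ?_) (fun x hx j => ?_) fun x hx j => ?_)
    (glue_isomorphicOverId_of_isCoboundary _ _ ?_)
  · fin_cases i <;> fin_cases a <;> fin_cases b <;> simp [B] <;> fun_prop
  · fin_cases i <;> fin_cases a <;> fin_cases b <;> simp [B] <;> fun_prop
  · ext a b
    fin_cases i <;> fin_cases a <;> fin_cases b <;> simp [B, Matrix.mul_apply, Fin.sum_univ_three]
  · ext a b
    fin_cases a <;> fin_cases b <;>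
      simp [B, diagMatrix, Matrix.mul_apply, Matrix.diagonal_apply, h0, h1, h2] <;>
      field_simp
  · rw [hpv, pC_invariantVF]
    fin_cases j <;> simp [B, Fin.sum_univ_three, Matrix.det_fin_three, invariantP, w] <;> field_simp
  · rw [hqv, qC_invariantVF, pC_invariantVF]
    fin_cases j <;>
      simp [B, Fin.sum_univ_three, Matrix.det_fin_three, invariantP, invariantQ, w, h0, h2,
        -zpow_neg]
    · rw [show β = 3 * (s * α) / 2 by rw [hsα]; ring]
      simp
      field_simp
      ring
    · rw [show β = 3 * (s * α) / 2 by rw [hsα]; ring]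
      simp
      field_simp
      ring
  · rw [isCoboundary_iff (hv.add ((isT2_invariantVF _ _ _ _ _).smul _))]
    have e : v + (-1 : ℂ) • invariantVF k α 0 0 0 = w := by
      simp [v]
    rw [e]
    intro l
    fin_cases l
    · refine pairCob_of_const (s * α) 0 0 0 (fun x hx => ?_) fun x hx => ?_
      · simp [w]
      · simp [w]
    · refine pairCob_of_const 0 0 (s * α) 0 (fun x hx => ?_) fun x hx => ?_
      · simp [w, wt, h0, h2, -zpow_neg]; ring
      · simp [w, wt, h0, h1, h2, -zpow_neg]; ring
    · refine pairCob_of_const 0 0 0 0 (fun x hx => ?_) fun x hx => ?_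
      · simp [w]
      · simp [w]

/-- Now `k 2 - k 0 = 1`, so multiples of `ξ 0` and `ξ 1` can be added to `ξ 2` instead. The shear
moves the `C` part by a multiple of `A`, without any coboundary correction. -/
theorem glue_invariantVF_isomorphicOverId_of_three (h0 : k 0 = 2) (h1 : k 1 = 2) (h2 : k 2 = 3)
    (hγ : γ ≠ 0) : (glue k _ (isT2_invariantVF k α 0 γ 0)).IsomorphicOverId
      (glue k _ (isT2_invariantVF k 0 0 γ 0)) := by
  set s := -α / (2 * γ) with hs
  have hsα : α = -2 * (s * γ) := by
    rw [hs]
    field_simp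
  let B : ℂ → ℂ → Matrix (Fin 3) (Fin 3) ℂ := fun a b => !![1, 0, a; 0, 1, b; 0, 0, 1]
  refine glue_isomorphicOverId_of_linear _ _
    (fun i t => if i = 0 then B s (-s * t) else B (s * t) (-s))
    (fun i t => if i = 0 then B (-s) (s * t) else B (-s * t) s) (fun i a b => ?_)
    (fun i a b => ?_) (fun i t => ?_) (fun x hx => ?_) (fun x hx j => ?_) fun x hx j => ?_
  · fin_cases i <;> fin_cases a <;> fin_cases b <;> simp [B] <;> fun_prop
  · fin_cases i <;> fin_cases a <;> fin_cases b <;> simp [B] <;> fun_prop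
  · ext a b
    fin_cases i <;> fin_cases a <;> fin_cases b <;> simp [B, Matrix.mul_apply, Fin.sum_univ_three]
  · ext a b
    fin_cases a <;> fin_cases b <;>
      simp [B, diagMatrix, Matrix.mul_apply, Matrix.diagonal_apply, h0, h1, h2] <;>
      field_simp
  · rw [pC_invariantVF, pC_invariantVF]
    fin_cases j <;> simp [B, Fin.sum_univ_three, Matrix.det_fin_three, invariantP]
    rw [hsα]
    field_simp
    ring
  · rw [qC_invariantVF, qC_invariantVF, pC_invariantVF]
    fin_cases j <;>
      simp [B, Fin.sum_univ_three, Matrix.det_fin_three, invariantP, invariantQ, h0, h2]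
    rw [hsα]
    field_simp
    ring
end

end SuperCP1
end

noncomputable section

namespace SuperCP1

/-! ### The classification -/

section
variable {k : Fin 3 → ℤ} {α β γ δ : ℂ}

theorem isSplit_of_isCoboundary {v : EvenVF} (hv : IsT2 v {0}ᶜ) (h : IsCoboundary k v) :
    (glue k v hv).IsSplit :=
  ⟨glue k 0 (isT2_zero _), rfl, glue_isomorphicOverId_of_isCoboundary _ _ (by simpa using h)⟩

theorem Supermanifold.IsSplit.of_isomorphicOverId {M N : Supermanifold} (hN : N.IsSplit)
    (h : M.IsomorphicOverId N) : M.IsSplit := by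
  obtain ⟨P, hP, hNP⟩ := hN
  exact ⟨P, hP, h.trans hNP⟩

theorem classifiedBy_of (hk : k 0 = k 1) {n : ℕ} {c : Fin n → EvenVF} (hc : ∀ i, IsT2 (c i) {0}ᶜ)
    (hinv : ∀ i, IsSPrimeInvariant k (c i)) (hns : ∀ i, ¬ IsCoboundary k (c i))
    (hni : ∀ i j, i ≠ j → ¬ (glue k (c i) (hc i)).Isomorphic (glue k (c j) (hc j)))
    (hcl : ∀ α β γ δ : ℂ, (wt k 2 ≠ 4 → α = 0) → (wt k 0 ≠ 3 → β = 0) → (wt k 0 ≠ 5 → γ = 0) →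
      (¬(wt k 2 = 2 ∧ k 2 = 0) → δ = 0) → ¬(α = 0 ∧ β = 0 ∧ γ = 0 ∧ δ = 0) →
      ∃ i, (glue k _ (isT2_invariantVF k α β γ δ)).IsomorphicOverId (glue k (c i) (hc i))) :
    ClassifiedBy k c := by
  -- The first reflexivity is the statement on retracts: the retract of a glued supermanifold is
  -- definitionally the one glued by the zero cocycle.
  refine ⟨hc, hinv, fun i => ⟨.refl _, c i, hc i, hinv i, .refl _⟩,
    fun i h => hns i (isCoboundary_of_isSplit h), hni, ?_⟩
  rintro M ⟨-, v, hv, hinv, hM⟩ hMs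
  obtain ⟨α, β, γ, δ, hα, hβ, hγ, hδ, h⟩ := exists_isCoboundary_sub_invariantVF hk hv hinv
  have hM' : M.IsomorphicOverId (glue k _ (isT2_invariantVF k α β γ δ)) :=
    hM.trans (glue_isomorphicOverId_of_isCoboundary _ _ h)
  obtain ⟨i, hi⟩ := hcl α β γ δ hα hβ hγ hδ (by
    rintro ⟨rfl, rfl, rfl, rfl⟩
    refine hMs ((isSplit_of_isCoboundary _ ?_).of_isomorphicOverId hM')
    refine (isCoboundary_zero k).congr fun o x _ => ?_
    rw [(isT2_invariantVF k 0 0 0 0).eq_vec (W := {0}ᶜ) (by assumption), pC_invariantVF,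
      qC_invariantVF]
    rcases o with _ | l
    · simp [vec, vf, elt, invariantP, Fin.sum_univ_three]
    · fin_cases l <;> simp [vec, vf, elt, invariantQ])
  exact ⟨i, hM'.trans hi⟩

theorem classifiedBy_single (hk : k 0 = k 1) {α₀ β₀ γ₀ δ₀ : ℂ}
    (hα₀ : α₀ = 0 ∨ wt k 2 = 4) (hβ₀ : β₀ = 0 ∨ wt k 0 = 3) (hγ₀ : γ₀ = 0 ∨ wt k 0 = 5)
    (hδ₀ : δ₀ = 0 ∨ wt k 2 = 2 ∧ k 2 = 0) (h0 : ¬(α₀ = 0 ∧ β₀ = 0 ∧ γ₀ = 0 ∧ δ₀ = 0))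
    (hcl : ∀ α β γ δ : ℂ, (wt k 2 ≠ 4 → α = 0) → (wt k 0 ≠ 3 → β = 0) → (wt k 0 ≠ 5 → γ = 0) →
      (¬(wt k 2 = 2 ∧ k 2 = 0) → δ = 0) → ¬(α = 0 ∧ β = 0 ∧ γ = 0 ∧ δ = 0) →
      ∃ a b : ℂ, a ≠ 0 ∧ b ≠ 0 ∧ α = a * α₀ ∧ β = b * β₀ ∧ γ = b * γ₀ ∧ δ = a * δ₀) :
    ClassifiedBy k ![invariantVF k α₀ β₀ γ₀ δ₀] := by
  refine classifiedBy_of hk (fun i => ?_) (fun i => ?_) (fun i => ?_) (fun i j hij => ?_)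
    fun α β γ δ h1 h2 h3 h4 h => ⟨0, ?_⟩
  · fin_cases i
    exact isT2_invariantVF _ _ _ _ _
  · fin_cases i
    exact isSPrimeInvariant_invariantVF hk hα₀ hβ₀ hγ₀ hδ₀
  · fin_cases i
    intro hc
    obtain ⟨h1, h2, h3, h4⟩ := eq_zero_of_isCoboundary_invariantVF hc
    exact h0 ⟨hα₀.elim id h1, hβ₀.elim id h2, hγ₀.elim id h3, hδ₀.elim id fun h => h4 h.1 h.2⟩
  · exact absurd (Subsingleton.elim i j) hij
  · obtain ⟨a, b, ha, hb, h1, h2, h3, h4⟩ := hcl α β γ δ h1 h2 h3 h4 h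
    exact glue_invariantVF_isomorphicOverId_of_scale ha hb h1 h2 h3 h4

theorem Supermanifold.Isomorphic.nonempty_preIso {M N : Supermanifold} (h : M.Isomorphic N) :
    Nonempty (PreIso M N) := by
  obtain ⟨φ⟩ := h
  obtain ⟨ψ, -⟩ := exists_preIso φ
  exact ⟨ψ⟩

theorem not_isomorphic_of_isEmpty_preIso {c : Fin 2 → EvenVF} (hc : ∀ i, IsT2 (c i) {0}ᶜ)
    (h : IsEmpty (PreIso (glue k (c 0) (hc 0)) (glue k (c 1) (hc 1)))) (i j : Fin 2) (hij : i ≠ j) :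
    ¬ (glue k (c i) (hc i)).Isomorphic (glue k (c j) (hc j)) := by
  intro hi
  obtain ⟨φ⟩ := hi.nonempty_preIso
  fin_cases i <;> fin_cases j
  exacts [hij rfl, h.false φ, h.false φ.symm, hij rfl]

theorem classifiedBy_pair (hk : k 0 = k 1) {α₀ β₀ γ₀ δ₀ α₁ β₁ γ₁ δ₁ : ℂ}
    (hinv₀ : IsSPrimeInvariant k (invariantVF k α₀ β₀ γ₀ δ₀))
    (hinv₁ : IsSPrimeInvariant k (invariantVF k α₁ β₁ γ₁ δ₁))
    (hns₀ : ¬ IsCoboundary k (invariantVF k α₀ β₀ γ₀ δ₀))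
    (hns₁ : ¬ IsCoboundary k (invariantVF k α₁ β₁ γ₁ δ₁))
    (h : IsEmpty (PreIso (glue k _ (isT2_invariantVF k α₀ β₀ γ₀ δ₀))
      (glue k _ (isT2_invariantVF k α₁ β₁ γ₁ δ₁))))
    (hcl : ∀ α β γ δ : ℂ, (wt k 2 ≠ 4 → α = 0) → (wt k 0 ≠ 3 → β = 0) → (wt k 0 ≠ 5 → γ = 0) →
      (¬(wt k 2 = 2 ∧ k 2 = 0) → δ = 0) → ¬(α = 0 ∧ β = 0 ∧ γ = 0 ∧ δ = 0) →
      (glue k _ (isT2_invariantVF k α β γ δ)).IsomorphicOverId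
        (glue k _ (isT2_invariantVF k α₀ β₀ γ₀ δ₀)) ∨
      (glue k _ (isT2_invariantVF k α β γ δ)).IsomorphicOverId
        (glue k _ (isT2_invariantVF k α₁ β₁ γ₁ δ₁))) :
    ClassifiedBy k ![invariantVF k α₀ β₀ γ₀ δ₀, invariantVF k α₁ β₁ γ₁ δ₁] := by
  have hc : ∀ i, IsT2 ((![invariantVF k α₀ β₀ γ₀ δ₀, invariantVF k α₁ β₁ γ₁ δ₁] :
      Fin 2 → EvenVF) i) {0}ᶜ := fun i => by
    fin_cases i
    exacts [isT2_invariantVF _ _ _ _ _, isT2_invariantVF _ _ _ _ _]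
  refine classifiedBy_of hk hc (fun i => ?_) (fun i => ?_)
    (not_isomorphic_of_isEmpty_preIso hc h) fun α β γ δ h1 h2 h3 h4 h => ?_
  · fin_cases i
    exacts [hinv₀, hinv₁]
  · fin_cases i
    exacts [hns₀, hns₁]
  · rcases hcl α β γ δ h1 h2 h3 h4 h with h | h
    exacts [⟨0, h⟩, ⟨1, h⟩]

theorem classifiedBy_two_two_one : ClassifiedBy ![2, 2, 1] ![cocycleA 1, cocycleB] := by
  rw [cocycleA_eq (k := ![2, 2, 1]) (κ := 1) rfl, cocycleB_eq ![2, 2, 1]]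
  have hw2 : wt ![2, 2, 1] 2 = 4 := rfl
  have hw0 : wt ![2, 2, 1] 0 = 3 := rfl
  refine classifiedBy_pair rfl
    (isSPrimeInvariant_invariantVF rfl (.inr hw2) (.inl rfl) (.inl rfl) (.inl rfl))
    (isSPrimeInvariant_invariantVF rfl (.inl rfl) (.inr hw0) (.inl rfl) (.inl rfl))
    (fun h => one_ne_zero ((eq_zero_of_isCoboundary_invariantVF h).1 hw2))
    (fun h => one_ne_zero ((eq_zero_of_isCoboundary_invariantVF h).2.1 hw0)) ⟨fun φ => ?_⟩
    fun α β γ δ _ _ hγ hδ h => ?_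
  · obtain ⟨a₀, a₁, h0, h1, ha⟩ := φ.exists_splitting_zero (fun l x _ => by
      change pC (invariantVF _ _ _ _ _) l x = 0
      rw [pC_invariantVF]
      fin_cases l <;> simp [invariantP]) 2
    -- Only the `p` equation is known, so it is completed by a trivial `q` part with `κ = 0` in
    -- order to apply `PairCob.lc_p`; the coefficient of `x ^ (-1)` gives the contradiction.
    have hp : PairCob 4 0 (pC (invariantVF ![2, 2, 1] 1 0 0 0) 2) 0 :=
      ⟨a₀, 0, a₁, 0, h0, differentiable_const _, h1, differentiable_const _,
        fun x hx => ⟨ha x hx, by simp⟩⟩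
    have := hp.lc_p (n := -1) (by norm_num) (by norm_num)
    rw [pC_invariantVF] at this
    simp [invariantP, lc_zpow, -Int.reduceNeg, -zpow_neg] at this
  · obtain rfl := hγ (by rw [hw0]; norm_num)
    obtain rfl := hδ (by rw [hw2]; norm_num)
    by_cases hα : α = 0
    · subst hα
      have hβ : β ≠ 0 := fun h' => h ⟨rfl, h', rfl, rfl⟩
      exact .inr (glue_invariantVF_isomorphicOverId_of_scale one_ne_zero hβ (by simp) (by simp)
        (by simp) (by simp))
    · exact .inl ((glue_invariantVF_isomorphicOverId_of_one rfl rfl rfl hα).trans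
        (glue_invariantVF_isomorphicOverId_of_scale hα one_ne_zero (by simp) (by simp)
          (by simp) (by simp)))

theorem classifiedBy_two_two_three : ClassifiedBy ![2, 2, 3] ![cocycleA 3, cocycleC 2] := by
  rw [cocycleA_eq (k := ![2, 2, 3]) (κ := 3) rfl, cocycleC_eq (k := ![2, 2, 3]) (κ := 2) rfl]
  have hw2 : wt ![2, 2, 3] 2 = 4 := rfl
  have hw0 : wt ![2, 2, 3] 0 = 5 := rfl
  refine classifiedBy_pair rfl
    (isSPrimeInvariant_invariantVF rfl (.inr hw2) (.inl rfl) (.inl rfl) (.inl rfl))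
    (isSPrimeInvariant_invariantVF rfl (.inl rfl) (.inl rfl) (.inr hw0) (.inl rfl))
    (fun h => one_ne_zero ((eq_zero_of_isCoboundary_invariantVF h).1 hw2))
    (fun h => one_ne_zero ((eq_zero_of_isCoboundary_invariantVF h).2.2.1 hw0)) ⟨fun φ => ?_⟩
    fun α β γ δ _ hβ _ hδ h => ?_
  -- The inverse isomorphism is used: the supermanifold of `A`, with its single slot 2, must be the
  -- target, so that the cocycle `C` of the source is the one to be split.
  · obtain ⟨a₀, a₁, h0, h1, ha⟩ := φ.symm.exists_splitting_of_slot_two rfl rfl rfl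
      (fun x _ => by rw [pC_invariantVF]; simp [invariantP])
      (fun x _ => by rw [pC_invariantVF]; simp [invariantP])
    have hp : PairCob 5 0 (pC (invariantVF ![2, 2, 3] 0 0 1 0) 0) 0 :=
      ⟨a₀, 0, a₁, 0, h0, differentiable_const _, h1, differentiable_const _,
        fun x hx => ⟨ha x hx, by simp⟩⟩
    have := hp.lc_p (n := -1) (by norm_num) (by norm_num)
    rw [pC_invariantVF] at this
    simp [invariantP, lc_zpow, -Int.reduceNeg, -zpow_neg] at this
  · obtain rfl := hβ (by rw [hw0]; norm_num)
    obtain rfl := hδ (by rw [hw2]; norm_num)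
    by_cases hγ : γ = 0
    · subst hγ
      have hα : α ≠ 0 := fun h' => h ⟨h', rfl, rfl, rfl⟩
      exact .inl (glue_invariantVF_isomorphicOverId_of_scale hα one_ne_zero (by simp) (by simp)
        (by simp) (by simp))
    · exact .inr ((glue_invariantVF_isomorphicOverId_of_three rfl rfl rfl hγ).trans
        (glue_invariantVF_isomorphicOverId_of_scale one_ne_zero hγ (by simp) (by simp)
          (by simp) (by simp)))

theorem classifiedBy_cocycleA {κ : ℤ} (h1 : κ ≠ 1) (h3 : κ ≠ 3) :
    ClassifiedBy ![2, 2, κ] ![cocycleA κ] := by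
  rw [cocycleA_eq (k := ![2, 2, κ]) (κ := κ) rfl]
  have hw2 : wt ![2, 2, κ] 2 = 4 := rfl
  have hw0 : wt ![2, 2, κ] 0 = 2 + κ := rfl
  refine classifiedBy_single rfl (.inr hw2) (.inl rfl) (.inl rfl) (.inl rfl) (by simp)
    fun α β γ δ _ hβ hγ hδ h => ?_
  obtain rfl := hβ (by omega)
  obtain rfl := hγ (by omega)
  obtain rfl := hδ (by omega)
  exact ⟨α, 1, fun h' => h ⟨h', rfl, rfl, rfl⟩, one_ne_zero, by simp, by simp, by simp, by simp⟩

theorem classifiedBy_cocycleB {κ : ℤ} (h2 : κ ≠ 2) :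
    ClassifiedBy ![κ, κ, 3 - κ] ![cocycleB] := by
  rw [cocycleB_eq ![κ, κ, 3 - κ]]
  have hw2 : wt ![κ, κ, 3 - κ] 2 = κ + κ := rfl
  have hw0 : wt ![κ, κ, 3 - κ] 0 = κ + (3 - κ) := rfl
  have hk2 : (![κ, κ, 3 - κ] : Fin 3 → ℤ) 2 = 3 - κ := rfl
  refine classifiedBy_single rfl (.inl rfl) (.inr (by omega)) (.inl rfl) (.inl rfl) (by simp)
    fun α β γ δ hα _ hγ hδ h => ?_
  obtain rfl := hα (by omega)
  obtain rfl := hγ (by omega)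
  obtain rfl := hδ (by omega)
  exact ⟨1, β, one_ne_zero, fun h' => h ⟨rfl, h', rfl, rfl⟩, by simp, by simp, by simp, by simp⟩

theorem classifiedBy_cocycleC {κ : ℤ} (h2 : κ ≠ 2) :
    ClassifiedBy ![κ, κ, 5 - κ] ![cocycleC κ] := by
  rw [cocycleC_eq (k := ![κ, κ, 5 - κ]) (κ := κ) rfl]
  have hw2 : wt ![κ, κ, 5 - κ] 2 = κ + κ := rfl
  have hw0 : wt ![κ, κ, 5 - κ] 0 = κ + (5 - κ) := rfl
  have hk2 : (![κ, κ, 5 - κ] : Fin 3 → ℤ) 2 = 5 - κ := rfl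
  refine classifiedBy_single rfl (.inl rfl) (.inl rfl) (.inr (by omega)) (.inl rfl) (by simp)
    fun α β γ δ hα hβ _ hδ h => ?_
  obtain rfl := hα (by omega)
  obtain rfl := hβ (by omega)
  obtain rfl := hδ (by omega)
  exact ⟨1, γ, one_ne_zero, fun h' => h ⟨rfl, rfl, h', rfl⟩, by simp, by simp, by simp, by simp⟩

theorem classifiedBy_cocycleD : ClassifiedBy ![1, 1, 0] ![cocycleD] := by
  rw [cocycleD_eq ![1, 1, 0]]
  have hw2 : wt ![1, 1, 0] 2 = 2 := rfl
  have hw0 : wt ![1, 1, 0] 0 = 1 := rfl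
  refine classifiedBy_single rfl (.inl rfl) (.inl rfl) (.inl rfl) (.inr ⟨hw2, rfl⟩) (by simp)
    fun α β γ δ hα hβ hγ _ h => ?_
  obtain rfl := hα (by omega)
  obtain rfl := hβ (by omega)
  obtain rfl := hγ (by omega)
  exact ⟨δ, 1, fun h' => h ⟨rfl, rfl, rfl, h'⟩, one_ne_zero, by simp, by simp, by simp, by simp⟩
end

end SuperCP1
end

theorem mainTheorem3 :
    SuperCP1.ClassifiedBy ![2, 2, 1] ![SuperCP1.cocycleA 1, SuperCP1.cocycleB] ∧
    SuperCP1.ClassifiedBy ![2, 2, 3] ![SuperCP1.cocycleA 3, SuperCP1.cocycleC 2] ∧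
    (∀ k : ℤ, k ≠ 1 → k ≠ 3 → SuperCP1.ClassifiedBy ![2, 2, k] ![SuperCP1.cocycleA k]) ∧
    (∀ k : ℤ, k ≠ 2 → SuperCP1.ClassifiedBy ![k, k, 3 - k] ![SuperCP1.cocycleB]) ∧
    (∀ k : ℤ, k ≠ 2 → SuperCP1.ClassifiedBy ![k, k, 5 - k] ![SuperCP1.cocycleC k]) ∧
    SuperCP1.ClassifiedBy ![1, 1, 0] ![SuperCP1.cocycleD] :=
  ⟨SuperCP1.classifiedBy_two_two_one, SuperCP1.classifiedBy_two_two_three,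
    fun _ h1 h3 => SuperCP1.classifiedBy_cocycleA h1 h3, fun _ h => SuperCP1.classifiedBy_cocycleB h,
    fun _ h => SuperCP1.classifiedBy_cocycleC h, SuperCP1.classifiedBy_cocycleD⟩
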